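/- Let $d\ge 2$ and let $\Omega\subset\mathbb{R}^d$ be a bounded Lipschitz domain, that is, a bounded open set with finitely many connected components whose boundary is locally the graph of a Lipschitz function with $\Omega$ lying on one side of the graph. Let $\operatorname{tr}:H^1(\Omega)\to L^2(\partial\Omega)$ be the trace operator and $\sigma$ the surface measure on $\partial\Omega$; all function spaces are complex. An operator in a Hilbert space $H$ is said to be associated with a sesquilinear form $a$ with dense domain $D(a)\subset H$ if its domain consists of the $u\in D(a)$ for which there is $h\in H$ with $a[u,v]=(h,v)_H$ for all $v\in D(a)$, and it maps $u$ to $h$. For $\alpha\in\mathbb{C}$ let the Robin Laplacian $-\Delta_\Omega^\alpha$ be the operator in $L^2(\Omega)$ associated with $$a_\alpha[u,v]=\int_\Omega\nabla u\cdot\overline{\nabla v}\,dx+\int_{\partial\Omega}\alpha\,\operatorname{tr}u\,\overline{\operatorname{tr}v}\,d\sigma,\qquad u,v\in H^1(\Omega),$$ and let the Dirichlet Laplacian $-\Delta_\Omega^D$ be the operator in $L^2(\Omega)$ associated with the restriction of $a_0$ to $H^1_0(\Omega)$. For $\lambda\in\mathbb{C}$ let $H^1(\lambda)$ be the space of those $u\in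 H^1(\Omega)$ that satisfy $\int_\Omega\nabla u\cdot\overline{\nabla v}\,dx=\lambda\int_\Omega u\overline v\,dx$ for all $v\in H^1_0(\Omega)$. For $\lambda$ in the resolvent set $\rho(-\Delta_\Omega^D)$ let $P(\lambda)$ map $g\in H^{1/2}(\partial\Omega)=\operatorname{tr}H^1(\Omega)$ to the unique $u\in H^1(\lambda)$ with $\operatorname{tr}u=g$, and let the Dirichlet-to-Neumann operator $M(\lambda)$ be the operator in $L^2(\partial\Omega)$ associated with $-q_\lambda$, where $$q_\lambda[g,h]=\int_\Omega\nabla P(\lambda)g\cdot\overline{\nabla P(\lambda)h}-\lambda\,P(\lambda)g\,\overline{P(\lambda)h}\,dx,\qquad g,h\in H^{1/2}(\partial\Omega).$$ Then for every $\alpha\in\mathbb{C}$ and every $\lambda\in\rho(-\Delta_\Omega^D)$: 1. $\lambda\in\sigma(-\Delta_\Omega^\alpha)$ if and only if $\alpha\in\sigma(M(\lambda))$; 2. $\lambda$ is an eigenvalue of $-\Delta_\Omega^\alpha$ if and only if $\alpha$ is an eigenvalue of $M(\lambda)$; 3. a function $u\in H^1(\Omega)$ is an eigenfunction of $-\Delta_\Omega^\alpha$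 corresponding to $\lambda$ if and only if $u\in H^1(\lambda)$ and $\operatorname{tr}u$ is an eigenfunction of $M(\lambda)$ corresponding to $\alpha$. -/

import Mathlib

open MeasureTheory
open scoped ContDiff InnerProductSpace Topology

noncomputable section

namespace RobinDN

/-! ## Unbounded operators associated with sesquilinear forms -/

section Operators

variable {H V : Type*} [NormedAddCommGroup H] [InnerProductSpace ℂ H] [AddCommGroup V] [Module ℂ V]

/-- The pairs `(u, h)` with `u ∈ D(a)` and `a[u, v] = (h, v)` for all `v ∈ D(a)`. The form domain is
given as a vector space `V` with its embedding `j` into `H`; forms are linear in the first and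
conjugate linear in the second variable, so `(h, v)` is Mathlib's `⟪v, h⟫`. -/
def formGraph (j : V →ₗ[ℂ] H) (a : V →ₗ[ℂ] V →ₗ⋆[ℂ] ℂ) : Submodule ℂ (H × H) where
  carrier := {p | ∃ x : V, j x = p.1 ∧ ∀ y : V, a x y = ⟪j y, p.2⟫_ℂ}
  zero_mem' := ⟨0, by simp⟩
  add_mem' := by
    rintro p q ⟨x, hx, hx'⟩ ⟨y, hy, hy'⟩
    exact ⟨x + y, by simp [hx, hy], fun z => by simp [hx', hy']⟩
  smul_mem' := by
    rintro c p ⟨x, hx, hx'⟩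
    exact ⟨c • x, by simp [hx], fun z => by simp [hx']⟩

/-- The operator in `H` associated with the (densely defined) form `a`. -/
def formOperator (j : V →ₗ[ℂ] H) (a : V →ₗ[ℂ] V →ₗ⋆[ℂ] ℂ) : H →ₗ.[ℂ] H :=
  (formGraph j a).toLinearPMap

/-- `z ∈ ρ(A)`: the operator `A - z` is a bijection from `D(A)` onto `H` with bounded inverse `R`. -/
def resolventSet (A : H →ₗ.[ℂ] H) : Set ℂ :=
  {z | ∃ R : H →L[ℂ] H,
    (∀ f : H, ∃ h : R f ∈ A.domain, A ⟨R f, h⟩ - z • R f = f) ∧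
    ∀ u : A.domain, R (A u - z • (u : H)) = u}

/-- The spectrum `σ(A) = ℂ \ ρ(A)`. -/
def opSpectrum (A : H →ₗ.[ℂ] H) : Set ℂ := (resolventSet A)ᶜ

/-- `u` is an eigenfunction of `A` corresponding to `z`. -/
def IsEigenfunction (A : H →ₗ.[ℂ] H) (z : ℂ) (u : H) : Prop :=
  u ≠ 0 ∧ ∃ h : u ∈ A.domain, A ⟨u, h⟩ = z • u

/-- `z` is an eigenvalue of `A`. -/
def IsEigenvalue (A : H →ₗ.[ℂ] H) (z : ℂ) : Prop := ∃ u : H, IsEigenfunction A z u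

/-- The form `(u, v) ↦ (T u, T v)`. -/
def pullInner (T : V →ₗ[ℂ] H) : V →ₗ[ℂ] V →ₗ⋆[ℂ] ℂ :=
  LinearMap.mk₂'ₛₗ (RingHom.id ℂ) (starRingEnd ℂ) (fun u v => ⟪T v, T u⟫_ℂ)
    (fun _ _ _ => by simp) (fun _ _ _ => by simp) (fun _ _ _ => by simp)
    (fun _ _ _ => by simp [mul_comm])

/-- The restriction of the form `a` along a linear map `T` into its domain. -/
def pullForm {W : Type*} [AddCommGroup W] [Module ℂ W] (a : V →ₗ[ℂ] V →ₗ⋆[ℂ] ℂ)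
    (T : W →ₗ[ℂ] V) : W →ₗ[ℂ] W →ₗ⋆[ℂ] ℂ :=
  LinearMap.mk₂'ₛₗ (RingHom.id ℂ) (starRingEnd ℂ) (fun u v => a (T u) (T v))
    (fun _ _ _ => by simp) (fun _ _ _ => by simp) (fun _ _ _ => by simp) (fun _ _ _ => by simp)

end Operators

/-! ## Lipschitz domains -/

/-- A bounded Lipschitz domain: a bounded open set with finitely many connected components which,
near every boundary point and in suitable Cartesian coordinates, is the set of points lying strictly
above the graph of a Lipschitz function. Here `e` is the "upward" unit vector, and `γ` is evaluated
at the orthogonal projection of `y` to the hyperplane `e⊥` only. -/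
structure IsBoundedLipschitzDomain {d : ℕ} (Ω : Set (EuclideanSpace ℝ (Fin d))) : Prop where
  isOpen : IsOpen Ω
  isBounded : Bornology.IsBounded Ω
  finite_components : Finite (ConnectedComponents Ω)
  locally_graph : ∀ p ∈ frontier Ω, ∃ e : EuclideanSpace ℝ (Fin d), ‖e‖ = 1 ∧
    ∃ (γ : EuclideanSpace ℝ (Fin d) → ℝ) (K : NNReal), LipschitzWith K γ ∧
      ∀ᶠ y in 𝓝 p, (y ∈ Ω ↔ γ (y - ⟪e, y⟫_ℝ • e) < ⟪e, y⟫_ℝ)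

/-! ## Function spaces -/

section Spaces

variable {d : ℕ} (Ω : Set (EuclideanSpace ℝ (Fin d)))

/-- `L²(Ω) = L²(Ω; ℂ)`. -/
abbrev L2 : Type := Lp ℂ 2 (volume.restrict Ω)

/-- `L²(Ω; ℂᵈ)`. -/
abbrev L2vec : Type := Lp (EuclideanSpace ℂ (Fin d)) 2 (volume.restrict Ω)

/-- The surface measure `σ` on `∂Ω`: the `(d-1)`-dimensional Hausdorff measure, in its Euclidean
normalisation. -/
def surfaceMeasure : Measure (EuclideanSpace ℝ (Fin d)) :=
  (Measure.euclideanHausdorffMeasure (d - 1)).restrict (frontier Ω)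

/-- `L²(∂Ω) = L²(∂Ω, σ; ℂ)`. -/
abbrev L2bd : Type := Lp ℂ 2 (surfaceMeasure Ω)

/-- The gradient `(∂₁φ, …, ∂_dφ)` of a differentiable complex-valued function. -/
def gradC (φ : EuclideanSpace ℝ (Fin d) → ℂ) (x : EuclideanSpace ℝ (Fin d)) :
    EuclideanSpace ℂ (Fin d) :=
  WithLp.toLp 2 fun i => fderiv ℝ φ x (EuclideanSpace.single i 1)

/-- `ψ ∈ C_c^∞(Ω)`. -/
structure IsTestFunction (ψ : EuclideanSpace ℝ (Fin d) → ℂ) : Prop where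
  smooth : ContDiff ℝ ∞ ψ
  compact : HasCompactSupport ψ
  support : tsupport ψ ⊆ Ω

/-- `G` is the weak gradient of `u` in `Ω`. -/
def IsWeakGradient (u : L2 Ω) (G : L2vec Ω) : Prop :=
  ∀ ψ : EuclideanSpace ℝ (Fin d) → ℂ, IsTestFunction Ω ψ → ∀ i : Fin d,
    ∫ x in Ω, u x * gradC ψ x i = -∫ x in Ω, G x i * ψ x

variable {Ω} in
lemma IsTestFunction.memLp {ψ : EuclideanSpace ℝ (Fin d) → ℂ} (h : IsTestFunction Ω ψ) :
    MemLp ψ 2 (volume.restrict Ω) :=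
  (h.smooth.continuous.memLp_of_hasCompactSupport h.compact).restrict Ω

lemma contDiff_gradC {φ : EuclideanSpace ℝ (Fin d) → ℂ} (h : ContDiff ℝ ∞ φ) :
    ContDiff ℝ ∞ (gradC φ) := by
  refine (PiLp.contDiff_toLp (𝕜 := ℝ)).comp (contDiff_pi.2 fun i => ?_)
  exact (h.fderiv_right (m := ∞) (by simp)).clm_apply contDiff_const

lemma hasCompactSupport_gradC {φ : EuclideanSpace ℝ (Fin d) → ℂ} (h : HasCompactSupport φ) :
    HasCompactSupport (gradC φ) := by
  refine (h.fderiv ℝ).comp_left (g := fun L : EuclideanSpace ℝ (Fin d) →L[ℝ] ℂ =>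
    (WithLp.toLp 2 fun i => L (EuclideanSpace.single i 1) : EuclideanSpace ℂ (Fin d))) ?_
  ext i; simp

lemma memLp_gradC {φ : EuclideanSpace ℝ (Fin d) → ℂ} (h : ContDiff ℝ ∞ φ)
    (hc : HasCompactSupport φ) : MemLp (gradC φ) 2 (volume.restrict Ω) :=
  ((contDiff_gradC h).continuous.memLp_of_hasCompactSupport
    (hasCompactSupport_gradC hc)).restrict Ω

lemma gradC_add {φ ψ : EuclideanSpace ℝ (Fin d) → ℂ} (h : ContDiff ℝ ∞ φ) (h' : ContDiff ℝ ∞ ψ) :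
    gradC (φ + ψ) = gradC φ + gradC ψ := by
  ext x i
  simp [gradC, fderiv_add (h.differentiable (by simp) x) (h'.differentiable (by simp) x)]

lemma gradC_smul (c : ℂ) {φ : EuclideanSpace ℝ (Fin d) → ℂ} (h : ContDiff ℝ ∞ φ) :
    gradC (c • φ) = c • gradC φ := by
  ext x i
  simp [gradC, fderiv_const_smul (h.differentiable (by simp) x) c]

lemma integrable_mul_gradC {u : EuclideanSpace ℝ (Fin d) → ℂ} (hu : MemLp u 2 (volume.restrict Ω))
    {ψ : EuclideanSpace ℝ (Fin d) → ℂ} (hψ : IsTestFunction Ω ψ) (i : Fin d) :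
    Integrable (fun x => u x * gradC ψ x i) (volume.restrict Ω) := by
  have h : MemLp (fun x => gradC ψ x i) 2 (volume.restrict Ω) :=
    (memLp_gradC Ω hψ.smooth hψ.compact).eval_piLp i
  exact hu.integrable_mul h

lemma integrable_comp_mul {G : EuclideanSpace ℝ (Fin d) → EuclideanSpace ℂ (Fin d)}
    (hG : MemLp G 2 (volume.restrict Ω))
    {ψ : EuclideanSpace ℝ (Fin d) → ℂ} (hψ : IsTestFunction Ω ψ) (i : Fin d) :
    Integrable (fun x => G x i * ψ x) (volume.restrict Ω) := by
  have h : MemLp (fun x => G x i) 2 (volume.restrict Ω) := hG.eval_piLp i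
  exact h.integrable_mul hψ.memLp

/-- The Sobolev space `H¹(Ω)`: a function `u ∈ L²(Ω)` having a weak gradient `∇u ∈ L²(Ω; ℂᵈ)`,
recorded as the pair `(u, ∇u)`, with the norm `(‖u‖² + ‖∇u‖²)^(1/2)`. -/
def H1 : Submodule ℂ (WithLp 2 (L2 Ω × L2vec Ω)) where
  carrier := {p | IsWeakGradient Ω p.fst p.snd}
  zero_mem' := by
    intro ψ hψ i
    have h1 : ∫ x in Ω, (0 : L2 Ω) x * gradC ψ x i = 0 := by
      refine integral_eq_zero_of_ae ?_
      filter_upwards [Lp.coeFn_zero ℂ 2 (volume.restrict Ω)] with x hx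
      rw [hx]; simp
    have h2 : ∫ x in Ω, (0 : L2vec Ω) x i * ψ x = 0 := by
      refine integral_eq_zero_of_ae ?_
      filter_upwards [Lp.coeFn_zero (EuclideanSpace ℂ (Fin d)) 2 (volume.restrict Ω)] with x hx
      rw [hx]; simp
    simp only [WithLp.zero_fst, WithLp.zero_snd]
    rw [h1, h2, neg_zero]
  add_mem' := by
    intro p q hp hq ψ hψ i
    have h1 : ∫ x in Ω, (p.fst + q.fst : L2 Ω) x * gradC ψ x i
        = ∫ x in Ω, (p.fst x * gradC ψ x i + q.fst x * gradC ψ x i) := by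
      refine integral_congr_ae ?_
      filter_upwards [Lp.coeFn_add p.fst q.fst] with x hx
      rw [hx, Pi.add_apply, add_mul]
    have h2 : ∫ x in Ω, (p.snd + q.snd : L2vec Ω) x i * ψ x
        = ∫ x in Ω, (p.snd x i * ψ x + q.snd x i * ψ x) := by
      refine integral_congr_ae ?_
      filter_upwards [Lp.coeFn_add p.snd q.snd] with x hx
      rw [hx, Pi.add_apply, PiLp.add_apply, add_mul]
    simp only [WithLp.add_fst, WithLp.add_snd]
    rw [h1, h2, integral_add (integrable_mul_gradC Ω (Lp.memLp _) hψ i)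
      (integrable_mul_gradC Ω (Lp.memLp _) hψ i), integral_add
      (integrable_comp_mul Ω (Lp.memLp _) hψ i) (integrable_comp_mul Ω (Lp.memLp _) hψ i),
      hp ψ hψ i, hq ψ hψ i, neg_add]
  smul_mem' := by
    intro c p hp ψ hψ i
    have h1 : ∫ x in Ω, (c • p.fst : L2 Ω) x * gradC ψ x i
        = ∫ x in Ω, c * (p.fst x * gradC ψ x i) := by
      refine integral_congr_ae ?_
      filter_upwards [Lp.coeFn_smul c p.fst] with x hx
      simp [hx, mul_assoc]
    have h2 : ∫ x in Ω, (c • p.snd : L2vec Ω) x i * ψ x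
        = ∫ x in Ω, c * (p.snd x i * ψ x) := by
      refine integral_congr_ae ?_
      filter_upwards [Lp.coeFn_smul c p.snd] with x hx
      simp [hx, mul_assoc]
    simp only [WithLp.smul_fst, WithLp.smul_snd]
    rw [h1, h2, integral_const_mul, integral_const_mul, hp ψ hψ i, mul_neg]

/-- The embedding `H¹(Ω) → L²(Ω)`, `u ↦ u`. -/
def val : H1 Ω →ₗ[ℂ] L2 Ω where
  toFun u := (u : WithLp 2 (L2 Ω × L2vec Ω)).fst
  map_add' _ _ := rfl
  map_smul' _ _ := rfl

/-- The weak gradient `H¹(Ω) → L²(Ω; ℂᵈ)`, `u ↦ ∇u`. -/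
def grad : H1 Ω →ₗ[ℂ] L2vec Ω where
  toFun u := (u : WithLp 2 (L2 Ω × L2vec Ω)).snd
  map_add' _ _ := rfl
  map_smul' _ _ := rfl

/-- `H¹₀(Ω)`, the closure of `C_c^∞(Ω)` in `H¹(Ω)`. -/
def H10 : Submodule ℂ (H1 Ω) :=
  (Submodule.span ℂ {u : H1 Ω | ∃ ψ, IsTestFunction Ω ψ ∧
    ∀ᵐ x ∂volume.restrict Ω, val Ω u x = ψ x}).topologicalClosure

/-! ## The trace operator -/

/-- The functions in `C_c^∞(ℝᵈ)` whose restriction to `∂Ω` is square integrable; this last condition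
is automatic if `∂Ω` has finite surface measure, as it does for bounded Lipschitz domains. -/
def smoothFunctions : Submodule ℂ (EuclideanSpace ℝ (Fin d) → ℂ) where
  carrier := {φ | ContDiff ℝ ∞ φ ∧ HasCompactSupport φ ∧ MemLp φ 2 (surfaceMeasure Ω)}
  zero_mem' := ⟨contDiff_const, HasCompactSupport.zero, MemLp.zero⟩
  add_mem' := fun h h' => ⟨h.1.add h'.1, h.2.1.add h'.2.1, h.2.2.add h'.2.2⟩
  smul_mem' := fun c _ h =>
    ⟨contDiff_const.smul h.1, h.2.1.smul_left (f := fun _ => c), h.2.2.const_smul c⟩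

lemma isWeakGradient_smooth {φ : EuclideanSpace ℝ (Fin d) → ℂ} (h : ContDiff ℝ ∞ φ)
    (hφ : MemLp φ 2 (volume.restrict Ω)) (hg : MemLp (gradC φ) 2 (volume.restrict Ω)) :
    IsWeakGradient Ω (hφ.toLp φ) (hg.toLp (gradC φ)) := by
  intro ψ hψ i
  have hz : ∀ x, x ∉ Ω → x ∉ tsupport ψ := fun x hx hx' => hx (hψ.support hx')
  have hz0 : ∀ x, x ∉ Ω → ψ x = 0 := fun x hx => image_eq_zero_of_notMem_tsupport (hz x hx)
  have hz1 : ∀ x, x ∉ Ω → fderiv ℝ ψ x = 0 := fun x hx => by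
    by_contra hne
    exact hz x hx (support_fderiv_subset ℝ hne)
  have h1 : ∫ x in Ω, (hφ.toLp φ : L2 Ω) x * gradC ψ x i
      = ∫ x, φ x * fderiv ℝ ψ x (EuclideanSpace.single i 1) := by
    rw [← setIntegral_eq_integral_of_forall_compl_eq_zero (s := Ω)
      (f := fun x => φ x * fderiv ℝ ψ x (EuclideanSpace.single i 1))
      (fun x hx => by simp [hz1 x hx])]
    refine integral_congr_ae ?_
    filter_upwards [hφ.coeFn_toLp] with x hx
    simp [hx, gradC]
  have h2 : ∫ x in Ω, (hg.toLp (gradC φ) : L2vec Ω) x i * ψ x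
      = ∫ x, fderiv ℝ φ x (EuclideanSpace.single i 1) * ψ x := by
    rw [← setIntegral_eq_integral_of_forall_compl_eq_zero (s := Ω)
      (f := fun x => fderiv ℝ φ x (EuclideanSpace.single i 1) * ψ x)
      (fun x hx => by simp [hz0 x hx])]
    refine integral_congr_ae ?_
    filter_upwards [hg.coeFn_toLp] with x hx
    simp [hx, gradC]
  have hcψ : HasCompactSupport fun x => fderiv ℝ ψ x (EuclideanSpace.single i 1) :=
    (hψ.compact.fderiv ℝ).comp_left (g := fun L : EuclideanSpace ℝ (Fin d) →L[ℝ] ℂ =>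
      L (EuclideanSpace.single i 1)) rfl
  have cφ : Continuous fun x => fderiv ℝ φ x (EuclideanSpace.single i 1) :=
    (h.continuous_fderiv (by simp)).clm_apply continuous_const
  have cψ : Continuous fun x => fderiv ℝ ψ x (EuclideanSpace.single i 1) :=
    (hψ.smooth.continuous_fderiv (by simp)).clm_apply continuous_const
  rw [h1, h2]
  exact integral_mul_fderiv_eq_neg_fderiv_mul_of_integrable
    ((cφ.mul hψ.smooth.continuous).integrable_of_hasCompactSupport hψ.compact.mul_left)
    ((h.continuous.mul cψ).integrable_of_hasCompactSupport hcψ.mul_left)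
    ((h.continuous.mul hψ.smooth.continuous).integrable_of_hasCompactSupport hψ.compact.mul_left)
    (fun x _ => h.differentiable (by simp) x) (fun x _ => hψ.smooth.differentiable (by simp) x)

lemma smoothFunctions_memLp (φ : smoothFunctions Ω) :
    MemLp (φ : EuclideanSpace ℝ (Fin d) → ℂ) 2 (volume.restrict Ω) :=
  (φ.2.1.continuous.memLp_of_hasCompactSupport φ.2.2.1).restrict Ω

lemma smoothFunctions_memLp_grad (φ : smoothFunctions Ω) :
    MemLp (gradC (φ : EuclideanSpace ℝ (Fin d) → ℂ)) 2 (volume.restrict Ω) :=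
  memLp_gradC Ω φ.2.1 φ.2.2.1

/-- The restriction `φ ↦ φ|_Ω ∈ H¹(Ω)` of smooth functions. -/
def restrictInterior : smoothFunctions Ω →ₗ[ℂ] H1 Ω where
  toFun φ := ⟨WithLp.toLp 2 ((smoothFunctions_memLp Ω φ).toLp _,
    (smoothFunctions_memLp_grad Ω φ).toLp _), isWeakGradient_smooth Ω φ.2.1 (smoothFunctions_memLp Ω φ)
      (smoothFunctions_memLp_grad Ω φ)⟩
  map_add' φ ψ := by
    refine Subtype.ext (congrArg (WithLp.toLp 2) (Prod.ext ?_ ?_))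
    · exact MemLp.toLp_add (smoothFunctions_memLp Ω φ) (smoothFunctions_memLp Ω ψ)
    · refine Eq.trans ?_ (MemLp.toLp_add (smoothFunctions_memLp_grad Ω φ)
        (smoothFunctions_memLp_grad Ω ψ))
      exact MemLp.toLp_congr (smoothFunctions_memLp_grad Ω (φ + ψ)) _
        (Filter.EventuallyEq.of_eq (gradC_add φ.2.1 ψ.2.1))
  map_smul' c φ := by
    refine Subtype.ext (congrArg (WithLp.toLp 2) (Prod.ext ?_ ?_))
    · exact MemLp.toLp_const_smul c (smoothFunctions_memLp Ω φ)
    · refine Eq.trans ?_ (MemLp.toLp_const_smul c (smoothFunctions_memLp_grad Ω φ))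
      exact MemLp.toLp_congr (smoothFunctions_memLp_grad Ω (c • φ)) _
        (Filter.EventuallyEq.of_eq (gradC_smul c φ.2.1))

/-- The restriction `φ ↦ φ|_∂Ω ∈ L²(∂Ω)` of smooth functions. -/
def restrictBoundary : smoothFunctions Ω →ₗ[ℂ] L2bd Ω where
  toFun φ := φ.2.2.2.toLp _
  map_add' _ _ := MemLp.toLp_add _ _
  map_smul' c _ := MemLp.toLp_const_smul c _

/-- The trace operator `tr : H¹(Ω) → L²(∂Ω)`: the unique continuous linear extension of
`φ|_Ω ↦ φ|_∂Ω`, `φ` smooth. (It exists on bounded Lipschitz domains by the trace theorem.) -/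
def trace : H1 Ω →L[ℂ] L2bd Ω :=
  (restrictBoundary Ω).extendOfNorm (restrictInterior Ω)

/-! ## The Robin and Dirichlet Laplacians -/

/-- The Robin form `a_α[u, v] = ∫_Ω ∇u · conj ∇v dx + ∫_∂Ω α u conj v dσ` on `H¹(Ω)`. -/
def robinForm (α : ℂ) : H1 Ω →ₗ[ℂ] H1 Ω →ₗ⋆[ℂ] ℂ :=
  pullInner (grad Ω) + α • pullInner (trace Ω : H1 Ω →ₗ[ℂ] L2bd Ω)

/-- The Robin Laplacian `-Δ_Ω^α` on `L²(Ω)`. -/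
def robinLaplacian (α : ℂ) : L2 Ω →ₗ.[ℂ] L2 Ω :=
  formOperator (val Ω) (robinForm Ω α)

/-- The Dirichlet Laplacian `-Δ_Ω^D` on `L²(Ω)`, associated with the restriction of `a_0` to
`H¹₀(Ω)`. -/
def dirichletLaplacian : L2 Ω →ₗ.[ℂ] L2 Ω :=
  formOperator (val Ω ∘ₗ (H10 Ω).subtype) (pullForm (robinForm Ω 0) (H10 Ω).subtype)

/-! ## The Dirichlet-to-Neumann operator -/

/-- `H¹(λ)`: the `u ∈ H¹(Ω)` with `-Δu = λu` weakly, that is,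
`∫_Ω ∇u · conj ∇v dx = λ ∫_Ω u conj v dx` for all `v ∈ H¹₀(Ω)`. -/
def helmholtzSpace (lam : ℂ) : Submodule ℂ (H1 Ω) where
  carrier := {u | ∀ v ∈ H10 Ω, ⟪grad Ω v, grad Ω u⟫_ℂ = lam * ⟪val Ω v, val Ω u⟫_ℂ}
  zero_mem' := fun v _ => by simp
  add_mem' := fun h h' v hv => by
    rw [map_add, map_add, inner_add_right, inner_add_right, h v hv, h' v hv, mul_add]
  smul_mem' := fun c u h v hv => by
    rw [map_smul, map_smul, inner_smul_right, inner_smul_right, h v hv, mul_left_comm]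

/-- The Poisson operator `P(λ) : g ↦ u_λ`, where `u_λ ∈ H¹(λ)` is the solution of the Dirichlet
problem with `tr u_λ = g`, given through its graph `{(tr u, u) : u ∈ H¹(λ)}`. Its domain consists of
the `g` for which the Dirichlet problem can be solved, which is the whole of
`H^{1/2}(∂Ω) = tr H¹(Ω)` when `λ` is in the resolvent set of the Dirichlet Laplacian. -/
def poisson (lam : ℂ) : L2bd Ω →ₗ.[ℂ] H1 Ω :=
  ((helmholtzSpace Ω lam).map ((trace Ω : H1 Ω →ₗ[ℂ] L2bd Ω).prod LinearMap.id)).toLinearPMap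

/-- The form `q_λ[g, h] = ∫_Ω ∇P(λ)g · conj ∇P(λ)h - λ P(λ)g conj (P(λ)h) dx` on
`H^{1/2}(∂Ω)`. -/
def dnForm (lam : ℂ) : (poisson Ω lam).domain →ₗ[ℂ] (poisson Ω lam).domain →ₗ⋆[ℂ] ℂ :=
  pullForm (pullInner (grad Ω) - lam • pullInner (val Ω)) (poisson Ω lam).toFun

/-- The (negative) Dirichlet-to-Neumann operator `M(λ)` in `L²(∂Ω)`, associated with `-q_λ`. -/
def dnOperator (lam : ℂ) : L2bd Ω →ₗ.[ℂ] L2bd Ω :=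
  formOperator (poisson Ω lam).domain.subtype (-dnForm Ω lam)

end Spaces

end RobinDN

end

/-!
Let `V = H¹(Ω)`, with embedding `j` into `L²(Ω)` and trace `τ`. The form of the Robin Laplacian
minus `z` is represented on `V` by `S = 1 + α τ*τ - (1 + z) j*j`, a compact perturbation of the
identity, so that `z` is in the spectrum exactly if it is an eigenvalue, and exactly if `S` is not
injective. Moreover `H¹(z) = {u | S u ⟂ H¹₀}`. If `z` is in the resolvent set of the Dirichlet
Laplacian, then `H¹ = H¹₀ ⊕ H¹(z)`; hence `ker S` is the kernel of the compression of `S` to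
`H¹(z)`. That compression is again a compact perturbation of the identity, and it represents the
form of `α - M(z)`, transported to `H¹(z)` by the trace.

Compactness of `j` and `τ`, and `ker τ = H¹₀`, come from integrating along the vertical direction
of Lipschitz charts: with `d` the distance to the complement of `Ω`, this bounds `τ u` by `u` and
`∇u`, and `u` on the strip `d < c t` by `τ u` and `∇u`, with explicit dependence on `t`. Cutting off
a function with zero trace in such a strip costs little in `H¹`; away from a thin strip,
mollification approximates the embedding by compact operators.
-/

noncomputable section

namespace RobinDN

section FormOperators

variable {H V W : Type*} [NormedAddCommGroup H] [InnerProductSpace ℂ H]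
  [AddCommGroup V] [Module ℂ V] [AddCommGroup W] [Module ℂ W]

@[simp] lemma pullInner_apply (T : V →ₗ[ℂ] H) (u v : V) : pullInner T u v = ⟪T v, T u⟫_ℂ := rfl

@[simp] lemma pullForm_apply (a : V →ₗ[ℂ] V →ₗ⋆[ℂ] ℂ) (T : W →ₗ[ℂ] V) (u v : W) :
    pullForm a T u v = a (T u) (T v) := rfl

lemma mem_formGraph {j : V →ₗ[ℂ] H} {a : V →ₗ[ℂ] V →ₗ⋆[ℂ] ℂ} {p : H × H} :
    p ∈ formGraph j a ↔ ∃ x : V, j x = p.1 ∧ ∀ y : V, a x y = ⟪j y, p.2⟫_ℂ := Iff.rfl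

lemma formGraph_congr {j : V →ₗ[ℂ] H} {a : V →ₗ[ℂ] V →ₗ⋆[ℂ] ℂ} {j' : W →ₗ[ℂ] H}
    {a' : W →ₗ[ℂ] W →ₗ⋆[ℂ] ℂ} (e : W → V) (he : Function.Surjective e)
    (hj : ∀ x, j (e x) = j' x) (ha : ∀ x y, a (e x) (e y) = a' x y) :
    formGraph j a = formGraph j' a' := by
  ext p
  simp only [mem_formGraph, he.exists, he.forall, hj, ha]

lemma snd_eq_zero_of_mem_formGraph {j : V →ₗ[ℂ] H} (hj : Function.Injective j) (hd : DenseRange j)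
    {a : V →ₗ[ℂ] V →ₗ⋆[ℂ] ℂ} {p : H × H} (hp : p ∈ formGraph j a) (hp0 : p.1 = 0) : p.2 = 0 := by
  obtain ⟨x, hx, hxa⟩ := hp
  obtain rfl : x = 0 := hj (by rw [hx, hp0, map_zero])
  refine hd.eq_zero_of_inner_left (𝕜 := ℂ) fun y => inner_eq_zero_symm.1 ?_
  rw [← hxa y, map_zero, LinearMap.zero_apply]

lemma mem_formGraph_iff {j : V →ₗ[ℂ] H} (hj : Function.Injective j) (hd : DenseRange j)
    {a : V →ₗ[ℂ] V →ₗ⋆[ℂ] ℂ} {u h : H} :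
    (u, h) ∈ formGraph j a ↔
      ∃ hu : u ∈ (formOperator j a).domain, formOperator j a ⟨u, hu⟩ = h := by
  rw [← Submodule.toLinearPMap_graph_eq (formGraph j a)
    fun _ => snd_eq_zero_of_mem_formGraph hj hd, LinearPMap.mem_graph_iff]
  constructor
  · rintro ⟨y, rfl, rfl⟩
    exact ⟨y.2, rfl⟩
  · rintro ⟨hu, rfl⟩
    exact ⟨⟨u, hu⟩, rfl, rfl⟩

lemma not_isEigenvalue_of_mem_resolventSet {A : H →ₗ.[ℂ] H} {z : ℂ} (hz : z ∈ resolventSet A) :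
    ¬ IsEigenvalue A z := by
  rintro ⟨u, hu0, hu, hAu⟩
  obtain ⟨R, -, hR⟩ := hz
  refine hu0 ?_
  rw [← show _ = u from hR ⟨u, hu⟩, hAu, sub_self, map_zero]

lemma exists_of_isEigenfunction_formOperator {j : V →ₗ[ℂ] H} (hj : Function.Injective j)
    (hd : DenseRange j) {a : V →ₗ[ℂ] V →ₗ⋆[ℂ] ℂ} {z : ℂ} {u : H}
    (hu : IsEigenfunction (formOperator j a) z u) : ∃ x, j x = u :=
  have ⟨x, hx, _⟩ := (mem_formGraph_iff hj hd).2 hu.2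
  ⟨x, hx⟩

end FormOperators

section Representation

variable {H V : Type*} [NormedAddCommGroup H] [InnerProductSpace ℂ H]
  [NormedAddCommGroup V] [InnerProductSpace ℂ V]
  {j : V →L[ℂ] H} {a : V →ₗ[ℂ] V →ₗ⋆[ℂ] ℂ} {z : ℂ} {S : V →L[ℂ] V}

open ContinuousLinearMap (adjoint adjoint_inner_right)

lemma isEigenfunction_formOperator_iff (hj : Function.Injective j) (hd : DenseRange j)
    (hS : ∀ x y, ⟪y, S x⟫_ℂ = a x y - z * ⟪j y, j x⟫_ℂ) (x : V) :
    IsEigenfunction (formOperator (j : V →ₗ[ℂ] H) a) z (j x) ↔ x ≠ 0 ∧ S x = 0 := by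
  rw [IsEigenfunction, ← mem_formGraph_iff hj hd, mem_formGraph, map_ne_zero_iff _ hj]
  simp only [ContinuousLinearMap.coe_coe, hj.eq_iff, exists_eq_left, inner_smul_right]
  refine and_congr_right fun _ => ⟨fun h => ext_inner_left ℂ fun y => ?_, fun h y => ?_⟩
  · rw [hS, h, sub_self, inner_zero_right]
  · rw [← sub_eq_zero, ← hS, h, inner_zero_right]

lemma isEigenvalue_formOperator_iff (hj : Function.Injective j) (hd : DenseRange j)
    (hS : ∀ x y, ⟪y, S x⟫_ℂ = a x y - z * ⟪j y, j x⟫_ℂ) :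
    IsEigenvalue (formOperator (j : V →ₗ[ℂ] H) a) z ↔ ∃ x, x ≠ 0 ∧ S x = 0 := by
  simp only [← isEigenfunction_formOperator_iff hj hd hS]
  refine ⟨fun ⟨u, hu⟩ => ?_, fun ⟨x, hx⟩ => ⟨j x, hx⟩⟩
  obtain ⟨x, rfl⟩ := exists_of_isEigenfunction_formOperator (j := (j : V →ₗ[ℂ] H)) hj hd hu
  exact ⟨x, hu⟩

lemma injective_iff_not_isEigenvalue (hj : Function.Injective j) (hd : DenseRange j)
    (hS : ∀ x y, ⟪y, S x⟫_ℂ = a x y - z * ⟪j y, j x⟫_ℂ) :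
    Function.Injective S ↔ ¬ IsEigenvalue (formOperator (j : V →ₗ[ℂ] H) a) z := by
  rw [isEigenvalue_formOperator_iff hj hd hS, injective_iff_map_eq_zero]
  simp only [not_exists, not_and', not_not]

variable [CompleteSpace H] [CompleteSpace V]

lemma mem_resolventSet_of_bijective (hj : Function.Injective j) (hd : DenseRange j)
    (hS : ∀ x y, ⟪y, S x⟫_ℂ = a x y - z * ⟪j y, j x⟫_ℂ) (hb : Function.Bijective S) :
    z ∈ resolventSet (formOperator (j : V →ₗ[ℂ] H) a) := by
  let e := ContinuousLinearEquiv.ofBijective S (LinearMap.ker_eq_bot.2 hb.1)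
    (LinearMap.range_eq_top.2 hb.2)
  have hSe : ∀ w, S (e.symm w) = w := e.apply_symm_apply
  have heS : ∀ w, e.symm (S w) = w := e.symm_apply_apply
  refine ⟨j ∘L (e.symm : V →L[ℂ] V) ∘L adjoint j, fun f => ?_, fun ⟨u, hu⟩ => ?_⟩
  · simp only [sub_eq_iff_eq_add, ← mem_formGraph_iff hj hd]
    refine mem_formGraph.2 ⟨e.symm (adjoint j f), rfl, fun y => ?_⟩
    have hy := hS (e.symm (adjoint j f)) y
    rw [hSe, adjoint_inner_right, eq_sub_iff_add_eq] at hy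
    rw [← hy, inner_add_right, inner_smul_right]
    rfl
  · obtain ⟨x, rfl, hxa⟩ := (mem_formGraph_iff hj hd).2 ⟨hu, rfl⟩
    have hx : adjoint j (formOperator (j : V →ₗ[ℂ] H) a ⟨j x, hu⟩ - z • j x) = S x := by
      refine ext_inner_left ℂ fun y => ?_
      rw [hS, hxa, adjoint_inner_right, inner_sub_right, inner_smul_right]
      rfl
    simp only [ContinuousLinearMap.coe_coe, ContinuousLinearMap.comp_apply,
      ContinuousLinearEquiv.coe_coe] at hx ⊢
    rw [hx, heS]

lemma mem_opSpectrum_formOperator_iff (hj : Function.Injective j) (hd : DenseRange j)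
    (hS : ∀ x y, ⟪y, S x⟫_ℂ = a x y - z * ⟪j y, j x⟫_ℂ)
    (hb : Function.Injective S → Function.Bijective S) :
    z ∈ opSpectrum (formOperator (j : V →ₗ[ℂ] H) a) ↔
      IsEigenvalue (formOperator (j : V →ₗ[ℂ] H) a) z := by
  refine not_iff_comm.1 ⟨fun h => ?_, not_isEigenvalue_of_mem_resolventSet⟩
  exact mem_resolventSet_of_bijective hj hd hS
    (hb ((injective_iff_not_isEigenvalue hj hd hS).2 h))

end Representation

lemma bijective_of_isCompactOperator_sub_one {𝕜 E : Type*} [NontriviallyNormedField 𝕜]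
    [NormedAddCommGroup E] [NormedSpace 𝕜 E] [CompleteSpace E] {S : E →L[𝕜] E}
    (hS : IsCompactOperator (S - 1 : E →L[𝕜] E)) (hi : Function.Injective S) :
    Function.Bijective S := by
  rcases hS.hasEigenvalue_or_mem_resolventSet (neg_ne_zero.2 (one_ne_zero' 𝕜)) with h | h
  · obtain ⟨x, hx, hx0⟩ := h.exists_hasEigenvector
    refine absurd (hi ?_) hx0
    simpa [Module.End.mem_eigenspace_iff, sub_eq_neg_self] using hx
  · rw [spectrum.mem_resolventSet_iff, ← IsUnit.neg_iff] at h
    rw [← ContinuousLinearMap.isUnit_iff_bijective]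
    simpa using h

section Compression

variable {V : Type*} [NormedAddCommGroup V] [InnerProductSpace ℂ V]

/-- The compression of an operator to a complete subspace. -/
def compression (U : Submodule ℂ V) [CompleteSpace U] (S : V →L[ℂ] V) : U →L[ℂ] U :=
  U.orthogonalProjectionOnto ∘L S ∘L U.subtypeL

@[simp] lemma inner_compression (U : Submodule ℂ V) [CompleteSpace U] (S : V →L[ℂ] V) (x y : U) :
    ⟪y, compression U S x⟫_ℂ = ⟪(y : V), S x⟫_ℂ := by
  simp [compression]

lemma isCompactOperator_compression_sub_one (U : Submodule ℂ V) [CompleteSpace U] {S : V →L[ℂ] V}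
    (hS : IsCompactOperator (S - 1 : V →L[ℂ] V)) :
    IsCompactOperator (compression U S - 1 : U →L[ℂ] U) := by
  have h : compression U S - 1 = U.orthogonalProjectionOnto ∘L (S - 1) ∘L U.subtypeL := by
    ext x
    simp [compression]
  rw [h]
  exact (hS.comp_clm U.subtypeL).clm_comp U.orthogonalProjectionOnto

lemma isCompl_comap_orthogonal {D : Submodule ℂ V} [CompleteSpace D] {S : V →L[ℂ] V}
    (hb : Function.Bijective (compression D S)) : IsCompl D (Dᗮ.comap (S : V →ₗ[ℂ] V)) := by
  constructor
  · refine Submodule.disjoint_def.2 fun u hu huS => ?_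
    have : (⟨u, hu⟩ : D) = 0 := hb.1 <| ext_inner_left ℂ fun v => by
      rw [inner_compression, map_zero, inner_zero_right]
      exact huS v v.2
    exact congrArg Subtype.val this
  · refine codisjoint_iff.2 (Submodule.eq_top_iff'.2 fun u => ?_)
    obtain ⟨t, ht⟩ := hb.2 (D.orthogonalProjectionOnto (S u))
    refine Submodule.mem_sup.2 ⟨t, t.2, u - t, fun v hv => ?_, add_sub_cancel ..⟩
    have := inner_compression D S t ⟨v, hv⟩
    rw [ht] at this
    simpa [inner_sub_right, sub_eq_zero] using this

lemma apply_eq_zero_iff_of_isCompl {D W : Submodule ℂ V} [CompleteSpace W] {S : V →L[ℂ] V}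
    (hW : W = Dᗮ.comap (S : V →ₗ[ℂ] V)) (h : IsCompl D W) (u : V) :
    S u = 0 ↔ ∃ hu : u ∈ W, compression W S ⟨u, hu⟩ = 0 := by
  have hu_iff : u ∈ W ↔ ∀ v ∈ D, ⟪v, S u⟫_ℂ = 0 := by
    rw [hW]
    rfl
  constructor
  · intro hu
    refine ⟨hu_iff.2 fun v _ => by rw [hu, inner_zero_right], ext_inner_left ℂ fun v => ?_⟩
    rw [inner_compression, hu, inner_zero_right, inner_zero_right]
  · rintro ⟨hu, huS⟩
    refine ext_inner_left ℂ fun v => ?_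
    obtain ⟨t, ht, w, hw, rfl⟩ := Submodule.mem_sup.1 (h.sup_eq_top ▸ Submodule.mem_top (x := v))
    have := inner_compression W S ⟨u, hu⟩ ⟨w, hw⟩
    rw [huS, inner_zero_right] at this
    rw [inner_add_left, hu_iff.1 hu t ht, ← this, add_zero, inner_zero_right]

end Compression

section TraceSetting

variable {V H G : Type*} [NormedAddCommGroup V] [InnerProductSpace ℂ V]
  [NormedAddCommGroup H] [InnerProductSpace ℂ H]
  [NormedAddCommGroup G] [InnerProductSpace ℂ G]

/-- The functional analytic properties of `V = H¹(Ω)`, its embedding `j` into `L²(Ω)`, the trace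
`τ`, the form `s` of the Neumann Laplacian and `D = H¹₀(Ω)` on which the correspondence between
Robin Laplacians and Dirichlet-to-Neumann operators rests. -/
structure IsTraceSetting (j : V →L[ℂ] H) (τ : V →L[ℂ] G) (s : V →ₗ[ℂ] V →ₗ⋆[ℂ] ℂ)
    (D : Submodule ℂ V) : Prop where
  inner_eq : ∀ x y, ⟪y, x⟫_ℂ = s x y + ⟪j y, j x⟫_ℂ
  injective : Function.Injective j
  denseRange : DenseRange (j ∘L D.subtypeL)
  denseRange_trace : DenseRange τ
  ker_trace : ∀ u, τ u = 0 ↔ u ∈ D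
  isCompactOperator : IsCompactOperator j
  isCompactOperator_trace : IsCompactOperator τ

namespace IsTraceSetting

/-- The abstract Robin Laplacian, associated with `s + α (τ, τ)`. -/
abbrev robin (j : V →L[ℂ] H) (τ : V →L[ℂ] G) (s : V →ₗ[ℂ] V →ₗ⋆[ℂ] ℂ) (α : ℂ) :
    H →ₗ.[ℂ] H :=
  formOperator (j : V →ₗ[ℂ] H) (s + α • pullInner (τ : V →ₗ[ℂ] G))

/-- The abstract Dirichlet Laplacian, associated with the restriction to `D` of the Robin form with
`α = 0`. -/
abbrev dirichlet (j : V →L[ℂ] H) (τ : V →L[ℂ] G) (s : V →ₗ[ℂ] V →ₗ⋆[ℂ] ℂ)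
    (D : Submodule ℂ V) : H →ₗ.[ℂ] H :=
  formOperator ((j : V →ₗ[ℂ] H) ∘ₗ D.subtype)
    (pullForm (s + (0 : ℂ) • pullInner (τ : V →ₗ[ℂ] G)) D.subtype)

/-- The abstract Poisson operator, the inverse of `τ` on the space `W` of solutions. -/
abbrev poisson (τ : V →L[ℂ] G) (W : Submodule ℂ V) : G →ₗ.[ℂ] V :=
  (W.map ((τ : V →ₗ[ℂ] G).prod LinearMap.id)).toLinearPMap

/-- The abstract Dirichlet-to-Neumann operator, associated with the negative of the form
`s - z (j, j)` transported to the boundary by the Poisson operator. -/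
abbrev dirichletToNeumann (j : V →L[ℂ] H) (τ : V →L[ℂ] G)
    (s : V →ₗ[ℂ] V →ₗ⋆[ℂ] ℂ) (W : Submodule ℂ V) (z : ℂ) : G →ₗ.[ℂ] G :=
  formOperator (poisson τ W).domain.subtype
    (-pullForm (s - z • pullInner (j : V →ₗ[ℂ] H)) (poisson τ W).toFun)

variable {j : V →L[ℂ] H} {τ : V →L[ℂ] G} {s : V →ₗ[ℂ] V →ₗ⋆[ℂ] ℂ} {D W : Submodule ℂ V} {α z : ℂ}

lemma isClosed (h : IsTraceSetting j τ s D) : IsClosed (D : Set V) := by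
  have hD : (D : Set V) = τ ⁻¹' {0} := Set.ext fun u => (h.ker_trace u).symm
  rw [hD]
  exact isClosed_singleton.preimage τ.continuous

lemma denseRange_val (h : IsTraceSetting j τ s D) : DenseRange j := by
  refine h.denseRange.mono ?_
  rintro _ ⟨x, rfl⟩
  exact ⟨x, rfl⟩

lemma eq_zero_of_trace_eq_zero (h : IsTraceSetting j τ s D) (hDW : IsCompl D W) (u : V)
    (hu : u ∈ W) (hu0 : τ u = 0) : u = 0 :=
  Submodule.disjoint_def.1 hDW.disjoint u ((h.ker_trace u).1 hu0) hu

lemma injective_trace_comp_subtypeL (h : IsTraceSetting j τ s D) (hDW : IsCompl D W) :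
    Function.Injective (τ ∘L W.subtypeL) :=
  (injective_iff_map_eq_zero _).2 fun x hx =>
    Subtype.ext (h.eq_zero_of_trace_eq_zero hDW x x.2 hx)

lemma denseRange_trace_comp_subtypeL (h : IsTraceSetting j τ s D) (hDW : IsCompl D W) :
    DenseRange (τ ∘L W.subtypeL) := by
  refine h.denseRange_trace.mono ?_
  rintro _ ⟨v, rfl⟩
  obtain ⟨t, ht, w, hw, rfl⟩ := Submodule.mem_sup.1 (hDW.sup_eq_top ▸ Submodule.mem_top (x := v))
  refine ⟨⟨w, hw⟩, ?_⟩
  rw [map_add, (h.ker_trace t).2 ht, zero_add]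
  rfl

lemma exists_poisson_apply_trace (hinj : ∀ u ∈ W, τ u = 0 → u = 0) {u : V} (hu : u ∈ W) :
    ∃ hd : τ u ∈ (poisson τ W).domain, poisson τ W ⟨τ u, hd⟩ = u := by
  have hW : ∀ p ∈ W.map ((τ : V →ₗ[ℂ] G).prod LinearMap.id), p.1 = 0 → p.2 = 0 := by
    rintro _ ⟨u, hu, rfl⟩ h0
    exact hinj u hu h0
  have hmem : (τ u, u) ∈ (poisson τ W).graph := by
    rw [poisson, Submodule.toLinearPMap_graph_eq _ hW]
    exact ⟨u, hu, rfl⟩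
  obtain ⟨⟨_, hg⟩, rfl, hgu⟩ := (LinearPMap.mem_graph_iff _).1 hmem
  exact ⟨hg, hgu⟩

lemma dirichletToNeumann_eq (hinj : ∀ u ∈ W, τ u = 0 → u = 0) (z : ℂ) :
    dirichletToNeumann j τ s W z =
      formOperator ((τ ∘L W.subtypeL : W →L[ℂ] G) : W →ₗ[ℂ] G)
        (-pullForm (s - z • pullInner (j : V →ₗ[ℂ] H)) W.subtype) := by
  refine congrArg Submodule.toLinearPMap ?_
  choose hd hP using fun u : W => exists_poisson_apply_trace hinj u.2
  refine formGraph_congr (fun u : W => ⟨τ u, hd u⟩) (fun g => ?_) (fun u => rfl) fun u v => ?_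
  · obtain ⟨_, ⟨u, hu, rfl⟩, hg⟩ := g.2
    exact ⟨⟨u, hu⟩, Subtype.ext hg⟩
  · simp only [LinearMap.neg_apply, pullForm_apply, Submodule.subtype_apply]
    rw [show (poisson τ W).toFun ⟨τ u, hd u⟩ = u from hP u,
      show (poisson τ W).toFun ⟨τ v, hd v⟩ = v from hP v]

variable [CompleteSpace V] [CompleteSpace H] [CompleteSpace G]

open ContinuousLinearMap (adjoint adjoint_inner_right)

/-- The operator in the form domain representing `s + α (τ, τ) - z (j, j)`; see `inner_repr`. -/
def repr (j : V →L[ℂ] H) (τ : V →L[ℂ] G) (α z : ℂ) : V →L[ℂ] V :=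
  1 + α • (adjoint τ ∘L τ) - (1 + z) • (adjoint j ∘L j)

lemma inner_repr (h : IsTraceSetting j τ s D) (α z : ℂ) (x y : V) :
    ⟪y, repr j τ α z x⟫_ℂ = s x y + α * ⟪τ y, τ x⟫_ℂ - z * ⟪j y, j x⟫_ℂ := by
  simp only [repr, sub_apply, add_apply, smul_apply, one_apply_eq_self,
    ContinuousLinearMap.comp_apply, inner_sub_right, inner_add_right, inner_smul_right,
    adjoint_inner_right, h.inner_eq x y]
  ring

lemma isCompactOperator_repr_sub_one (h : IsTraceSetting j τ s D) (α z : ℂ) :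
    IsCompactOperator (repr j τ α z - 1 : V →L[ℂ] V) := by
  have hrepr : repr j τ α z - 1 = α • (adjoint τ ∘L τ) - (1 + z) • (adjoint j ∘L j) := by
    rw [repr]
    abel
  rw [hrepr]
  exact ((h.isCompactOperator_trace.clm_comp (adjoint τ)).smul α).sub
    ((h.isCompactOperator.clm_comp (adjoint j)).smul (1 + z))

lemma eq_comap_orthogonal (h : IsTraceSetting j τ s D)
    (hW : ∀ u, u ∈ W ↔ ∀ v ∈ D, s u v = z * ⟪j v, j u⟫_ℂ) (α : ℂ) :
    W = Dᗮ.comap (repr j τ α z : V →ₗ[ℂ] V) := by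
  ext u
  rw [hW, Submodule.mem_comap, Submodule.mem_orthogonal]
  refine forall₂_congr fun v hv => ?_
  rw [ContinuousLinearMap.coe_coe, h.inner_repr, (h.ker_trace v).2 hv, inner_zero_left, mul_zero,
    add_zero, sub_eq_zero]

lemma isCompl (h : IsTraceSetting j τ s D) (hW : ∀ u, u ∈ W ↔ ∀ v ∈ D, s u v = z * ⟪j v, j u⟫_ℂ)
    (hz : z ∈ resolventSet (dirichlet j τ s D)) : IsCompl D W := by
  have : CompleteSpace D := h.isClosed.completeSpace_coe
  rw [h.eq_comap_orthogonal hW 0]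
  refine isCompl_comap_orthogonal (bijective_of_isCompactOperator_sub_one
    (isCompactOperator_compression_sub_one D (h.isCompactOperator_repr_sub_one 0 z)) ?_)
  refine (injective_iff_not_isEigenvalue (j := j ∘L D.subtypeL)
    (h.injective.comp Subtype.val_injective) h.denseRange fun x y => ?_).2
    (not_isEigenvalue_of_mem_resolventSet hz)
  rw [inner_compression, h.inner_repr]
  rfl

lemma inner_neg_compression_repr (h : IsTraceSetting j τ s D) [CompleteSpace W] (x y : W) :
    ⟪y, (-compression W (repr j τ α z)) x⟫_ℂ =
      (-pullForm (s - z • pullInner (j : V →ₗ[ℂ] H)) W.subtype) x y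
        - α * ⟪(τ ∘L W.subtypeL) y, (τ ∘L W.subtypeL) x⟫_ℂ := by
  simp only [neg_apply, inner_neg_right, inner_compression, h.inner_repr,
    LinearMap.neg_apply, pullForm_apply, Submodule.subtype_apply, LinearMap.sub_apply,
    LinearMap.smul_apply, pullInner_apply, ContinuousLinearMap.coe_coe, smul_eq_mul,
    ContinuousLinearMap.comp_apply, Submodule.subtypeL_apply]
  ring

lemma completeSpace (h : IsTraceSetting j τ s D)
    (hW : ∀ u, u ∈ W ↔ ∀ v ∈ D, s u v = z * ⟪j v, j u⟫_ℂ) : CompleteSpace W := by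
  have hWc : IsClosed (W : Set V) := by
    rw [h.eq_comap_orthogonal hW 0]
    exact D.isClosed_orthogonal.preimage (repr j τ 0 z).continuous
  exact hWc.completeSpace_coe

theorem isEigenfunction_robin_iff (h : IsTraceSetting j τ s D)
    (hW : ∀ u, u ∈ W ↔ ∀ v ∈ D, s u v = z * ⟪j v, j u⟫_ℂ) (hDW : IsCompl D W) (u : V) :
    IsEigenfunction (robin j τ s α) z (j u) ↔
      u ∈ W ∧ IsEigenfunction (dirichletToNeumann j τ s W z) α (τ u) := by
  have := h.completeSpace hW
  have hrobin := isEigenfunction_formOperator_iff h.injective h.denseRange_val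
    (a := s + α • pullInner (τ : V →ₗ[ℂ] G)) (h.inner_repr α z) u
  have hdn (hu : u ∈ W) := isEigenfunction_formOperator_iff (h.injective_trace_comp_subtypeL hDW)
    (h.denseRange_trace_comp_subtypeL hDW) (h.inner_neg_compression_repr (α := α) (z := z))
    ⟨u, hu⟩
  rw [← dirichletToNeumann_eq (h.eq_zero_of_trace_eq_zero hDW)] at hdn
  rw [hrobin, apply_eq_zero_iff_of_isCompl (h.eq_comap_orthogonal hW α) hDW]
  constructor
  · rintro ⟨hu0, hu, huS⟩
    exact ⟨hu, (hdn hu).2 ⟨fun h0 => hu0 (congrArg Subtype.val h0), by simpa using huS⟩⟩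
  · rintro ⟨hu, hu'⟩
    obtain ⟨hu0, huS⟩ := (hdn hu).1 hu'
    exact ⟨fun h0 => hu0 (Subtype.ext h0), hu, by simpa using huS⟩

theorem isEigenvalue_robin_iff (h : IsTraceSetting j τ s D)
    (hW : ∀ u, u ∈ W ↔ ∀ v ∈ D, s u v = z * ⟪j v, j u⟫_ℂ) (hDW : IsCompl D W) :
    IsEigenvalue (robin j τ s α) z ↔ IsEigenvalue (dirichletToNeumann j τ s W z) α := by
  constructor
  · rintro ⟨f, hf⟩
    obtain ⟨u, rfl⟩ := exists_of_isEigenfunction_formOperator (j := (j : V →ₗ[ℂ] H)) h.injective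
      h.denseRange_val hf
    exact ⟨τ u, ((h.isEigenfunction_robin_iff hW hDW u).1 hf).2⟩
  · rintro ⟨g, hg⟩
    have hg' := hg
    rw [dirichletToNeumann_eq (h.eq_zero_of_trace_eq_zero hDW)] at hg'
    obtain ⟨u, rfl⟩ := exists_of_isEigenfunction_formOperator
      (j := ((τ ∘L W.subtypeL : W →L[ℂ] G) : W →ₗ[ℂ] G)) (h.injective_trace_comp_subtypeL hDW)
      (h.denseRange_trace_comp_subtypeL hDW) hg'
    exact ⟨j u, (h.isEigenfunction_robin_iff hW hDW u).2 ⟨u.2, hg⟩⟩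

theorem mem_opSpectrum_robin_iff (h : IsTraceSetting j τ s D)
    (hW : ∀ u, u ∈ W ↔ ∀ v ∈ D, s u v = z * ⟪j v, j u⟫_ℂ) (hDW : IsCompl D W) :
    z ∈ opSpectrum (robin j τ s α) ↔ α ∈ opSpectrum (dirichletToNeumann j τ s W z) := by
  have := h.completeSpace hW
  have hcompact := h.isCompactOperator_repr_sub_one α z
  have hrobin : z ∈ opSpectrum (robin j τ s α) ↔ IsEigenvalue (robin j τ s α) z :=
    mem_opSpectrum_formOperator_iff h.injective h.denseRange_val
      (h.inner_repr α z) (bijective_of_isCompactOperator_sub_one hcompact)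
  have hneg : ⇑(-compression W (repr j τ α z)) = Equiv.neg W ∘ compression W (repr j τ α z) := rfl
  have hdn := mem_opSpectrum_formOperator_iff (h.injective_trace_comp_subtypeL hDW)
    (h.denseRange_trace_comp_subtypeL hDW) (h.inner_neg_compression_repr (α := α) (z := z))
    fun hi => by
      rw [hneg, EquivLike.comp_injective] at hi
      rw [hneg, EquivLike.comp_bijective]
      exact bijective_of_isCompactOperator_sub_one
        (isCompactOperator_compression_sub_one W hcompact) hi
  rw [← dirichletToNeumann_eq (h.eq_zero_of_trace_eq_zero hDW)] at hdn
  rw [hrobin, hdn, h.isEigenvalue_robin_iff hW hDW]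

end IsTraceSetting

end TraceSetting

section Graph

open scoped ENNReal NNReal

variable {E : Type*} [NormedAddCommGroup E] [InnerProductSpace ℝ E] {e : E} {γ : E → ℝ} {K : ℝ≥0}

/-- The hyperplane orthogonal to `e`. -/
abbrev hyperplane (e : E) : Submodule ℝ E := (Submodule.span ℝ {e})ᗮ

/-- The parametrisation by `hyperplane e` of the graph of `γ` in direction `e`. Only the values
of `γ` on the hyperplane matter. -/
def graphMap (γ : E → ℝ) (y : hyperplane e) : E := y + γ y • e

/-- The height of a point over the graph of `γ` in direction `e`. -/
def height (e : E) (γ : E → ℝ) (x : E) : ℝ := ⟪e, x⟫_ℝ - γ (x - ⟪e, x⟫_ℝ • e)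

lemma coe_orthogonalProjectionOnto_hyperplane (he : ‖e‖ = 1) (x : E) :
    ((hyperplane e).orthogonalProjectionOnto x : E) = x - ⟪e, x⟫_ℝ • e := by
  have := Submodule.starProjection_orthogonal_val (K := Submodule.span ℝ {e}) x
  rwa [Submodule.starProjection_unit_singleton ℝ he] at this

lemma orthogonalProjectionOnto_hyperplane_self (e : E) :
    (hyperplane e).orthogonalProjectionOnto e = 0 :=
  Submodule.orthogonalProjectionOnto_orthogonal_apply_eq_zero (Submodule.mem_span_singleton_self e)

lemma orthogonalProjectionOnto_graphMap_add_smul (γ : E → ℝ) (y : hyperplane e) (t : ℝ) :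
    (hyperplane e).orthogonalProjectionOnto (graphMap γ y + t • e) = y := by
  simp only [graphMap, map_add, map_smul, orthogonalProjectionOnto_hyperplane_self, smul_zero,
    add_zero, Submodule.orthogonalProjectionOnto_mem_subspace_eq_self]

lemma graphMap_orthogonalProjectionOnto_add (he : ‖e‖ = 1) (γ : E → ℝ) (x : E) :
    graphMap γ ((hyperplane e).orthogonalProjectionOnto x) + height e γ x • e = x := by
  rw [graphMap, coe_orthogonalProjectionOnto_hyperplane he, height]
  module

lemma height_add_smul (he : ‖e‖ = 1) (γ : E → ℝ) (x : E) (t : ℝ) :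
    height e γ (x + t • e) = height e γ x + t := by
  have h1 : ⟪e, x + t • e⟫_ℝ = ⟪e, x⟫_ℝ + t := by
    rw [inner_add_right, inner_smul_right, real_inner_self_eq_norm_sq, he, one_pow, mul_one]
  have h2 : x + t • e - (⟪e, x⟫_ℝ + t) • e = x - ⟪e, x⟫_ℝ • e := by module
  rw [height, height, h1, h2]
  ring

lemma height_graphMap_add_smul (he : ‖e‖ = 1) (γ : E → ℝ) (y : hyperplane e) (t : ℝ) :
    height e γ (graphMap γ y + t • e) = t := by
  have hy : ⟪e, (y : E)⟫_ℝ = 0 := Submodule.mem_orthogonal_singleton_iff_inner_right.1 y.2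
  rw [graphMap, height_add_smul he, height_add_smul he, height, hy, zero_smul, sub_zero]
  ring

lemma lipschitzWith_graphMap (he : ‖e‖ = 1) (hγ : LipschitzWith K γ) :
    LipschitzWith (1 + K) (graphMap γ : hyperplane e → E) := by
  refine .of_dist_le_mul fun y z => ?_
  have hγyz := hγ.dist_le_mul (y : E) z
  calc dist (graphMap γ y) (graphMap γ z)
      ≤ dist (y : E) z + dist (γ y • e) (γ z • e) := dist_add_add_le ..
    _ = dist (y : E) z + dist (γ y) (γ z) := by
        rw [dist_eq_norm (γ y • e), ← sub_smul, norm_smul, he, mul_one, dist_eq_norm (γ y)]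
    _ ≤ dist (y : E) z + K * dist (y : E) z := by gcongr
    _ = ((1 + K : ℝ≥0) : ℝ) * dist y z := by rw [Subtype.dist_eq]; push_cast; ring

lemma lipschitzWith_height (he : ‖e‖ = 1) (hγ : LipschitzWith K γ) :
    LipschitzWith (1 + K) (height e γ) := by
  have hinner : LipschitzWith 1 fun x : E => ⟪e, x⟫_ℝ := .of_dist_le_mul fun x z => by
    simpa [dist_eq_norm, he, ← inner_sub_right] using abs_real_inner_le_norm e (x - z)
  have hproj : LipschitzWith 1 fun x : E => x - ⟪e, x⟫_ℝ • e := by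
    simpa only [Function.comp_def, coe_orthogonalProjectionOnto_hyperplane he, one_mul] using
      (LipschitzWith.subtype_val _).comp (hyperplane e).lipschitzWith_orthogonalProjectionOnto
  have := hinner.sub (hγ.comp hproj)
  rwa [mul_one] at this

variable [FiniteDimensional ℝ E]

lemma finrank_hyperplane (he : ‖e‖ = 1) :
    Module.finrank ℝ (hyperplane e) = Module.finrank ℝ E - 1 := by
  have he0 : e ≠ 0 := norm_ne_zero_iff.1 (he ▸ one_ne_zero)
  have : Nontrivial E := ⟨e, 0, he0⟩
  have : Fact (Module.finrank ℝ E = Module.finrank ℝ E - 1 + 1) :=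
    ⟨(Nat.sub_add_cancel Module.finrank_pos).symm⟩
  exact Submodule.finrank_orthogonal_span_singleton he0

variable [MeasurableSpace E] [BorelSpace E]

lemma measurePreserving_hyperplane_add_smul (he : ‖e‖ = 1) :
    MeasurePreserving (fun q : hyperplane e × ℝ => (q.1 : E) + q.2 • e)
      (volume.prod volume) volume := by
  have hspan : MeasurePreserving (LinearIsometryEquiv.toSpanUnitSingleton (𝕜 := ℝ) e he)
      volume volume := LinearIsometryEquiv.measurePreserving _
  have hprod := (hspan.prod (MeasurePreserving.id (volume : Measure (hyperplane e)))).comp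
    (Measure.measurePreserving_swap (μ := (volume : Measure (hyperplane e)))
      (ν := (volume : Measure ℝ)))
  have hdecomp := (Submodule.span ℝ {e}).orthogonalDecomposition.symm.measurePreserving.comp
    ((WithLp.volume_preserving_toLp (Submodule.span ℝ {e}) (hyperplane e)).comp hprod)
  refine (congrArg (MeasurePreserving · _ _) (funext fun q => ?_)).mpr hdecomp
  have := (Submodule.span ℝ {e}).measurableEquivProd_symm_apply (0 : E)
    (⟨q.2 • e, Submodule.smul_mem _ _ (Submodule.mem_span_singleton_self e)⟩, q.1)
  simp only [vadd_eq_add, add_zero] at this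
  rw [add_comm, ← this]
  simp [Submodule.measurableEquivProd]

lemma measurePreserving_graphMap_add_smul (he : ‖e‖ = 1) (hγ : Measurable γ) :
    MeasurePreserving (fun q : hyperplane e × ℝ => graphMap γ q.1 + q.2 • e)
      (volume.prod volume) volume := by
  have hshear : MeasurePreserving (fun q : hyperplane e × ℝ => (q.1, γ q.1 + q.2))
      (volume.prod volume) (volume.prod volume) :=
    (MeasurePreserving.id _).skew_product (g := fun (y : hyperplane e) t => γ y + t)
      (by unfold Function.uncurry; fun_prop)
      (.of_forall fun y => (measurePreserving_add_left volume (γ y)).map_eq)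
  convert (measurePreserving_hyperplane_add_smul he).comp hshear using 1
  funext q
  simp only [Function.comp_apply, graphMap, add_smul, add_assoc]

lemma setLIntegral_graphMap_add_smul_le (he : ‖e‖ = 1) (hγ : Measurable γ)
    {A : Set (hyperplane e)} {I : Set ℝ} {B : Set E} (hB : MeasurableSet B) {h : E → ℝ≥0∞}
    (hh : Measurable h) (hAB : ∀ y ∈ A, ∀ t ∈ I, graphMap γ y + t • e ∈ B) :
    ∫⁻ y in A, ∫⁻ t in I, h (graphMap γ y + t • e) ≤ ∫⁻ x in B, h x := by
  have hΦ := measurePreserving_graphMap_add_smul he hγ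
  rw [← hΦ.setLIntegral_comp_preimage hB hh,
    ← lintegral_prod (f := fun q : hyperplane e × ℝ => h (graphMap γ q.1 + q.2 • e))
      (hh.comp hΦ.measurable).aemeasurable, Measure.prod_restrict]
  exact lintegral_mono_set fun q hq => hAB q.1 hq.1 q.2 hq.2

lemma setLIntegral_le_graphMap_add_smul (he : ‖e‖ = 1) (hγ : Measurable γ)
    {A : Set (hyperplane e)} {I : Set ℝ} {B : Set E} (hB : MeasurableSet B) {h : E → ℝ≥0∞}
    (hh : Measurable h)
    (hBA : ∀ x ∈ B, (hyperplane e).orthogonalProjectionOnto x ∈ A ∧ height e γ x ∈ I) :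
    ∫⁻ x in B, h x ≤ ∫⁻ y in A, ∫⁻ t in I, h (graphMap γ y + t • e) := by
  have hΦ := measurePreserving_graphMap_add_smul he hγ
  rw [← hΦ.setLIntegral_comp_preimage hB hh,
    ← lintegral_prod (f := fun q : hyperplane e × ℝ => h (graphMap γ q.1 + q.2 • e))
      (hh.comp hΦ.measurable).aemeasurable, Measure.prod_restrict]
  refine lintegral_mono_set fun q hq => ?_
  have := hBA _ hq
  rwa [orthogonalProjectionOnto_graphMap_add_smul, height_graphMap_add_smul he] at this

lemma euclideanHausdorffMeasure_image_le_of_lipschitzWith {X Y : Type*} [MetricSpace X]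
    [MeasurableSpace X] [BorelSpace X] [MetricSpace Y] [MeasurableSpace Y] [BorelSpace Y]
    {f : X → Y} (hf : LipschitzWith K f) (n : ℕ) (s : Set X) :
    Measure.euclideanHausdorffMeasure n (f '' s)
      ≤ (K : ℝ≥0∞) ^ n * Measure.euclideanHausdorffMeasure n s := by
  have := hf.hausdorffMeasure_image_le (d := n) (by positivity) s
  rw [ENNReal.rpow_natCast] at this
  simp only [Measure.euclideanHausdorffMeasure_def, Measure.smul_apply]
  rw [mul_smul_comm]
  exact smul_le_smul_of_nonneg_left this (by positivity)

lemma volume_hyperplane (he : ‖e‖ = 1) : (volume : Measure (hyperplane e)) =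
    Measure.euclideanHausdorffMeasure (Module.finrank ℝ E - 1) := by
  rw [← finrank_hyperplane he, InnerProductSpace.euclideanHausdorffMeasure_eq_volume]

lemma setLIntegral_euclideanHausdorffMeasure_le_graphMap (he : ‖e‖ = 1) (hγ : LipschitzWith K γ)
    {A : Set (hyperplane e)} {S : Set E} (hS : S ⊆ graphMap γ '' A) {h : E → ℝ≥0∞}
    (hh : Measurable h) :
    ∫⁻ x in S, h x ∂(Measure.euclideanHausdorffMeasure (Module.finrank ℝ E - 1)) ≤
      ((1 + K : ℝ≥0) : ℝ≥0∞) ^ (Module.finrank ℝ E - 1) * ∫⁻ y in A, h (graphMap γ y) := by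
  have hΓ := lipschitzWith_graphMap he hγ
  have hΓm := hΓ.continuous.measurable
  rw [← lintegral_map hh hΓm, ← smul_eq_mul, ← lintegral_smul_measure]
  refine lintegral_mono' (Measure.le_iff.2 fun T hT => ?_) le_rfl
  rw [Measure.restrict_apply hT, Measure.smul_apply, Measure.map_apply hΓm hT,
    Measure.restrict_apply (hΓm hT), volume_hyperplane he, smul_eq_mul]
  refine (measure_mono ?_).trans (euclideanHausdorffMeasure_image_le_of_lipschitzWith hΓ _ _)
  rintro x ⟨hxT, hxS⟩
  obtain ⟨y, hy, rfl⟩ := hS hxS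
  exact ⟨y, ⟨hxT, hy⟩, rfl⟩

lemma setLIntegral_graphMap_le_euclideanHausdorffMeasure (he : ‖e‖ = 1) (hγ : LipschitzWith K γ)
    {A : Set (hyperplane e)} {S : Set E} (hS : graphMap γ '' A ⊆ S) {h : E → ℝ≥0∞}
    (hh : Measurable h) :
    ∫⁻ y in A, h (graphMap γ y) ≤
      ∫⁻ x in S, h x ∂(Measure.euclideanHausdorffMeasure (Module.finrank ℝ E - 1)) := by
  have hΓm := (lipschitzWith_graphMap he hγ).continuous.measurable
  rw [← lintegral_map hh hΓm]
  refine lintegral_mono' (Measure.le_iff.2 fun T hT => ?_) le_rfl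
  rw [Measure.restrict_apply hT, Measure.map_apply hΓm hT, Measure.restrict_apply (hΓm hT),
    volume_hyperplane he]
  have hproj := euclideanHausdorffMeasure_image_le_of_lipschitzWith
    (hyperplane e).lipschitzWith_orthogonalProjectionOnto (Module.finrank ℝ E - 1) (T ∩ S)
  rw [ENNReal.coe_one, one_pow, one_mul] at hproj
  refine (measure_mono ?_).trans hproj
  rintro y ⟨hyT, hyA⟩
  refine ⟨graphMap γ y, ⟨hyT, hS ⟨y, hyA, rfl⟩⟩, ?_⟩
  simpa only [zero_smul, add_zero] using orthogonalProjectionOnto_graphMap_add_smul γ y 0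

end Graph

section Charts

open scoped NNReal
open Set Metric

/-- The boundary strip of width `τ`: the points of `Ω` at distance less than `τ` from the
complement. It is empty if `Ω` is the whole space. -/
def strip {X : Type*} [PseudoMetricSpace X] (Ω : Set X) (τ : ℝ) : Set X := Ω ∩ thickening τ Ωᶜ

lemma isOpen_strip {X : Type*} [PseudoMetricSpace X] {Ω : Set X} (hΩ : IsOpen Ω) (τ : ℝ) :
    IsOpen (strip Ω τ) := hΩ.inter isOpen_thickening

lemma exists_strip_subset {X : Type*} [PseudoMetricSpace X] {Ω U : Set X} (hΩ : IsOpen Ω)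
    (hc : IsCompact (closure Ω)) (hU : IsOpen U) (hsub : frontier Ω ⊆ U) :
    ∃ ε > 0, strip Ω ε ⊆ U := by
  have hdisj : Disjoint (closure Ω \ U) Ωᶜ := by
    rw [disjoint_compl_right_iff_subset]
    rintro x ⟨hx, hxU⟩
    by_contra hxΩ
    exact hxU (hsub (hΩ.frontier_eq ▸ ⟨hx, hxΩ⟩))
  obtain ⟨ε, hε, h⟩ := hdisj.exists_thickenings (hc.diff hU) hΩ.isClosed_compl
  refine ⟨ε, hε, fun x hx => ?_⟩
  by_contra hxU
  exact disjoint_left.1 h (self_subset_thickening hε _ ⟨subset_closure hx.1, hxU⟩) hx.2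

variable {E : Type*} [NormedAddCommGroup E] [InnerProductSpace ℝ E]
  {Ω : Set E} {p e : E} {γ : E → ℝ} {K : ℝ≥0} {R : ℝ}

/-- A boundary chart: in the ball of radius `R` around the boundary point `p`, the open set `Ω`
is the epigraph of the `K`-Lipschitz function `γ` in direction `e`. -/
structure IsChart (Ω : Set E) (p e : E) (γ : E → ℝ) (K : ℝ≥0) (R : ℝ) : Prop where
  isOpen : IsOpen Ω
  norm_eq : ‖e‖ = 1
  lipschitz : LipschitzWith K γ
  pos : 0 < R
  mem_frontier : p ∈ frontier Ω
  mem_iff : ∀ y ∈ ball p R, y ∈ Ω ↔ 0 < height e γ y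

namespace IsChart

/-- The radius of a smaller concentric ball; the vertical segments of this length over `base`
stay in the ball of radius `R`. -/
def radius (K : ℝ≥0) (R : ℝ) : ℝ := R / (3 + K)

/-- The parameter domain of the chart in the hyperplane. -/
def base (e p : E) (K : ℝ≥0) (R : ℝ) : Set (hyperplane e) :=
  ball ((hyperplane e).orthogonalProjectionOnto p) (radius K R)

lemma radius_mul (K : ℝ≥0) (R : ℝ) : radius K R * (3 + K) = R :=
  div_mul_cancel₀ _ (by positivity)

lemma radius_pos (h : IsChart Ω p e γ K R) : 0 < radius K R := div_pos h.pos (by positivity)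

lemma two_mul_radius_lt (h : IsChart Ω p e γ K R) : 2 * radius K R < R := by
  nlinarith [radius_mul K R, h.radius_pos, mul_nonneg h.radius_pos.le K.2]

lemma ball_radius_subset (h : IsChart Ω p e γ K R) : ball p (radius K R) ⊆ ball p R :=
  ball_subset_ball (by linarith [h.two_mul_radius_lt, h.radius_pos])

lemma notMem_of_mem_frontier (h : IsChart Ω p e γ K R) {x : E} (hx : x ∈ frontier Ω) : x ∉ Ω :=
  (h.isOpen.frontier_eq ▸ hx : x ∈ closure Ω \ Ω).2

lemma height_eq_zero (h : IsChart Ω p e γ K R) {y : E} (hy : y ∈ ball p R)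
    (hf : y ∈ frontier Ω) : height e γ y = 0 := by
  refine le_antisymm (not_lt.1 ((h.mem_iff y hy).not.1 (h.notMem_of_mem_frontier hf))) ?_
  by_contra! hneg
  have hnear : ∀ᶠ z in 𝓝 y, z ∈ ball p R ∧ height e γ z < 0 :=
    (isOpen_ball.eventually_mem hy).and
      ((lipschitzWith_height h.norm_eq h.lipschitz).continuous.continuousAt.eventually_lt_const
        hneg)
  obtain ⟨z, hzΩ, hzR, hz⟩ :=
    (mem_closure_iff_frequently.1 (frontier_subset_closure hf)).and_eventually hnear |>.exists
  exact ((h.mem_iff z hzR).1 hzΩ).not_gt hz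

lemma mem_frontier_of_height_eq_zero (h : IsChart Ω p e γ K R) {y : E}
    (hy : y ∈ ball p R) (hf : height e γ y = 0) : y ∈ frontier Ω := by
  rw [h.isOpen.frontier_eq]
  refine ⟨?_, fun hy' => ((h.mem_iff y hy).1 hy').ne' hf⟩
  have hc : ContinuousWithinAt (fun t : ℝ => y + t • e) (Ioi 0) 0 := by fun_prop
  have h0 : Filter.Tendsto (fun t : ℝ => y + t • e) (𝓝[>] 0) (𝓝 y) := by
    simpa only [ContinuousWithinAt, zero_smul, add_zero] using hc
  refine mem_closure_of_tendsto h0 ?_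
  filter_upwards [h0 (isOpen_ball.mem_nhds hy), self_mem_nhdsWithin] with t ht htpos
  rwa [h.mem_iff _ ht, height_add_smul h.norm_eq, hf, zero_add]

lemma orthogonalProjectionOnto_mem_base {x : E} (hx : x ∈ ball p (radius K R)) :
    (hyperplane e).orthogonalProjectionOnto x ∈ base e p K R := by
  rw [base, mem_ball, dist_eq_norm, ← map_sub]
  refine (Submodule.norm_orthogonalProjectionOnto_apply_le _ _).trans_lt ?_
  rwa [mem_ball, dist_eq_norm] at hx

lemma graphMap_orthogonalProjectionOnto (h : IsChart Ω p e γ K R) {x : E} (hx : x ∈ ball p R)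
    (hf : x ∈ frontier Ω) : graphMap γ ((hyperplane e).orthogonalProjectionOnto x) = x := by
  have := graphMap_orthogonalProjectionOnto_add h.norm_eq γ x
  rwa [h.height_eq_zero hx hf, zero_smul, add_zero] at this

lemma graphMap_add_smul_mem_ball (h : IsChart Ω p e γ K R) {y : hyperplane e}
    (hy : y ∈ base e p K R) {t : ℝ} (ht : |t| ≤ radius K R) : graphMap γ y + t • e ∈ ball p R := by
  have hpy := (lipschitzWith_graphMap h.norm_eq h.lipschitz).dist_le_mul y
    ((hyperplane e).orthogonalProjectionOnto p)
  rw [h.graphMap_orthogonalProjectionOnto (mem_ball_self h.pos) h.mem_frontier] at hpy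
  have hvert : dist (graphMap γ y + t • e) (graphMap γ y) ≤ radius K R := by
    rwa [dist_self_add_left, norm_smul, h.norm_eq, mul_one]
  have htri := dist_triangle (graphMap γ y + t • e) (graphMap γ y) p
  have hy' : dist y ((hyperplane e).orthogonalProjectionOnto p) < radius K R := hy
  rw [mem_ball]
  push_cast at hpy
  nlinarith [K.2, radius_mul K R, h.radius_pos]

lemma graphMap_mem_frontier (h : IsChart Ω p e γ K R) {y : hyperplane e} (hy : y ∈ base e p K R) :
    graphMap γ y ∈ frontier Ω := by
  have hball := h.graphMap_add_smul_mem_ball hy (t := 0) (by rw [abs_zero]; exact h.radius_pos.le)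
  have hheight := height_graphMap_add_smul h.norm_eq γ y 0
  rw [zero_smul, add_zero] at hball hheight
  exact h.mem_frontier_of_height_eq_zero hball hheight

lemma graphMap_add_smul_mem (h : IsChart Ω p e γ K R) {y : hyperplane e} (hy : y ∈ base e p K R)
    {t : ℝ} (ht : 0 < t) (ht' : t ≤ radius K R) : graphMap γ y + t • e ∈ Ω := by
  rwa [h.mem_iff _ (h.graphMap_add_smul_mem_ball hy (by rwa [abs_of_pos ht])),
    height_graphMap_add_smul h.norm_eq]

lemma graphMap_add_smul_mem_strip (h : IsChart Ω p e γ K R) {y : hyperplane e}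
    (hy : y ∈ base e p K R) {t τ : ℝ} (ht : t ∈ Ioo 0 τ) (hτ : τ ≤ radius K R) :
    graphMap γ y + t • e ∈ strip Ω τ := by
  refine ⟨h.graphMap_add_smul_mem hy ht.1 (ht.2.le.trans hτ), mem_thickening_iff.2
    ⟨graphMap γ y, h.notMem_of_mem_frontier (h.graphMap_mem_frontier hy), ?_⟩⟩
  rw [dist_self_add_left, norm_smul, h.norm_eq, mul_one, Real.norm_eq_abs, abs_of_pos ht.1]
  exact ht.2

lemma frontier_inter_ball_subset (h : IsChart Ω p e γ K R) :
    frontier Ω ∩ ball p (radius K R) ⊆ graphMap γ '' base e p K R := fun _ ⟨hx, hxb⟩ =>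
  ⟨_, orthogonalProjectionOnto_mem_base hxb,
    h.graphMap_orthogonalProjectionOnto (h.ball_radius_subset hxb) hx⟩

lemma height_mem_Ioo (h : IsChart Ω p e γ K R) {τ : ℝ} (hτ : 0 < τ) (hτR : τ ≤ radius K R) {x : E}
    (hx : x ∈ strip Ω (τ / (1 + K))) (hxp : x ∈ ball p (radius K R)) :
    height e γ x ∈ Ioo 0 τ := by
  obtain ⟨z, hz, hxz⟩ := mem_thickening_iff.1 hx.2
  have hτK : τ / (1 + K) ≤ τ := div_le_self hτ.le (le_add_of_nonneg_right K.2)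
  have hzR : z ∈ ball p R := by
    have hxp' : dist x p < radius K R := hxp
    rw [mem_ball]
    linarith [dist_triangle_left z p x, h.two_mul_radius_lt]
  have hz0 : height e γ z ≤ 0 := not_lt.1 ((h.mem_iff z hzR).not.1 hz)
  have hxz' := (lipschitzWith_height h.norm_eq h.lipschitz).dist_le_mul x z
  rw [Real.dist_eq] at hxz'
  push_cast at hxz'
  have := (lt_div_iff₀ (by positivity : (0 : ℝ) < 1 + K)).1 hxz
  refine ⟨(h.mem_iff x (h.ball_radius_subset hxp)).1 hx.1, ?_⟩
  linarith [le_abs_self (height e γ x - height e γ z)]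

end IsChart

variable {d : ℕ} {Ω : Set (EuclideanSpace ℝ (Fin d))}

lemma IsBoundedLipschitzDomain.exists_isChart (hΩ : IsBoundedLipschitzDomain Ω)
    {p : EuclideanSpace ℝ (Fin d)} (hp : p ∈ frontier Ω) : ∃ e γ K R, IsChart Ω p e γ K R := by
  obtain ⟨e, he, γ, K, hγ, h⟩ := hΩ.locally_graph p hp
  obtain ⟨R, hR, hR'⟩ := Metric.eventually_nhds_iff_ball.1 h
  exact ⟨e, γ, K, R, hΩ.isOpen, he, hγ, hR, hp, fun y hy => by rw [hR' y hy, height, sub_pos]⟩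

lemma IsBoundedLipschitzDomain.exists_atlas (hΩ : IsBoundedLipschitzDomain Ω) :
    ∃ (ι : Type) (_ : Fintype ι) (p e : ι → EuclideanSpace ℝ (Fin d))
      (γ : ι → EuclideanSpace ℝ (Fin d) → ℝ) (K : ι → ℝ≥0) (R : ι → ℝ),
      (∀ i, IsChart Ω (p i) (e i) (γ i) (K i) (R i)) ∧
      frontier Ω ⊆ ⋃ i, ball (p i) (IsChart.radius (K i) (R i)) := by
  have hc : IsCompact (frontier Ω) :=
    hΩ.isBounded.isCompact_closure.of_isClosed_subset isClosed_frontier frontier_subset_closure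
  choose e γ K R h using fun p : frontier Ω => hΩ.exists_isChart p.2
  obtain ⟨t, ht⟩ := hc.elim_finite_subcover
    (fun p : frontier Ω => ball (p : EuclideanSpace ℝ (Fin d)) (IsChart.radius (K p) (R p)))
    (fun _ => isOpen_ball) fun x hx => mem_iUnion.2 ⟨⟨x, hx⟩, mem_ball_self (h _).radius_pos⟩
  refine ⟨t, inferInstance, fun i => i.1, fun i => e i, fun i => γ i, fun i => K i, fun i => R i,
    fun i => h i, fun x hx => ?_⟩
  obtain ⟨q, hq, hxq⟩ := mem_iUnion₂.1 (ht hx)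
  exact mem_iUnion.2 ⟨⟨q, hq⟩, hxq⟩

end Charts

section SegmentEstimates

open scoped ENNReal
open Set

variable {F : Type*} [NormedAddCommGroup F] [NormedSpace ℝ F] [CompleteSpace F] {g g' : ℝ → F}

lemma ennreal_add_sq_le (a b : ℝ≥0∞) : (a + b) ^ 2 ≤ 2 * a ^ 2 + 2 * b ^ 2 := by
  have := ENNReal.rpow_add_le_mul_rpow_add_rpow a b (p := 2) (by norm_num)
  norm_num at this
  rwa [mul_add] at this

lemma sq_lintegral_le {X : Type*} [MeasurableSpace X] {μ : Measure X} {f : X → ℝ≥0∞}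
    (hf : AEMeasurable f μ) : (∫⁻ x, f x ∂μ) ^ 2 ≤ μ univ * ∫⁻ x, f x ^ 2 ∂μ := by
  have := ENNReal.lintegral_mul_le_Lp_mul_Lq μ
    Real.HolderConjugate.two_two (f := fun _ => 1) (g := f) aemeasurable_const hf
  simp only [Pi.mul_apply, one_mul, lintegral_const, ENNReal.rpow_two] at this
  refine (pow_le_pow_left' this 2).trans (le_of_eq ?_)
  have hsq (a : ℝ≥0∞) : (a ^ (1 / 2 : ℝ)) ^ 2 = a := by
    rw [← ENNReal.rpow_natCast, ← ENNReal.rpow_mul]; norm_num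
  rw [mul_pow, hsq, hsq, one_pow, one_mul]

lemma enorm_sub_le_setLIntegral_of_hasDerivAt (hg : ∀ t, HasDerivAt g (g' t) t)
    (hg' : Continuous g') {s a b : ℝ} (ha : a ∈ Icc 0 s) (hb : b ∈ Icc 0 s) :
    ‖g a - g b‖ₑ ≤ ∫⁻ t in Ioo 0 s, ‖g' t‖ₑ := by
  have hftc : g a - g b = ∫ t in b..a, g' t :=
    (intervalIntegral.integral_eq_sub_of_hasDerivAt (fun t _ => hg t)
      (hg'.intervalIntegrable _ _)).symm
  have habs : ‖∫ t in b..a, g' t‖ₑ = ‖∫ t in uIoc b a, g' t‖ₑ := by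
    simpa only [ofReal_norm] using congrArg ENNReal.ofReal
      (intervalIntegral.norm_integral_eq_norm_integral_uIoc (μ := volume) g')
  rw [hftc, habs, Measure.restrict_congr_set Ioo_ae_eq_Ioc]
  exact (enorm_integral_le_lintegral_enorm _).trans
    (lintegral_mono_set (Ioc_subset_Ioc (le_min hb.1 ha.1) (max_le hb.2 ha.2)))

lemma enorm_sq_le_of_hasDerivAt (hg : ∀ t, HasDerivAt g (g' t) t) (hg' : Continuous g')
    {s a b : ℝ} (ha : a ∈ Icc 0 s) (hb : b ∈ Icc 0 s) :
    ‖g a‖ₑ ^ 2 ≤ 2 * ‖g b‖ₑ ^ 2 + 2 * ENNReal.ofReal s * ∫⁻ t in Ioo 0 s, ‖g' t‖ₑ ^ 2 := by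
  have hcs := sq_lintegral_le (μ := volume.restrict (Ioo 0 s)) (f := fun t => ‖g' t‖ₑ)
    (by fun_prop)
  rw [Measure.restrict_apply_univ, Real.volume_Ioo, sub_zero] at hcs
  have htri : ‖g a‖ₑ ≤ ‖g b‖ₑ + ‖g a - g b‖ₑ := by
    simpa only [add_sub_cancel] using enorm_add_le (g b) (g a - g b)
  calc ‖g a‖ₑ ^ 2 ≤ (‖g b‖ₑ + ‖g a - g b‖ₑ) ^ 2 := pow_le_pow_left' htri 2
    _ ≤ 2 * ‖g b‖ₑ ^ 2 + 2 * ‖g a - g b‖ₑ ^ 2 := ennreal_add_sq_le _ _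
    _ ≤ 2 * ‖g b‖ₑ ^ 2 + 2 * (∫⁻ t in Ioo 0 s, ‖g' t‖ₑ) ^ 2 := by
        gcongr
        exact enorm_sub_le_setLIntegral_of_hasDerivAt hg hg' ha hb
    _ ≤ _ := by rw [mul_assoc]; gcongr

lemma ofReal_mul_enorm_sq_le_of_hasDerivAt (hg : ∀ t, HasDerivAt g (g' t) t)
    (hg' : Continuous g') {s : ℝ} (hs : 0 ≤ s) :
    ENNReal.ofReal s * ‖g 0‖ₑ ^ 2 ≤ 2 * (∫⁻ t in Ioo 0 s, ‖g t‖ₑ ^ 2)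
      + 2 * ENNReal.ofReal s ^ 2 * ∫⁻ t in Ioo 0 s, ‖g' t‖ₑ ^ 2 := by
  have hgm : Measurable fun t => ‖g t‖ₑ ^ 2 :=
    (continuous_iff_continuousAt.2 fun t => (hg t).continuousAt).enorm.measurable.pow_const 2
  have := setLIntegral_mono (μ := volume) (s := Ioo 0 s) ((hgm.const_mul 2).add_const _)
    fun b hb => enorm_sq_le_of_hasDerivAt hg hg' ⟨le_rfl, hs⟩ ⟨hb.1.le, hb.2.le⟩
  rw [setLIntegral_const, Real.volume_Ioo, sub_zero, lintegral_add_right _ measurable_const,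
    lintegral_const_mul _ hgm, setLIntegral_const, Real.volume_Ioo, sub_zero] at this
  rw [mul_comm]
  exact this.trans_eq (by ring)

lemma setLIntegral_enorm_sq_le_of_hasDerivAt (hg : ∀ t, HasDerivAt g (g' t) t)
    (hg' : Continuous g') {s : ℝ} (hs : 0 ≤ s) :
    ∫⁻ t in Ioo 0 s, ‖g t‖ₑ ^ 2 ≤ 2 * ENNReal.ofReal s * ‖g 0‖ₑ ^ 2
      + 2 * ENNReal.ofReal s ^ 2 * ∫⁻ t in Ioo 0 s, ‖g' t‖ₑ ^ 2 := by
  have := setLIntegral_mono (μ := volume) (s := Ioo 0 s) measurable_const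
    fun a ha => enorm_sq_le_of_hasDerivAt hg hg' ⟨ha.1.le, ha.2.le⟩ ⟨le_rfl, hs⟩
  rw [setLIntegral_const, Real.volume_Ioo, sub_zero] at this
  exact this.trans_eq (by ring)

end SegmentEstimates

section BoundaryEstimates

open scoped ENNReal NNReal
open Set Metric

variable {d : ℕ} {Ω : Set (EuclideanSpace ℝ (Fin d))} {φ : EuclideanSpace ℝ (Fin d) → ℂ}

lemma measurable_gradC (hφ : ContDiff ℝ ∞ φ) : Measurable (gradC φ) :=
  (contDiff_gradC hφ).continuous.measurable

lemma fderiv_apply_eq_sum (φ : EuclideanSpace ℝ (Fin d) → ℂ) (x v : EuclideanSpace ℝ (Fin d)) :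
    fderiv ℝ φ x v = ∑ i, v i * gradC φ x i := by
  conv_lhs => rw [← (EuclideanSpace.basisFun (Fin d) ℝ).sum_repr v]
  simp [gradC, map_sum]

lemma norm_fderiv_apply_le (φ : EuclideanSpace ℝ (Fin d) → ℂ) (x v : EuclideanSpace ℝ (Fin d)) :
    ‖fderiv ℝ φ x v‖ ≤ ‖v‖ * ‖gradC φ x‖ := by
  have hinner : fderiv ℝ φ x v =
      ⟪(WithLp.toLp 2 fun i => (v i : ℂ) : EuclideanSpace ℂ (Fin d)), gradC φ x⟫_ℂ := by
    simp [fderiv_apply_eq_sum, PiLp.inner_apply, mul_comm]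
  have hnorm : ‖(WithLp.toLp 2 fun i => (v i : ℂ) : EuclideanSpace ℂ (Fin d))‖ = ‖v‖ := by
    simp [EuclideanSpace.norm_eq]
  rw [hinner, ← hnorm]
  exact norm_inner_le_norm _ _

lemma enorm_fderiv_apply_le {e : EuclideanSpace ℝ (Fin d)} (he : ‖e‖ = 1)
    (φ : EuclideanSpace ℝ (Fin d) → ℂ) (x : EuclideanSpace ℝ (Fin d)) :
    ‖fderiv ℝ φ x e‖ₑ ≤ ‖gradC φ x‖ₑ :=
  enorm_le_iff_norm_le.2 (by simpa only [he, one_mul] using norm_fderiv_apply_le φ x e)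

lemma hasDerivAt_comp_add_smul (hφ : ContDiff ℝ ∞ φ) (x e : EuclideanSpace ℝ (Fin d)) (t : ℝ) :
    HasDerivAt (fun t : ℝ => φ (x + t • e)) (fderiv ℝ φ (x + t • e) e) t := by
  have hline : HasDerivAt (fun t : ℝ => x + t • e) e t := by
    simpa only [id, one_smul] using ((hasDerivAt_id t).smul_const e).const_add x
  exact (hφ.differentiable (by simp) (x + t • e)).hasFDerivAt.comp_hasDerivAt t hline

lemma continuous_fderiv_comp_add_smul (hφ : ContDiff ℝ ∞ φ) (x e : EuclideanSpace ℝ (Fin d)) :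
    Continuous fun t : ℝ => fderiv ℝ φ (x + t • e) e :=
  ((hφ.continuous_fderiv (by simp)).comp (by fun_prop)).clm_apply continuous_const

lemma ofReal_mul_enorm_sq_le_setLIntegral {e : EuclideanSpace ℝ (Fin d)} (he : ‖e‖ = 1)
    (hφ : ContDiff ℝ ∞ φ) (x : EuclideanSpace ℝ (Fin d)) {τ : ℝ} (hτ : 0 ≤ τ) :
    ENNReal.ofReal τ * ‖φ x‖ₑ ^ 2 ≤ 2 * (∫⁻ t in Ioo 0 τ, ‖φ (x + t • e)‖ₑ ^ 2)
      + 2 * ENNReal.ofReal τ ^ 2 * ∫⁻ t in Ioo 0 τ, ‖gradC φ (x + t • e)‖ₑ ^ 2 := by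
  have hline := ofReal_mul_enorm_sq_le_of_hasDerivAt (hasDerivAt_comp_add_smul hφ x e)
    (continuous_fderiv_comp_add_smul hφ x e) hτ
  rw [zero_smul, add_zero] at hline
  refine hline.trans ?_
  gcongr
  exact enorm_fderiv_apply_le he φ _

lemma setLIntegral_add_smul_enorm_sq_le {e : EuclideanSpace ℝ (Fin d)} (he : ‖e‖ = 1)
    (hφ : ContDiff ℝ ∞ φ) (x : EuclideanSpace ℝ (Fin d)) {τ : ℝ} (hτ : 0 ≤ τ) :
    ∫⁻ t in Ioo 0 τ, ‖φ (x + t • e)‖ₑ ^ 2 ≤ 2 * ENNReal.ofReal τ * ‖φ x‖ₑ ^ 2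
      + 2 * ENNReal.ofReal τ ^ 2 * ∫⁻ t in Ioo 0 τ, ‖gradC φ (x + t • e)‖ₑ ^ 2 := by
  have hline := setLIntegral_enorm_sq_le_of_hasDerivAt (hasDerivAt_comp_add_smul hφ x e)
    (continuous_fderiv_comp_add_smul hφ x e) hτ
  rw [zero_smul, add_zero] at hline
  refine hline.trans ?_
  gcongr
  exact enorm_fderiv_apply_le he φ _

namespace IsChart

variable {p e : EuclideanSpace ℝ (Fin d)} {γ : EuclideanSpace ℝ (Fin d) → ℝ} {K : ℝ≥0} {R : ℝ}

lemma measurable_setLIntegral_add_smul (h : IsChart Ω p e γ K R)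
    {f : EuclideanSpace ℝ (Fin d) → ℝ≥0∞} (hf : Measurable f) (I : Set ℝ) :
    Measurable fun y : hyperplane e => ∫⁻ t in I, f (graphMap γ y + t • e) :=
  (hf.comp (measurePreserving_graphMap_add_smul h.norm_eq
    h.lipschitz.continuous.measurable).measurable).lintegral_prod_right'

lemma setLIntegral_surfaceMeasure_le (h : IsChart Ω p e γ K R)
    {f : EuclideanSpace ℝ (Fin d) → ℝ≥0∞} (hf : Measurable f) :
    ∫⁻ x in ball p (radius K R), f x ∂surfaceMeasure Ω ≤
      ((1 + K : ℝ≥0) : ℝ≥0∞) ^ (d - 1) * ∫⁻ y in base e p K R, f (graphMap γ y) := by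
  rw [surfaceMeasure, Measure.restrict_restrict measurableSet_ball, inter_comm]
  simpa only [finrank_euclideanSpace_fin] using
    setLIntegral_euclideanHausdorffMeasure_le_graphMap h.norm_eq h.lipschitz
      h.frontier_inter_ball_subset hf

lemma setLIntegral_graphMap_le (h : IsChart Ω p e γ K R)
    {f : EuclideanSpace ℝ (Fin d) → ℝ≥0∞} (hf : Measurable f) :
    ∫⁻ y in base e p K R, f (graphMap γ y) ≤ ∫⁻ x, f x ∂surfaceMeasure Ω := by
  have hsub : graphMap γ '' base e p K R ⊆ frontier Ω :=
    image_subset_iff.2 fun y hy => h.graphMap_mem_frontier hy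
  simpa only [surfaceMeasure, finrank_euclideanSpace_fin] using
    setLIntegral_graphMap_le_euclideanHausdorffMeasure h.norm_eq h.lipschitz hsub hf

lemma trace_estimate (h : IsChart Ω p e γ K R) {τ : ℝ} (hτ : 0 ≤ τ) (hτR : τ ≤ radius K R)
    (hφ : ContDiff ℝ ∞ φ) :
    ENNReal.ofReal τ * ∫⁻ x in ball p (radius K R), ‖φ x‖ₑ ^ 2 ∂surfaceMeasure Ω ≤
      (((1 + K : ℝ≥0) : ℝ≥0∞) ^ (d - 1) * 2) * ((∫⁻ x in Ω, ‖φ x‖ₑ ^ 2)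
        + ENNReal.ofReal τ ^ 2 * ∫⁻ x in Ω, ‖gradC φ x‖ₑ ^ 2) := by
  have hm : Measurable fun x => ‖φ x‖ₑ ^ 2 := hφ.continuous.measurable.enorm.pow_const 2
  have hm' : Measurable fun x => ‖gradC φ x‖ₑ ^ 2 := (measurable_gradC hφ).enorm.pow_const 2
  have hγ := h.lipschitz.continuous.measurable
  have hΓ : Measurable fun y : hyperplane e => ‖φ (graphMap γ y)‖ₑ ^ 2 :=
    hm.comp (lipschitzWith_graphMap h.norm_eq h.lipschitz).continuous.measurable
  have hmem : ∀ y ∈ base e p K R, ∀ t ∈ Ioo (0 : ℝ) τ, graphMap γ y + t • e ∈ Ω :=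
    fun y hy t ht => h.graphMap_add_smul_mem hy ht.1 (ht.2.le.trans hτR)
  calc _ ≤ ((1 + K : ℝ≥0) : ℝ≥0∞) ^ (d - 1) *
        ∫⁻ y in base e p K R, ENNReal.ofReal τ * ‖φ (graphMap γ y)‖ₑ ^ 2 := by
        rw [lintegral_const_mul _ hΓ, mul_left_comm]
        gcongr
        exact h.setLIntegral_surfaceMeasure_le hm
    _ ≤ ((1 + K : ℝ≥0) : ℝ≥0∞) ^ (d - 1) *
        (2 * (∫⁻ y in base e p K R, ∫⁻ t in Ioo 0 τ, ‖φ (graphMap γ y + t • e)‖ₑ ^ 2)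
        + 2 * ENNReal.ofReal τ ^ 2 *
          ∫⁻ y in base e p K R, ∫⁻ t in Ioo 0 τ, ‖gradC φ (graphMap γ y + t • e)‖ₑ ^ 2) := by
        have hmy := h.measurable_setLIntegral_add_smul hm (Ioo 0 τ)
        rw [← lintegral_const_mul _ hmy, ← lintegral_const_mul _
          (h.measurable_setLIntegral_add_smul hm' _), ← lintegral_add_left (hmy.const_mul 2)]
        gcongr with y
        exact ofReal_mul_enorm_sq_le_setLIntegral h.norm_eq hφ (graphMap γ y) hτ
    _ ≤ ((1 + K : ℝ≥0) : ℝ≥0∞) ^ (d - 1) * (2 * (∫⁻ x in Ω, ‖φ x‖ₑ ^ 2)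
        + 2 * ENNReal.ofReal τ ^ 2 * ∫⁻ x in Ω, ‖gradC φ x‖ₑ ^ 2) := by
        gcongr
        · exact setLIntegral_graphMap_add_smul_le h.norm_eq hγ h.isOpen.measurableSet hm hmem
        · exact setLIntegral_graphMap_add_smul_le h.norm_eq hγ h.isOpen.measurableSet hm' hmem
    _ = _ := by ring

lemma strip_estimate (h : IsChart Ω p e γ K R) {τ : ℝ} (hτ : 0 < τ) (hτR : τ ≤ radius K R)
    (hφ : ContDiff ℝ ∞ φ) :
    ∫⁻ x in strip Ω (τ / (1 + K)) ∩ ball p (radius K R), ‖φ x‖ₑ ^ 2 ≤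
      2 * (ENNReal.ofReal τ * (∫⁻ x, ‖φ x‖ₑ ^ 2 ∂surfaceMeasure Ω)
        + ENNReal.ofReal τ ^ 2 * ∫⁻ x in strip Ω τ, ‖gradC φ x‖ₑ ^ 2) := by
  have hm : Measurable fun x => ‖φ x‖ₑ ^ 2 := hφ.continuous.measurable.enorm.pow_const 2
  have hm' : Measurable fun x => ‖gradC φ x‖ₑ ^ 2 := (measurable_gradC hφ).enorm.pow_const 2
  have hγ := h.lipschitz.continuous.measurable
  have hmy := h.measurable_setLIntegral_add_smul hm' (Ioo 0 τ)
  have hΓ : Measurable fun y : hyperplane e => ‖φ (graphMap γ y)‖ₑ ^ 2 :=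
    hm.comp (lipschitzWith_graphMap h.norm_eq h.lipschitz).continuous.measurable
  calc _ ≤ ∫⁻ y in base e p K R, ∫⁻ t in Ioo 0 τ, ‖φ (graphMap γ y + t • e)‖ₑ ^ 2 :=
        setLIntegral_le_graphMap_add_smul h.norm_eq hγ
          ((isOpen_strip h.isOpen _).inter isOpen_ball).measurableSet hm fun x hx =>
          ⟨orthogonalProjectionOnto_mem_base hx.2, h.height_mem_Ioo hτ hτR hx.1 hx.2⟩
    _ ≤ ∫⁻ y in base e p K R, (2 * ENNReal.ofReal τ * ‖φ (graphMap γ y)‖ₑ ^ 2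
        + 2 * ENNReal.ofReal τ ^ 2 *
          ∫⁻ t in Ioo 0 τ, ‖gradC φ (graphMap γ y + t • e)‖ₑ ^ 2) :=
        lintegral_mono fun y => setLIntegral_add_smul_enorm_sq_le h.norm_eq hφ (graphMap γ y) hτ.le
    _ = 2 * ENNReal.ofReal τ * (∫⁻ y in base e p K R, ‖φ (graphMap γ y)‖ₑ ^ 2)
        + 2 * ENNReal.ofReal τ ^ 2 * ∫⁻ y in base e p K R,
          ∫⁻ t in Ioo 0 τ, ‖gradC φ (graphMap γ y + t • e)‖ₑ ^ 2 := by
        rw [lintegral_add_left (hΓ.const_mul _), lintegral_const_mul _ hΓ,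
          lintegral_const_mul _ hmy]
    _ ≤ 2 * ENNReal.ofReal τ * (∫⁻ x, ‖φ x‖ₑ ^ 2 ∂surfaceMeasure Ω)
        + 2 * ENNReal.ofReal τ ^ 2 * ∫⁻ x in strip Ω τ, ‖gradC φ x‖ₑ ^ 2 := by
        gcongr
        · exact h.setLIntegral_graphMap_le hm
        · exact setLIntegral_graphMap_add_smul_le h.norm_eq hγ
            (isOpen_strip h.isOpen τ).measurableSet hm'
            fun y hy t ht => h.graphMap_add_smul_mem_strip hy ht hτR
    _ = _ := by ring

end IsChart

lemma exists_pos_forall_le {ι : Type*} [Finite ι] (f : ι → ℝ) (hf : ∀ i, 0 < f i) :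
    ∃ c > 0, ∀ i, c ≤ f i := by
  cases isEmpty_or_nonempty ι
  · exact ⟨1, one_pos, fun i => isEmptyElim i⟩
  · obtain ⟨i, hi⟩ := Finite.exists_min f
    exact ⟨f i, hf i, hi⟩

namespace IsBoundedLipschitzDomain

lemma trace_estimate (hΩ : IsBoundedLipschitzDomain Ω) :
    ∃ (C : ℝ≥0) (τ₀ : ℝ), 0 < τ₀ ∧ ∀ τ, 0 < τ → τ ≤ τ₀ → ∀ φ : EuclideanSpace ℝ (Fin d) → ℂ,
      ContDiff ℝ ∞ φ → ENNReal.ofReal τ * ∫⁻ x, ‖φ x‖ₑ ^ 2 ∂surfaceMeasure Ω ≤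
        C * ((∫⁻ x in Ω, ‖φ x‖ₑ ^ 2) + ENNReal.ofReal τ ^ 2 * ∫⁻ x in Ω, ‖gradC φ x‖ₑ ^ 2) := by
  obtain ⟨ι, _, p, e, γ, K, R, h, hcov⟩ := hΩ.exists_atlas
  obtain ⟨τ₀, hτ₀, hτ₀'⟩ := exists_pos_forall_le _ fun i => (h i).radius_pos
  refine ⟨∑ i, (1 + K i) ^ (d - 1) * 2, τ₀, hτ₀, fun τ hτ hτ' φ hφ => ?_⟩
  have hcov' : ∫⁻ x, ‖φ x‖ₑ ^ 2 ∂surfaceMeasure Ω ≤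
      ∑ i, ∫⁻ x in ball (p i) (IsChart.radius (K i) (R i)), ‖φ x‖ₑ ^ 2 ∂surfaceMeasure Ω := by
    have : surfaceMeasure Ω =
        (surfaceMeasure Ω).restrict (⋃ i, ball (p i) (IsChart.radius (K i) (R i))) := by
      rw [surfaceMeasure, Measure.restrict_restrict (MeasurableSet.iUnion fun i =>
        measurableSet_ball), inter_eq_self_of_subset_right hcov]
    conv_lhs => rw [this]
    exact (lintegral_iUnion_le _ _).trans_eq (tsum_fintype _)
  refine (mul_le_mul_right hcov' _).trans ?_
  push_cast
  rw [Finset.mul_sum, Finset.sum_mul]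
  refine Finset.sum_le_sum fun i _ => ?_
  simpa only [ENNReal.coe_add, ENNReal.coe_one] using
    (h i).trace_estimate hτ.le (hτ'.trans (hτ₀' i)) hφ

lemma isFiniteMeasure_surfaceMeasure (hΩ : IsBoundedLipschitzDomain Ω) :
    IsFiniteMeasure (surfaceMeasure Ω) := by
  obtain ⟨C, τ, hτ, h⟩ := hΩ.trace_estimate
  have hone := h τ hτ le_rfl (fun _ => 1) contDiff_const
  have hgrad : gradC (fun _ : EuclideanSpace ℝ (Fin d) => (1 : ℂ)) = 0 := by
    ext x i
    simp [gradC]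
  simp only [hgrad, enorm_one, one_pow, lintegral_const, one_mul, Pi.zero_apply, enorm_zero,
    ne_eq, OfNat.ofNat_ne_zero, not_false_eq_true, zero_pow, zero_mul, mul_zero, add_zero,
    Measure.restrict_apply_univ] at hone
  refine ⟨lt_of_mul_lt_mul_left' (a := ENNReal.ofReal τ) (hone.trans_lt ?_)⟩
  rw [ENNReal.mul_top (ENNReal.ofReal_pos.2 hτ).ne']
  exact ENNReal.mul_lt_top ENNReal.coe_lt_top hΩ.isBounded.measure_lt_top

lemma strip_estimate (hΩ : IsBoundedLipschitzDomain Ω) :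
    ∃ (C : ℝ≥0) (c τ₀ : ℝ), 0 < c ∧ 0 < τ₀ ∧ ∀ τ, 0 < τ → τ ≤ τ₀ →
      ∀ φ : EuclideanSpace ℝ (Fin d) → ℂ, ContDiff ℝ ∞ φ →
      ∫⁻ x in strip Ω (c * τ), ‖φ x‖ₑ ^ 2 ≤
        C * (ENNReal.ofReal τ * (∫⁻ x, ‖φ x‖ₑ ^ 2 ∂surfaceMeasure Ω)
          + ENNReal.ofReal τ ^ 2 * ∫⁻ x in strip Ω τ, ‖gradC φ x‖ₑ ^ 2) := by
  obtain ⟨ι, _, p, e, γ, K, R, h, hcov⟩ := hΩ.exists_atlas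
  obtain ⟨τ₁, hτ₁, hτ₁'⟩ := exists_pos_forall_le _ fun i => (h i).radius_pos
  obtain ⟨c, hc, hcK⟩ := exists_pos_forall_le (fun i => (1 + (K i : ℝ))⁻¹) fun i => by positivity
  obtain ⟨ε, hε, hεU⟩ := exists_strip_subset hΩ.isOpen hΩ.isBounded.isCompact_closure
    (isOpen_iUnion fun i => isOpen_ball) hcov
  refine ⟨∑ _i : ι, 2, c, min τ₁ (ε / c), hc, by positivity, fun τ hτ hτ' φ hφ => ?_⟩
  have hcov' : strip Ω (c * τ) ⊆ ⋃ i, strip Ω (τ / (1 + K i)) ∩ ball (p i)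
      (IsChart.radius (K i) (R i)) := fun x hx => by
    have hcτ : c * τ ≤ ε := (le_div_iff₀' hc).1 (hτ'.trans (min_le_right _ _))
    obtain ⟨i, hi⟩ := mem_iUnion.1 (hεU ⟨hx.1, thickening_mono hcτ _ hx.2⟩)
    refine mem_iUnion.2 ⟨i, ⟨hx.1, thickening_mono ?_ _ hx.2⟩, hi⟩
    simpa only [inv_mul_eq_div] using mul_le_mul_of_nonneg_right (hcK i) hτ.le
  refine (lintegral_mono_set hcov').trans ((lintegral_iUnion_le _ _).trans ?_)
  rw [tsum_fintype]
  push_cast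
  rw [Finset.sum_mul]
  exact Finset.sum_le_sum fun i _ =>
    (h i).strip_estimate hτ ((hτ'.trans (min_le_left _ _)).trans (hτ₁' i)) hφ

end IsBoundedLipschitzDomain

end BoundaryEstimates

section Mollifiers

open scoped ENNReal NNReal
open Set Metric

lemma eLpNorm_two_sq {X F : Type*} [MeasurableSpace X] {μ : Measure X} [NormedAddCommGroup F]
    (f : X → F) : eLpNorm f 2 μ ^ 2 = ∫⁻ x, ‖f x‖ₑ ^ 2 ∂μ := by
  have := eLpNorm_nnreal_pow_eq_lintegral (μ := μ) (f := f) (p := 2) (by norm_num)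
  simpa using this

lemma enorm_Lp_sq {X F : Type*} [MeasurableSpace X] {μ : Measure X} [NormedAddCommGroup F]
    (f : Lp F 2 μ) : ‖f‖ₑ ^ 2 = ∫⁻ x, ‖f x‖ₑ ^ 2 ∂μ := by
  rw [Lp.enorm_def, eLpNorm_two_sq]

lemma enorm_toLp_sq {X F : Type*} [MeasurableSpace X] {μ : Measure X} [NormedAddCommGroup F]
    {f : X → F} (hf : MemLp f 2 μ) : ‖hf.toLp f‖ₑ ^ 2 = ∫⁻ x, ‖f x‖ₑ ^ 2 ∂μ := by
  rw [Lp.enorm_toLp, eLpNorm_two_sq]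

variable {E : Type*} [NormedAddCommGroup E] [InnerProductSpace ℝ E] [FiniteDimensional ℝ E]
  [MeasurableSpace E] [BorelSpace E] {F : Type*} [NormedAddCommGroup F] [NormedSpace ℝ F]

/-- A smooth probability density with compact support, used as a convolution kernel. -/
structure IsMollifier (ρ : E → ℝ) : Prop where
  smooth : ContDiff ℝ ∞ ρ
  compact : HasCompactSupport ρ
  nonneg : ∀ x, 0 ≤ ρ x
  integral_eq : ∫ x, ρ x = 1

lemma exists_isMollifier (c : E) {r : ℝ} (hr : 0 < r) :
    ∃ ρ : E → ℝ, IsMollifier ρ ∧ tsupport ρ = closedBall c r := by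
  let b : ContDiffBump c := ⟨r / 2, r, by positivity, by linarith⟩
  exact ⟨b.normed volume, ⟨b.contDiff_normed, b.hasCompactSupport_normed, b.nonneg_normed,
    b.integral_normed⟩, b.tsupport_normed_eq⟩

/-- The convolution `ρ * f` with the kernel `ρ`. -/
def mollify (ρ : E → ℝ) (f : E → F) (x : E) : F := ∫ t, ρ t • f (x - t)

lemma mollify_eq_swap (ρ : E → ℝ) (f : E → F) (x : E) :
    mollify ρ f x = ∫ t, ρ (x - t) • f t :=
  convolution_lsmul_swap (𝕜 := ℝ) (μ := volume) (f := ρ) (g := f) (x := x)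

namespace IsMollifier

variable {ρ : E → ℝ}

lemma integrable (h : IsMollifier ρ) : Integrable ρ :=
  h.smooth.continuous.integrable_of_hasCompactSupport h.compact

lemma lintegral_eq (h : IsMollifier ρ) : ∫⁻ x, ENNReal.ofReal (ρ x) = 1 := by
  rw [← ofReal_integral_eq_lintegral_ofReal h.integrable (Filter.Eventually.of_forall h.nonneg),
    h.integral_eq, ENNReal.ofReal_one]

lemma integrable_mollify (h : IsMollifier ρ) {f : E → F} (hf : LocallyIntegrable f) (x : E) :
    Integrable fun t => ρ t • f (x - t) :=
  h.compact.convolutionExists_left (L := ContinuousLinearMap.lsmul ℝ ℝ) h.smooth.continuous hf x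

lemma contDiff_mollify (h : IsMollifier ρ) {f : E → F} (hf : LocallyIntegrable f) :
    ContDiff ℝ ∞ (mollify ρ f) :=
  h.compact.contDiff_convolution_left (μ := volume) (L := ContinuousLinearMap.lsmul ℝ ℝ)
    h.smooth hf

lemma fderiv_mollify (h : IsMollifier ρ) {f : E → F} (hf : LocallyIntegrable f) (x v : E) :
    fderiv ℝ (mollify ρ f) x v = ∫ t, (fderiv ℝ ρ (x - t) v) • f t := by
  have hderiv : fderiv ℝ (mollify ρ f) x = _ :=
    (h.compact.hasFDerivAt_convolution_left (μ := volume) (ContinuousLinearMap.lsmul ℝ ℝ)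
      (h.smooth.of_le (by simp)) hf x).fderiv
  have hint : Integrable fun t => ((ContinuousLinearMap.lsmul ℝ ℝ : ℝ →L[ℝ] F →L[ℝ] F).precompL E)
      (fderiv ℝ ρ (x - t)) (f t) :=
    ((h.compact.fderiv ℝ).convolutionExists_left
      (L := (ContinuousLinearMap.lsmul ℝ ℝ : ℝ →L[ℝ] F →L[ℝ] F).precompL E)
      (h.smooth.continuous_fderiv (by simp)) hf x).integrable_swap
  rw [hderiv, convolution_eq_swap, ContinuousLinearMap.integral_apply hint]
  simp [ContinuousLinearMap.precompL_apply]

lemma enorm_mollify_sub_sq_le [CompleteSpace F] [MeasurableSpace F] [BorelSpace F]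
    (h : IsMollifier ρ) {f : E → F} (hm : Measurable f) (hf : LocallyIntegrable f) (x : E) :
    ‖mollify ρ f x - f x‖ₑ ^ 2 ≤ ∫⁻ t, ENNReal.ofReal (ρ t) * ‖f (x - t) - f x‖ₑ ^ 2 := by
  have herr : mollify ρ f x - f x = ∫ t, ρ t • (f (x - t) - f x) := by
    simp only [smul_sub]
    rw [integral_sub (h.integrable_mollify hf x) (h.integrable.smul_const _),
      integral_smul_const, h.integral_eq, one_smul]
    rfl
  have hmd : Measurable fun t => ENNReal.ofReal (ρ t) :=
    h.smooth.continuous.measurable.ennreal_ofReal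
  have hmf : Measurable fun t => ‖f (x - t) - f x‖ₑ :=
    ((hm.comp (measurable_const.sub measurable_id)).sub_const _).enorm
  have hle : ‖mollify ρ f x - f x‖ₑ ≤ ∫⁻ t, ‖f (x - t) - f x‖ₑ
      ∂(volume.withDensity fun t => ENNReal.ofReal (ρ t)) := by
    rw [herr, lintegral_withDensity_eq_lintegral_mul _ hmd hmf]
    refine (enorm_integral_le_lintegral_enorm _).trans (le_of_eq (lintegral_congr fun t => ?_))
    rw [enorm_smul, Pi.mul_apply, Real.enorm_eq_ofReal (h.nonneg t)]
  refine (pow_le_pow_left' hle 2).trans ((sq_lintegral_le hmf.aemeasurable).trans (le_of_eq ?_))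
  rw [withDensity_apply _ MeasurableSet.univ, setLIntegral_univ, h.lintegral_eq, one_mul,
    lintegral_withDensity_eq_lintegral_mul _ hmd (hmf.pow_const 2)]
  rfl

lemma lintegral_mollify_sub_le [CompleteSpace F] [MeasurableSpace F] [BorelSpace F]
    [SecondCountableTopology F] (h : IsMollifier ρ) {f : E → F} (hm : Measurable f)
    (hf : LocallyIntegrable f) {A : Set E} {M : ℝ≥0∞}
    (hM : ∀ t ∈ tsupport ρ, ∫⁻ x in A, ‖f (x - t) - f x‖ₑ ^ 2 ≤ M) :
    ∫⁻ x in A, ‖mollify ρ f x - f x‖ₑ ^ 2 ≤ M := by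
  have hmd : Measurable fun t => ENNReal.ofReal (ρ t) :=
    h.smooth.continuous.measurable.ennreal_ofReal
  have hmf : Measurable fun q : E × E => ‖f (q.1 - q.2) - f q.1‖ₑ ^ 2 :=
    ((hm.comp (measurable_fst.sub measurable_snd)).sub (hm.comp measurable_fst)).enorm.pow_const 2
  have hmt : ∀ t, Measurable fun x => ‖f (x - t) - f x‖ₑ ^ 2 := fun t =>
    ((hm.comp (measurable_id.sub_const t)).sub hm).enorm.pow_const 2
  calc ∫⁻ x in A, ‖mollify ρ f x - f x‖ₑ ^ 2
      ≤ ∫⁻ x in A, ∫⁻ t, ENNReal.ofReal (ρ t) * ‖f (x - t) - f x‖ₑ ^ 2 :=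
        lintegral_mono fun x => h.enorm_mollify_sub_sq_le hm hf x
    _ = ∫⁻ t, ∫⁻ x in A, ENNReal.ofReal (ρ t) * ‖f (x - t) - f x‖ₑ ^ 2 :=
        lintegral_lintegral_swap (f := fun x t => ENNReal.ofReal (ρ t) * ‖f (x - t) - f x‖ₑ ^ 2)
          ((hmd.comp measurable_snd).mul hmf).aemeasurable
    _ = ∫⁻ t, ENNReal.ofReal (ρ t) * ∫⁻ x in A, ‖f (x - t) - f x‖ₑ ^ 2 := by
        refine lintegral_congr fun t => lintegral_const_mul _ (hmt t)
    _ ≤ ∫⁻ t, ENNReal.ofReal (ρ t) * M := by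
        refine lintegral_mono fun t => ?_
        by_cases ht : t ∈ tsupport ρ
        · dsimp only
          gcongr
          exact hM t ht
        · simp [image_eq_zero_of_notMem_tsupport ht]
    _ = M := by rw [lintegral_mul_const _ hmd, h.lintegral_eq, one_mul]

end IsMollifier

lemma mollify_indicator (ρ : E → ℝ) {A : Set E} (hA : MeasurableSet A) (f : E → F) (x : E) :
    mollify ρ (A.indicator f) x = ∫ t in A, ρ (x - t) • f t := by
  rw [mollify_eq_swap, ← integral_indicator hA, indicator_smul]

omit [NormedSpace ℝ F] in
lemma exists_lintegral_translate_sub_le {f : E → F} (hf : MemLp f 2 volume) {ε : ℝ≥0∞}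
    (hε : 0 < ε) : ∃ δ > 0, ∀ t, ‖t‖ < δ → ∫⁻ x, ‖f (x - t) - f x‖ₑ ^ 2 ≤ ε := by
  let shift : E → C(E, E) := fun t => ⟨fun x => x - t, by fun_prop⟩
  have hshift : Continuous shift :=
    ContinuousMap.continuous_of_continuous_uncurry _ (continuous_snd.sub continuous_fst)
  have hpres (t : E) : MeasurePreserving (shift t) (volume : Measure E) volume :=
    measurePreserving_sub_right volume t
  let T (t : E) : Lp F 2 (volume : Measure E) :=
    Lp.compMeasurePreserving (shift t) (hpres t) (hf.toLp f)
  have hT : Continuous T := continuous_const.compMeasurePreservingLp hshift hpres (by norm_num)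
  have hTf (t : E) : T t =ᵐ[volume] fun x => f (x - t) :=
    (Lp.coeFn_compMeasurePreserving _ (hpres t)).trans
      ((hpres t).quasiMeasurePreserving.ae_eq_comp hf.coeFn_toLp)
  have hlim : Filter.Tendsto (fun t => ‖T t - T 0‖ₑ ^ 2) (𝓝 0) (𝓝 0) := by
    simpa [Function.comp_def] using
      ((ENNReal.continuous_pow 2).comp (hT.sub (continuous_const (y := T 0))).enorm).tendsto 0
  obtain ⟨δ, hδ, hδε⟩ := Metric.eventually_nhds_iff.1 (hlim.eventually_le_const hε)
  refine ⟨δ, hδ, fun t ht => ?_⟩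
  have hTt : ‖T t - T 0‖ₑ ^ 2 ≤ ε := hδε (by simpa using ht)
  rw [enorm_Lp_sq] at hTt
  refine (lintegral_congr_ae ?_).trans_le hTt
  filter_upwards [hTf t, hTf 0, Lp.coeFn_sub (T t) (T 0)] with x ht h0 hsub
  rw [hsub, Pi.sub_apply, ht, h0, sub_zero]

lemma exists_eLpNorm_mollify_sub_le [CompleteSpace F] [MeasurableSpace F] [BorelSpace F]
    [SecondCountableTopology F] {f : E → F} (hm : Measurable f) (hf : MemLp f 2 volume)
    {ε : ℝ≥0∞} (hε : 0 < ε) :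
    ∃ δ > 0, ∀ ρ, IsMollifier ρ → tsupport ρ ⊆ ball 0 δ →
      eLpNorm (mollify ρ f - f) 2 volume ≤ ε := by
  obtain ⟨δ, hδ, htrans⟩ := exists_lintegral_translate_sub_le hf (ε := ε ^ 2) (by positivity)
  refine ⟨δ, hδ, fun ρ hρ hρδ => ?_⟩
  rw [← ENNReal.pow_le_pow_left_iff two_ne_zero, eLpNorm_two_sq, ← setLIntegral_univ]
  refine hρ.lintegral_mollify_sub_le hm (hf.locallyIntegrable (by norm_num)) fun t ht => ?_
  rw [setLIntegral_univ]
  exact htrans t (mem_ball_zero_iff.1 (hρδ ht))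

end Mollifiers

section Density

open scoped ENNReal NNReal Manifold
open Set Metric

/-- The points of `A` are moved into `Ω` by all `-t`, `t` in a suitable ball, and this ball can be
found arbitrarily close to the origin. Its centre need not be the origin: near the boundary of a
Lipschitz domain it points outwards. -/
def HasSmallShiftsInto {E : Type*} [SeminormedAddCommGroup E] (A Ω : Set E) : Prop :=
  ∀ δ > 0, ∃ c, ∃ s > 0, closedBall c s ⊆ ball 0 δ ∧ ∀ x ∈ A, ∀ t ∈ closedBall c s, x - t ∈ Ω

lemma HasSmallShiftsInto.mono {E : Type*} [SeminormedAddCommGroup E] {A B Ω : Set E}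
    (h : HasSmallShiftsInto B Ω) (hAB : A ⊆ B) : HasSmallShiftsInto A Ω := fun δ hδ => by
  obtain ⟨c, s, hs, hδs, hΩ⟩ := h δ hδ
  exact ⟨c, s, hs, hδs, fun x hx => hΩ x (hAB hx)⟩

lemma HasSmallShiftsInto.exists_isMollifier {E : Type*} [NormedAddCommGroup E]
    [InnerProductSpace ℝ E] [FiniteDimensional ℝ E] [MeasurableSpace E] [BorelSpace E]
    {A Ω : Set E} (h : HasSmallShiftsInto A Ω) {δ : ℝ} (hδ : 0 < δ) :
    ∃ ρ : E → ℝ, IsMollifier ρ ∧ tsupport ρ ⊆ ball 0 δ ∧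
      ∀ x ∈ A, ∀ t ∈ tsupport ρ, x - t ∈ Ω := by
  obtain ⟨c, s, hs, hδs, hΩ⟩ := h δ hδ
  obtain ⟨ρ, hρ, hρs⟩ := RobinDN.exists_isMollifier c hs
  exact ⟨ρ, hρ, hρs ▸ hδs, by rwa [hρs]⟩

lemma hasSmallShiftsInto_ball {E : Type*} [SeminormedAddCommGroup E] (p : E) {R : ℝ} (hR : 0 < R) :
    HasSmallShiftsInto (ball p (R / 2)) (ball p R) := by
  refine fun δ hδ => ⟨0, min (R / 2) (δ / 2), by positivity,
    closedBall_subset_ball ((min_le_right _ _).trans_lt (half_lt_self hδ)), fun x hx t ht => ?_⟩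
  have htR : ‖t‖ ≤ R / 2 := (mem_closedBall_zero_iff.1 ht).trans (min_le_left _ _)
  rw [mem_ball, dist_eq_norm] at hx ⊢
  rw [sub_right_comm]
  linarith [norm_sub_le (x - p) t]

lemma IsChart.hasSmallShiftsInto {E : Type*} [NormedAddCommGroup E] [InnerProductSpace ℝ E]
    {Ω : Set E} {p e : E} {γ : E → ℝ} {K : ℝ≥0} {R : ℝ} (h : IsChart Ω p e γ K R) :
    HasSmallShiftsInto (Ω ∩ ball p (R / 2)) Ω := by
  intro δ hδ
  have hR := h.pos
  set s : ℝ := min (R / 2) δ / 2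
  have hs : 0 < s := by positivity
  have hsmin : s + s = min (R / 2) δ := add_halves _
  have hc : s / (2 * (1 + K)) ≤ s / 2 := by
    gcongr
    linarith [K.2]
  have hnorm {t : E} (ht : t ∈ closedBall (-(s • e)) (s / (2 * (1 + K)))) : ‖t‖ < s + s := by
    have hse : ‖s • e‖ = s := by rw [norm_smul, h.norm_eq, mul_one, Real.norm_of_nonneg hs.le]
    rw [mem_closedBall, dist_eq_norm, sub_neg_eq_add] at ht
    linarith [norm_le_add_norm_add t (s • e)]
  refine ⟨-(s • e), s / (2 * (1 + K)), by positivity, fun t ht => ?_, fun x hx t ht => ?_⟩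
  · exact mem_ball_zero_iff.2 ((hnorm ht).trans_le (hsmin ▸ min_le_right _ _))
  · have hxR : dist x p < R / 2 := hx.2
    have hxt : x - t ∈ ball p R := by
      have : dist (x - t) x < R / 2 := by
        rw [dist_eq_norm, sub_sub_cancel_left, norm_neg]
        exact (hnorm ht).trans_le (hsmin ▸ min_le_left _ _)
      rw [mem_ball]
      linarith [dist_triangle (x - t) x p]
    have hpos : 0 < height e γ x := (h.mem_iff x (mem_ball.2 (by linarith))).1 hx.1
    have hdist : |height e γ (x - t) - (height e γ x + s)| ≤ s / 2 := by
      rw [← height_add_smul h.norm_eq, ← Real.dist_eq]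
      calc dist (height e γ (x - t)) (height e γ (x + s • e))
          ≤ ((1 + K : ℝ≥0) : ℝ) * dist (x - t) (x + s • e) :=
            (lipschitzWith_height h.norm_eq h.lipschitz).dist_le_mul _ _
        _ ≤ (1 + K) * (s / (2 * (1 + K))) := by
            push_cast
            gcongr
            rw [mem_closedBall, dist_eq_norm] at ht
            rwa [dist_eq_norm, ← norm_neg, show -(x - t - (x + s • e)) = t - -(s • e) by abel]
        _ = s / 2 := by field_simp
    rw [h.mem_iff _ hxt]
    linarith [(abs_le.1 hdist).1]

variable {d : ℕ} {Ω : Set (EuclideanSpace ℝ (Fin d))}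

lemma IsBoundedLipschitzDomain.exists_hasSmallShiftsInto (hΩ : IsBoundedLipschitzDomain Ω)
    {p : EuclideanSpace ℝ (Fin d)} (hp : p ∈ closure Ω) :
    ∃ r > 0, HasSmallShiftsInto (Ω ∩ ball p r) Ω := by
  by_cases hpΩ : p ∈ Ω
  · obtain ⟨R, hR, hRΩ⟩ := Metric.isOpen_iff.1 hΩ.isOpen p hpΩ
    refine ⟨R / 2, half_pos hR, fun δ hδ => ?_⟩
    obtain ⟨c, s, hs, hδs, h⟩ := hasSmallShiftsInto_ball p hR δ hδ
    exact ⟨c, s, hs, hδs, fun x hx t ht => hRΩ (h x hx.2 t ht)⟩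
  · obtain ⟨e, γ, K, R, h⟩ := hΩ.exists_isChart (hΩ.isOpen.frontier_eq ▸ ⟨hp, hpΩ⟩ : p ∈ frontier Ω)
    exact ⟨R / 2, half_pos h.pos, h.hasSmallShiftsInto⟩

lemma IsMollifier.isTestFunction_comp_sub {ρ : EuclideanSpace ℝ (Fin d) → ℝ} (hρ : IsMollifier ρ)
    {x : EuclideanSpace ℝ (Fin d)} (hx : ∀ t ∈ tsupport ρ, x - t ∈ Ω) :
    IsTestFunction Ω fun t => (ρ (x - t) : ℂ) := by
  have hcomp : (fun t => (ρ (x - t) : ℂ)) = (fun t => (ρ t : ℂ)) ∘ Homeomorph.subLeft x := rfl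
  have hcompact : HasCompactSupport fun t => (ρ t : ℂ) :=
    hρ.compact.comp_left (g := ((↑) : ℝ → ℂ)) Complex.ofReal_zero
  refine ⟨Complex.ofRealCLM.contDiff.comp (hρ.smooth.comp (contDiff_const.sub contDiff_id)),
    hcomp ▸ hcompact.comp_homeomorph _, ?_⟩
  rw [hcomp, tsupport_comp_eq_preimage]
  intro t ht
  have hmem : x - t ∈ tsupport ρ :=
    closure_mono (s := Function.support fun t => (ρ t : ℂ)) (fun y hy => by simpa using hy) ht
  simpa using hx _ hmem

lemma IsMollifier.gradC_comp_sub {ρ : EuclideanSpace ℝ (Fin d) → ℝ} (hρ : IsMollifier ρ)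
    (x t : EuclideanSpace ℝ (Fin d)) (i : Fin d) :
    gradC (fun t => (ρ (x - t) : ℂ)) t i =
      -((fderiv ℝ ρ (x - t) (EuclideanSpace.single i 1) : ℝ) : ℂ) := by
  have hderiv : HasFDerivAt (fun t => ρ (x - t))
      ((fderiv ℝ ρ (x - t)).comp (-ContinuousLinearMap.id ℝ _)) t :=
    (hρ.smooth.differentiable (by simp) (x - t)).hasFDerivAt.comp t
      (by simpa using (hasFDerivAt_id t).const_sub x)
  have hderivC : HasFDerivAt (fun t => (ρ (x - t) : ℂ)) _ t :=
    Complex.ofRealCLM.hasFDerivAt.comp t hderiv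
  simp [gradC, hderivC.fderiv]

lemma IsMollifier.mollify_apply {ρ : EuclideanSpace ℝ (Fin d) → ℝ} (hρ : IsMollifier ρ)
    {G : EuclideanSpace ℝ (Fin d) → EuclideanSpace ℂ (Fin d)} (hG : LocallyIntegrable G)
    (x : EuclideanSpace ℝ (Fin d)) (i : Fin d) :
    mollify ρ G x i = mollify ρ (fun t => G t i) x := by
  simpa [mollify] using (((EuclideanSpace.proj i : EuclideanSpace ℂ (Fin d) →L[ℂ] ℂ).restrictScalars
    ℝ).integral_comp_comm (hρ.integrable_mollify hG x)).symm

lemma IsWeakGradient.gradC_mollify (hΩ : MeasurableSet Ω) {u : L2 Ω} {G : L2vec Ω}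
    (h : IsWeakGradient Ω u G) {ρ : EuclideanSpace ℝ (Fin d) → ℝ} (hρ : IsMollifier ρ)
    (hu : LocallyIntegrable (Ω.indicator u)) (hG : LocallyIntegrable (Ω.indicator G))
    {x : EuclideanSpace ℝ (Fin d)} (hx : ∀ t ∈ tsupport ρ, x - t ∈ Ω) :
    gradC (mollify ρ (Ω.indicator u)) x = mollify ρ (Ω.indicator G) x := by
  ext i
  calc gradC (mollify ρ (Ω.indicator u)) x i
      = -∫ t in Ω, u t * gradC (fun t => (ρ (x - t) : ℂ)) t i := by
        simp only [gradC]
        rw [hρ.fderiv_mollify hu, ← integral_neg, ← integral_indicator hΩ]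
        congr with t
        by_cases ht : t ∈ Ω
        · have := hρ.gradC_comp_sub x t i
          simp only [gradC] at this
          simp only [indicator_of_mem ht, this, Complex.real_smul]
          ring
        · simp only [indicator_of_notMem ht, smul_zero]
    _ = ∫ t in Ω, G t i * ρ (x - t) := by
        rw [h _ (hρ.isTestFunction_comp_sub hx) i, neg_neg]
    _ = mollify ρ (Ω.indicator G) x i := by
        have hcomp : (fun t => Ω.indicator G t i) = Ω.indicator fun t => G t i := by
          ext t; by_cases ht : t ∈ Ω <;> simp [ht]
        rw [hρ.mollify_apply hG, hcomp, mollify_indicator ρ hΩ]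
        simp only [Complex.real_smul, mul_comm]

lemma gradC_mul {χ f : EuclideanSpace ℝ (Fin d) → ℂ} (hχ : ContDiff ℝ ∞ χ) (hf : ContDiff ℝ ∞ f)
    (x : EuclideanSpace ℝ (Fin d)) :
    gradC (fun x => χ x * f x) x = f x • gradC χ x + χ x • gradC f x := by
  have hderiv : fderiv ℝ (fun x => χ x * f x) x = _ :=
    ((hχ.differentiable (by simp) x).hasFDerivAt.mul
      (hf.differentiable (by simp) x).hasFDerivAt).fderiv
  ext i
  simp [gradC, hderiv, add_comm]

lemma gradC_sum {ι : Type*} (s : Finset ι) {φ : ι → EuclideanSpace ℝ (Fin d) → ℂ}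
    (hφ : ∀ i, ContDiff ℝ ∞ (φ i)) (x : EuclideanSpace ℝ (Fin d)) :
    gradC (fun x => ∑ i ∈ s, φ i x) x = ∑ i ∈ s, gradC (φ i) x := by
  have hderiv : fderiv ℝ (fun x => ∑ i ∈ s, φ i x) x = ∑ i ∈ s, fderiv ℝ (φ i) x :=
    fderiv_fun_sum fun i _ => (hφ i).differentiable (by simp) x
  ext k
  simp [gradC, hderiv]

/-- The pair `(u, G)` is a limit in `L²(Ω) × L²(Ω; ℂᵈ)` of pairs `(φ, ∇φ)` with `φ` smooth and
compactly supported in the whole space. -/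
structure HasSmoothApprox (Ω : Set (EuclideanSpace ℝ (Fin d))) (u : EuclideanSpace ℝ (Fin d) → ℂ)
    (G : EuclideanSpace ℝ (Fin d) → EuclideanSpace ℂ (Fin d)) : Prop where
  aestronglyMeasurable : AEStronglyMeasurable u (volume.restrict Ω)
  aestronglyMeasurable_grad : AEStronglyMeasurable G (volume.restrict Ω)
  exists_le : ∀ ε > 0, ∃ φ : EuclideanSpace ℝ (Fin d) → ℂ, ContDiff ℝ ∞ φ ∧ HasCompactSupport φ ∧
    eLpNorm (φ - u) 2 (volume.restrict Ω) ≤ ε ∧ eLpNorm (gradC φ - G) 2 (volume.restrict Ω) ≤ ε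

namespace HasSmoothApprox

variable {u v : EuclideanSpace ℝ (Fin d) → ℂ}
  {G H : EuclideanSpace ℝ (Fin d) → EuclideanSpace ℂ (Fin d)}

lemma congr_ae (h : HasSmoothApprox Ω u G) (huv : u =ᵐ[volume.restrict Ω] v)
    (hGH : G =ᵐ[volume.restrict Ω] H) : HasSmoothApprox Ω v H where
  aestronglyMeasurable := h.aestronglyMeasurable.congr huv
  aestronglyMeasurable_grad := h.aestronglyMeasurable_grad.congr hGH
  exists_le ε hε := by
    obtain ⟨φ, hφ, hφc, hu, hG⟩ := h.exists_le ε hε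
    rw [eLpNorm_congr_ae (.sub .rfl huv)] at hu
    rw [eLpNorm_congr_ae (.sub .rfl hGH)] at hG
    exact ⟨φ, hφ, hφc, hu, hG⟩

lemma zero : HasSmoothApprox Ω 0 0 where
  aestronglyMeasurable := aestronglyMeasurable_zero
  aestronglyMeasurable_grad := aestronglyMeasurable_zero
  exists_le ε _ := by
    refine ⟨0, contDiff_const, .zero, by simp, ?_⟩
    rw [show gradC (0 : EuclideanSpace ℝ (Fin d) → ℂ) = 0 by ext x i; simp [gradC]]
    simp

lemma add (h : HasSmoothApprox Ω u G) (h' : HasSmoothApprox Ω v H) :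
    HasSmoothApprox Ω (u + v) (G + H) where
  aestronglyMeasurable := h.aestronglyMeasurable.add h'.aestronglyMeasurable
  aestronglyMeasurable_grad := h.aestronglyMeasurable_grad.add h'.aestronglyMeasurable_grad
  exists_le ε hε := by
    obtain ⟨φ, hφ, hφc, hu, hG⟩ := h.exists_le (ε / 2) (ENNReal.half_pos hε.ne')
    obtain ⟨ψ, hψ, hψc, hv, hH⟩ := h'.exists_le (ε / 2) (ENNReal.half_pos hε.ne')
    refine ⟨φ + ψ, hφ.add hψ, hφc.add hψc, ?_, ?_⟩
    · rw [add_sub_add_comm, ← ENNReal.add_halves ε]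
      exact (eLpNorm_add_le (hφ.continuous.aestronglyMeasurable.sub h.aestronglyMeasurable)
        (hψ.continuous.aestronglyMeasurable.sub h'.aestronglyMeasurable) (by norm_num)).trans
        (add_le_add hu hv)
    · rw [gradC_add hφ hψ, add_sub_add_comm, ← ENNReal.add_halves ε]
      exact (eLpNorm_add_le
        ((contDiff_gradC hφ).continuous.aestronglyMeasurable.sub h.aestronglyMeasurable_grad)
        ((contDiff_gradC hψ).continuous.aestronglyMeasurable.sub h'.aestronglyMeasurable_grad)
        (by norm_num)).trans (add_le_add hG hH)

lemma sum {ι : Type*} (s : Finset ι) {u : ι → EuclideanSpace ℝ (Fin d) → ℂ}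
    {G : ι → EuclideanSpace ℝ (Fin d) → EuclideanSpace ℂ (Fin d)}
    (h : ∀ i, HasSmoothApprox Ω (u i) (G i)) :
    HasSmoothApprox Ω (∑ i ∈ s, u i) (∑ i ∈ s, G i) := by
  classical
  induction s using Finset.induction_on with
  | empty => simpa only [Finset.sum_empty] using zero
  | insert i s hi ih =>
    rw [Finset.sum_insert hi, Finset.sum_insert hi]
    exact (h i).add ih

end HasSmoothApprox

lemma exists_norm_le_of_hasCompactSupport {X F : Type*} [TopologicalSpace X]
    [SeminormedAddCommGroup F] {f : X → F} (hf : Continuous f) (hc : HasCompactSupport f) :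
    ∃ B : ℝ≥0, ∀ x, ‖f x‖₊ ≤ B := by
  obtain ⟨C, hC⟩ := hc.exists_bound_of_continuous hf
  exact ⟨C.toNNReal, fun x => NNReal.le_toNNReal_of_coe_le (hC x)⟩

lemma locallyIntegrable_indicator {F : Type*} [NormedAddCommGroup F] (hΩ : MeasurableSet Ω)
    (f : Lp F 2 (volume.restrict Ω)) : LocallyIntegrable (Ω.indicator f) :=
  ((memLp_indicator_iff_restrict hΩ).2 (Lp.memLp f)).locallyIntegrable (by norm_num)

lemma exists_eLpNorm_mollify_indicator_sub_le {F : Type*} [NormedAddCommGroup F] [NormedSpace ℝ F]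
    [CompleteSpace F] [MeasurableSpace F] [BorelSpace F] [SecondCountableTopology F]
    (hΩ : MeasurableSet Ω) (f : Lp F 2 (volume.restrict Ω)) {ε : ℝ≥0∞} (hε : 0 < ε) :
    ∃ δ > 0, ∀ ρ, IsMollifier ρ → tsupport ρ ⊆ ball 0 δ →
      eLpNorm (mollify ρ (Ω.indicator f) - ⇑f) 2 (volume.restrict Ω) ≤ ε := by
  obtain ⟨δ, hδ, h⟩ := exists_eLpNorm_mollify_sub_le
    ((Lp.stronglyMeasurable f).measurable.indicator hΩ)
    ((memLp_indicator_iff_restrict hΩ).2 (Lp.memLp f)) hε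
  refine ⟨δ, hδ, fun ρ hρ hρδ => ?_⟩
  rw [← eLpNorm_congr_ae (Filter.EventuallyEq.rfl.sub (indicator_ae_eq_restrict hΩ))]
  exact (eLpNorm_restrict_le _ _ _ _).trans (h ρ hρ hρδ)

lemma HasSmallShiftsInto.exists_isMollifier_eLpNorm_sub_le {A : Set (EuclideanSpace ℝ (Fin d))}
    (h : HasSmallShiftsInto A Ω) (hΩ : MeasurableSet Ω) (u : L2 Ω) (G : L2vec Ω) {ε : ℝ≥0∞}
    (hε : 0 < ε) :
    ∃ ρ, IsMollifier ρ ∧ (∀ x ∈ A, ∀ t ∈ tsupport ρ, x - t ∈ Ω) ∧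
      eLpNorm (mollify ρ (Ω.indicator u) - ⇑u) 2 (volume.restrict Ω) ≤ ε ∧
      eLpNorm (mollify ρ (Ω.indicator G) - ⇑G) 2 (volume.restrict Ω) ≤ ε := by
  obtain ⟨δ₁, hδ₁, hu⟩ := exists_eLpNorm_mollify_indicator_sub_le hΩ u hε
  obtain ⟨δ₂, hδ₂, hG⟩ := exists_eLpNorm_mollify_indicator_sub_le hΩ G hε
  obtain ⟨ρ, hρ, hρδ, hρΩ⟩ := h.exists_isMollifier (lt_min hδ₁ hδ₂)
  exact ⟨ρ, hρ, hρΩ, hu ρ hρ (hρδ.trans (ball_subset_ball (min_le_left _ _))),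
    hG ρ hρ (hρδ.trans (ball_subset_ball (min_le_right _ _)))⟩

lemma eLpNorm_smul_le_of_nnnorm_le {X 𝕜 F : Type*} [MeasurableSpace X] {μ : Measure X}
    [NormedField 𝕜] [NormedAddCommGroup F] [NormedSpace 𝕜 F] {χ : X → 𝕜} {B : ℝ≥0}
    (hB : ∀ x, ‖χ x‖₊ ≤ B) (f : X → F) (p : ℝ≥0∞) :
    eLpNorm (fun x => χ x • f x) p μ ≤ B * eLpNorm f p μ :=
  eLpNorm_le_nnreal_smul_eLpNorm_of_ae_le_mul (.of_forall fun x => by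
    rw [nnnorm_smul]; gcongr; exact hB x) p

lemma eLpNorm_smul_le_of_nnnorm_le' {X 𝕜 F : Type*} [MeasurableSpace X] {μ : Measure X}
    [NormedField 𝕜] [NormedAddCommGroup F] [NormedSpace 𝕜 F] {f : X → F} {B : ℝ≥0}
    (hB : ∀ x, ‖f x‖₊ ≤ B) (χ : X → 𝕜) (p : ℝ≥0∞) :
    eLpNorm (fun x => χ x • f x) p μ ≤ B * eLpNorm χ p μ :=
  eLpNorm_le_nnreal_smul_eLpNorm_of_ae_le_mul (.of_forall fun x => by
    rw [nnnorm_smul, mul_comm]; gcongr; exact hB x) p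

lemma IsWeakGradient.gradC_mul_mollify_sub_ae_eq (hΩ : MeasurableSet Ω) {u : L2 Ω} {G : L2vec Ω}
    (h : IsWeakGradient Ω u G) {χ : EuclideanSpace ℝ (Fin d) → ℂ} (hχ : ContDiff ℝ ∞ χ)
    {ρ : EuclideanSpace ℝ (Fin d) → ℝ} (hρ : IsMollifier ρ)
    (hshift : ∀ x ∈ Ω ∩ tsupport χ, ∀ t ∈ tsupport ρ, x - t ∈ Ω) :
    (gradC fun x => χ x * mollify ρ (Ω.indicator u) x) - (fun x => u x • gradC χ x + χ x • G x)
      =ᵐ[volume.restrict Ω] (fun x => (mollify ρ (Ω.indicator u) - ⇑u) x • gradC χ x)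
        + fun x => χ x • (mollify ρ (Ω.indicator G) - ⇑G) x := by
  have hu := locallyIntegrable_indicator hΩ u
  have hG := locallyIntegrable_indicator hΩ G
  filter_upwards [ae_restrict_mem hΩ] with x hx
  simp only [Pi.sub_apply, Pi.add_apply]
  rw [gradC_mul hχ (hρ.contDiff_mollify hu)]
  by_cases hxχ : x ∈ tsupport χ
  · rw [h.gradC_mollify hΩ hρ hu hG (hshift x ⟨hx, hxχ⟩)]
    module
  · rw [image_eq_zero_of_notMem_tsupport hxχ]
    module

lemma IsWeakGradient.hasSmoothApprox_mul (hΩ : MeasurableSet Ω) {u : L2 Ω} {G : L2vec Ω}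
    (h : IsWeakGradient Ω u G) {χ : EuclideanSpace ℝ (Fin d) → ℂ} (hχ : ContDiff ℝ ∞ χ)
    (hχc : HasCompactSupport χ) (hshift : HasSmallShiftsInto (Ω ∩ tsupport χ) Ω) :
    HasSmoothApprox Ω (fun x => χ x * u x) (fun x => u x • gradC χ x + χ x • G x) := by
  have hum : AEStronglyMeasurable u (volume.restrict Ω) := Lp.aestronglyMeasurable u
  have hGm : AEStronglyMeasurable G (volume.restrict Ω) := Lp.aestronglyMeasurable G
  have hχm := hχ.continuous.aestronglyMeasurable (μ := volume.restrict Ω)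
  have hχ'm := (contDiff_gradC hχ).continuous.aestronglyMeasurable (μ := volume.restrict Ω)
  obtain ⟨B₁, hB₁⟩ := exists_norm_le_of_hasCompactSupport hχ.continuous hχc
  obtain ⟨B₂, hB₂⟩ := exists_norm_le_of_hasCompactSupport (contDiff_gradC hχ).continuous
    (hasCompactSupport_gradC hχc)
  refine ⟨hχm.mul hum, (hum.smul hχ'm).add (hχm.smul hGm), fun ε hε => ?_⟩
  obtain ⟨η, hη, hηε⟩ := ENNReal.exists_nnreal_pos_mul_lt
    (ENNReal.coe_ne_top (r := B₂ + B₁)) hε.ne'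
  rw [mul_comm, ENNReal.coe_add, add_mul] at hηε
  obtain ⟨ρ, hρ, hρΩ, hu, hG⟩ :=
    hshift.exists_isMollifier_eLpNorm_sub_le hΩ u G (ENNReal.coe_pos.2 hη)
  have hul := locallyIntegrable_indicator hΩ u
  have hGl := locallyIntegrable_indicator hΩ G
  set m := mollify ρ (Ω.indicator u)
  set M := mollify ρ (Ω.indicator G)
  have hm : ContDiff ℝ ∞ m := hρ.contDiff_mollify hul
  have hMm : AEStronglyMeasurable M (volume.restrict Ω) :=
    (hρ.contDiff_mollify hGl).continuous.aestronglyMeasurable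
  refine ⟨fun x => χ x * m x, hχ.mul hm, hχc.mul_right, ?_, ?_⟩
  · rw [show (fun x => χ x * m x) - (fun x => χ x * u x) = fun x => χ x • (m - ⇑u) x by
      ext x
      simp [mul_sub]]
    exact (eLpNorm_smul_le_of_nnnorm_le hB₁ _ _).trans
      ((mul_le_mul_right hu _).trans (le_add_self.trans hηε.le))
  · rw [eLpNorm_congr_ae (h.gradC_mul_mollify_sub_ae_eq hΩ hχ hρ hρΩ)]
    refine (eLpNorm_add_le ((hm.continuous.aestronglyMeasurable.sub hum).smul hχ'm)
      (hχm.smul (hMm.sub hGm)) one_le_two).trans ((add_le_add ?_ ?_).trans hηε.le)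
    · exact (eLpNorm_smul_le_of_nnnorm_le' hB₂ (m - ⇑u) 2).trans (mul_le_mul_right hu _)
    · exact (eLpNorm_smul_le_of_nnnorm_le hB₁ (M - ⇑G) 2).trans (mul_le_mul_right hG _)

end Density

section Global

open scoped ENNReal NNReal Manifold
open Set Metric

lemma exists_smooth_partition {E : Type*} [NormedAddCommGroup E] [NormedSpace ℝ E]
    [FiniteDimensional ℝ E] {K : Set E} (hK : IsCompact K) {r : K → ℝ} (hr : ∀ p, 0 < r p) :
    ∃ (t : Finset K) (χ : t → E → ℂ), (∀ i, ContDiff ℝ ∞ (χ i)) ∧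
      (∀ i, tsupport (χ i) ⊆ ball ((i : K) : E) (r i)) ∧ ∀ x ∈ K, ∑ i, χ i x = 1 := by
  obtain ⟨t, ht⟩ := hK.elim_finite_subcover (fun p : K => ball (p : E) (r p))
    (fun _ => isOpen_ball) fun x hx => mem_iUnion.2 ⟨⟨x, hx⟩, mem_ball_self (hr _)⟩
  obtain ⟨f, hf⟩ := SmoothPartitionOfUnity.exists_isSubordinate 𝓘(ℝ, E) hK.isClosed
    (fun p : t => ball ((p : K) : E) (r p)) (fun _ => isOpen_ball)
    (fun x hx => by simpa [iUnion_subtype] using ht hx)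
  refine ⟨t, fun i x => (f i x : ℂ), fun i => ?_, fun i => ?_, fun x hx => ?_⟩
  · exact Complex.ofRealCLM.contDiff.comp (f i).contMDiff.contDiff
  · exact (closure_mono fun y hy => by simpa using hy).trans (hf i)
  · rw [← Complex.ofReal_sum, ← finsum_eq_sum_of_fintype, f.sum_eq_one hx, Complex.ofReal_one]

variable {d : ℕ} {Ω : Set (EuclideanSpace ℝ (Fin d))}

lemma sum_gradC_eq_zero (hΩ : IsOpen Ω) {ι : Type*} [Fintype ι]
    {χ : ι → EuclideanSpace ℝ (Fin d) → ℂ} (hχ : ∀ i, ContDiff ℝ ∞ (χ i))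
    (hsum : ∀ x ∈ Ω, ∑ i, χ i x = 1) {x : EuclideanSpace ℝ (Fin d)} (hx : x ∈ Ω) :
    ∑ i, gradC (χ i) x = 0 := by
  have hloc : (fun x => ∑ i, χ i x) =ᶠ[𝓝 x] fun _ => (1 : ℂ) := by
    filter_upwards [hΩ.mem_nhds hx] with y hy using hsum y hy
  rw [← gradC_sum _ hχ]
  ext k
  simp [gradC, hloc.fderiv_eq]

lemma IsWeakGradient.hasSmoothApprox (hΩ : IsBoundedLipschitzDomain Ω) {u : L2 Ω} {G : L2vec Ω}
    (h : IsWeakGradient Ω u G) : HasSmoothApprox Ω u G := by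
  choose r hr hshift using fun p : closure Ω => hΩ.exists_hasSmallShiftsInto p.2
  obtain ⟨t, χ, hχ, hχr, hsum⟩ := exists_smooth_partition hΩ.isBounded.isCompact_closure hr
  replace hsum : ∀ x ∈ Ω, ∑ i, χ i x = 1 := fun x hx => hsum x (subset_closure hx)
  have hloc (i : t) := h.hasSmoothApprox_mul hΩ.isOpen.measurableSet (hχ i)
    (isCompact_of_isClosed_isBounded (isClosed_tsupport _) (isBounded_ball.subset (hχr i)))
    ((hshift i).mono (inter_subset_inter_right _ (hχr i)))
  refine (HasSmoothApprox.sum Finset.univ hloc).congr_ae ?_ ?_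
  · filter_upwards [ae_restrict_mem hΩ.isOpen.measurableSet] with x hx
    simp only [Finset.sum_apply]
    rw [← Finset.sum_mul, hsum x hx, one_mul]
  · filter_upwards [ae_restrict_mem hΩ.isOpen.measurableSet] with x hx
    simp only [Finset.sum_apply, Finset.sum_add_distrib]
    rw [← Finset.smul_sum, ← Finset.sum_smul, hsum x hx, sum_gradC_eq_zero hΩ.isOpen hχ hsum hx,
      smul_zero, one_smul, zero_add]

lemma norm_H1_sq (u : H1 Ω) : ‖u‖ ^ 2 = ‖val Ω u‖ ^ 2 + ‖grad Ω u‖ ^ 2 :=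
  WithLp.prod_norm_sq_eq_of_L2 _

lemma enorm_H1_sq (u : H1 Ω) : ‖u‖ₑ ^ 2 = ‖val Ω u‖ₑ ^ 2 + ‖grad Ω u‖ₑ ^ 2 := by
  simp only [← ofReal_norm, ← ENNReal.ofReal_pow (norm_nonneg _)]
  rw [norm_H1_sq, ENNReal.ofReal_add (by positivity) (by positivity)]

lemma enorm_H1_le (u : H1 Ω) : ‖u‖ₑ ≤ ‖val Ω u‖ₑ + ‖grad Ω u‖ₑ := by
  rw [← ENNReal.pow_le_pow_left_iff two_ne_zero, enorm_H1_sq, add_sq]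
  gcongr
  exact le_self_add

lemma enorm_val_restrictInterior_sq (φ : smoothFunctions Ω) :
    ‖val Ω (restrictInterior Ω φ)‖ₑ ^ 2
      = ∫⁻ x in Ω, ‖(φ : EuclideanSpace ℝ (Fin d) → ℂ) x‖ₑ ^ 2 :=
  enorm_toLp_sq (smoothFunctions_memLp Ω φ)

lemma enorm_grad_restrictInterior_sq (φ : smoothFunctions Ω) :
    ‖grad Ω (restrictInterior Ω φ)‖ₑ ^ 2
      = ∫⁻ x in Ω, ‖gradC (φ : EuclideanSpace ℝ (Fin d) → ℂ) x‖ₑ ^ 2 :=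
  enorm_toLp_sq (smoothFunctions_memLp_grad Ω φ)

lemma enorm_restrictBoundary_sq (φ : smoothFunctions Ω) :
    ‖restrictBoundary Ω φ‖ₑ ^ 2
      = ∫⁻ x, ‖(φ : EuclideanSpace ℝ (Fin d) → ℂ) x‖ₑ ^ 2 ∂surfaceMeasure Ω :=
  enorm_toLp_sq φ.2.2.2

lemma val_restrictInterior_coeFn (φ : smoothFunctions Ω) :
    val Ω (restrictInterior Ω φ) =ᵐ[volume.restrict Ω] (φ : EuclideanSpace ℝ (Fin d) → ℂ) :=
  (smoothFunctions_memLp Ω φ).coeFn_toLp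

lemma grad_restrictInterior_coeFn (φ : smoothFunctions Ω) :
    grad Ω (restrictInterior Ω φ) =ᵐ[volume.restrict Ω]
      gradC (φ : EuclideanSpace ℝ (Fin d) → ℂ) :=
  (smoothFunctions_memLp_grad Ω φ).coeFn_toLp

lemma enorm_val_restrictInterior_sub (φ : smoothFunctions Ω) (u : H1 Ω) :
    ‖val Ω (restrictInterior Ω φ - u)‖ₑ
      = eLpNorm ((φ : EuclideanSpace ℝ (Fin d) → ℂ) - ⇑(val Ω u)) 2 (volume.restrict Ω) := by
  rw [map_sub, Lp.enorm_def]
  exact eLpNorm_congr_ae ((Lp.coeFn_sub _ _).trans ((val_restrictInterior_coeFn φ).sub .rfl))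

lemma enorm_grad_restrictInterior_sub (φ : smoothFunctions Ω) (u : H1 Ω) :
    ‖grad Ω (restrictInterior Ω φ - u)‖ₑ
      = eLpNorm (gradC (φ : EuclideanSpace ℝ (Fin d) → ℂ) - ⇑(grad Ω u)) 2
        (volume.restrict Ω) := by
  rw [map_sub, Lp.enorm_def]
  exact eLpNorm_congr_ae ((Lp.coeFn_sub _ _).trans ((grad_restrictInterior_coeFn φ).sub .rfl))

namespace IsBoundedLipschitzDomain

lemma memLp_boundary (hΩ : IsBoundedLipschitzDomain Ω)
    {φ : EuclideanSpace ℝ (Fin d) → ℂ} (hφ : Continuous φ) (hc : HasCompactSupport φ) :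
    MemLp φ 2 (surfaceMeasure Ω) := by
  have := hΩ.isFiniteMeasure_surfaceMeasure
  exact hφ.memLp_of_hasCompactSupport hc

lemma denseRange_restrictInterior (hΩ : IsBoundedLipschitzDomain Ω) :
    DenseRange (restrictInterior Ω) := by
  intro u
  rw [EMetric.mem_closure_iff]
  intro ε hε
  obtain ⟨η, hη, hηε⟩ := ENNReal.exists_nnreal_pos_mul_lt (ENNReal.ofNat_ne_top (n := 2)) hε.ne'
  obtain ⟨φ, hφ, hφc, hval, hgrad⟩ :=
    (IsWeakGradient.hasSmoothApprox hΩ u.2).exists_le η (ENNReal.coe_pos.2 hη)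
  set ψ : smoothFunctions Ω := ⟨φ, hφ, hφc, hΩ.memLp_boundary hφ.continuous hφc⟩
  refine ⟨_, ⟨ψ, rfl⟩, ?_⟩
  calc edist u (restrictInterior Ω ψ) = ‖restrictInterior Ω ψ - u‖ₑ := by
        rw [edist_comm, edist_eq_enorm_sub]
    _ ≤ ‖val Ω (restrictInterior Ω ψ - u)‖ₑ + ‖grad Ω (restrictInterior Ω ψ - u)‖ₑ :=
        enorm_H1_le _
    _ ≤ η + η := by
        rw [enorm_val_restrictInterior_sub, enorm_grad_restrictInterior_sub]
        exact add_le_add hval hgrad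
    _ < ε := by rwa [← mul_two]

lemma restrictBoundary_le (hΩ : IsBoundedLipschitzDomain Ω) :
    ∃ (C τ₀ : ℝ), 0 ≤ C ∧ 0 < τ₀ ∧ ∀ τ, 0 < τ → τ ≤ τ₀ → ∀ φ : smoothFunctions Ω,
      ‖restrictBoundary Ω φ‖ ^ 2 ≤ C * (τ⁻¹ * ‖val Ω (restrictInterior Ω φ)‖ ^ 2
        + τ * ‖grad Ω (restrictInterior Ω φ)‖ ^ 2) := by
  obtain ⟨C, τ₀, hτ₀, h⟩ := hΩ.trace_estimate
  refine ⟨C, τ₀, C.2, hτ₀, fun τ hτ hτ' φ => ?_⟩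
  have hreal : τ * ‖restrictBoundary Ω φ‖ ^ 2 ≤ C * (‖val Ω (restrictInterior Ω φ)‖ ^ 2
      + τ ^ 2 * ‖grad Ω (restrictInterior Ω φ)‖ ^ 2) := by
    have henorm := h τ hτ hτ' φ φ.2.1
    rw [← enorm_restrictBoundary_sq, ← enorm_val_restrictInterior_sq,
      ← enorm_grad_restrictInterior_sq] at henorm
    have := ENNReal.toReal_mono (by finiteness) henorm
    rwa [ENNReal.toReal_mul, ENNReal.toReal_mul, ENNReal.toReal_add (by finiteness)
      (by finiteness), ENNReal.toReal_mul, ENNReal.toReal_pow, ENNReal.toReal_pow,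
      ENNReal.toReal_pow, ENNReal.toReal_pow, toReal_enorm, toReal_enorm, toReal_enorm,
      ENNReal.toReal_ofReal hτ.le, ENNReal.coe_toReal] at this
  calc ‖restrictBoundary Ω φ‖ ^ 2 = τ⁻¹ * (τ * ‖restrictBoundary Ω φ‖ ^ 2) := by
        rw [inv_mul_cancel_left₀ hτ.ne']
    _ ≤ τ⁻¹ * (C * (‖val Ω (restrictInterior Ω φ)‖ ^ 2
        + τ ^ 2 * ‖grad Ω (restrictInterior Ω φ)‖ ^ 2)) := by gcongr
    _ = _ := by field_simp

lemma exists_restrictBoundary_le (hΩ : IsBoundedLipschitzDomain Ω) :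
    ∃ C, ∀ φ, ‖restrictBoundary Ω φ‖ ≤ C * ‖restrictInterior Ω φ‖ := by
  obtain ⟨C, τ, hC, hτ, h⟩ := hΩ.restrictBoundary_le
  refine ⟨√(C * (τ⁻¹ + τ)), fun φ => ?_⟩
  refine le_of_sq_le_sq ((h τ hτ le_rfl φ).trans ?_) (by positivity)
  rw [mul_pow, Real.sq_sqrt (by positivity), norm_H1_sq, mul_assoc, add_mul]
  gcongr
  · exact le_add_of_nonneg_right (by positivity)
  · exact le_add_of_nonneg_left (by positivity)

lemma trace_restrictInterior (hΩ : IsBoundedLipschitzDomain Ω) (φ : smoothFunctions Ω) :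
    trace Ω (restrictInterior Ω φ) = restrictBoundary Ω φ :=
  LinearMap.extendOfNorm_eq hΩ.denseRange_restrictInterior hΩ.exists_restrictBoundary_le φ

end IsBoundedLipschitzDomain

end Global

section Sobolev

open scoped ENNReal NNReal ComplexConjugate
open Set Metric

variable {d : ℕ} {Ω : Set (EuclideanSpace ℝ (Fin d))}

lemma continuous_integral_mul {f : EuclideanSpace ℝ (Fin d) → ℂ}
    (hf : MemLp f 2 (volume.restrict Ω)) :
    Continuous fun u : L2 Ω => ∫ x in Ω, u x * f x := by
  have hinner (u : L2 Ω) : ∫ x in Ω, u x * f x = ⟪hf.star.toLp (star f), u⟫_ℂ := by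
    rw [L2.inner_def]
    refine integral_congr_ae ?_
    filter_upwards [hf.star.coeFn_toLp] with x hx
    rw [hx]
    simp [RCLike.inner_apply]
  simp only [hinner]
  fun_prop

lemma continuous_integral_comp_mul {f : EuclideanSpace ℝ (Fin d) → ℂ}
    (hf : MemLp f 2 (volume.restrict Ω)) (i : Fin d) :
    Continuous fun G : L2vec Ω => ∫ x in Ω, G x i * f x := by
  have hcoord (G : L2vec Ω) : ∫ x in Ω, G x i * f x
      = ∫ x in Ω, (EuclideanSpace.proj (𝕜 := ℂ) i).compLp G x * f x :=
    integral_congr_ae (by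
      filter_upwards [(EuclideanSpace.proj (𝕜 := ℂ) i).coeFn_compLp G] with x hx
      rw [hx, PiLp.proj_apply])
  simp only [hcoord]
  exact (continuous_integral_mul hf).comp
    ((EuclideanSpace.proj (𝕜 := ℂ) i).compLpL 2 (volume.restrict Ω)).continuous

lemma isClosed_H1 : IsClosed (H1 Ω : Set (WithLp 2 (L2 Ω × L2vec Ω))) := by
  have hH1 : (H1 Ω : Set (WithLp 2 (L2 Ω × L2vec Ω))) =
      ⋂ (ψ : EuclideanSpace ℝ (Fin d) → ℂ) (_ : IsTestFunction Ω ψ) (i : Fin d),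
        {p : WithLp 2 (L2 Ω × L2vec Ω) |
          ∫ x in Ω, p.fst x * gradC ψ x i = -∫ x in Ω, p.snd x i * ψ x} := by
    ext p
    simp only [mem_iInter]
    rfl
  rw [hH1]
  refine isClosed_iInter fun ψ => isClosed_iInter fun hψ => isClosed_iInter fun i => ?_
  exact isClosed_eq
    ((continuous_integral_mul ((memLp_gradC Ω hψ.smooth hψ.compact).eval_piLp i)).comp
      (WithLp.prod_continuous_ofLp 2 _ _).fst)
    ((continuous_integral_comp_mul hψ.memLp i).comp (WithLp.prod_continuous_ofLp 2 _ _).snd).neg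

instance : CompleteSpace (H1 Ω) := isClosed_H1.completeSpace_coe

lemma norm_val_le (u : H1 Ω) : ‖val Ω u‖ ≤ ‖u‖ :=
  le_of_sq_le_sq (by rw [norm_H1_sq u]; exact le_add_of_nonneg_right (sq_nonneg _)) (norm_nonneg _)

lemma norm_grad_le (u : H1 Ω) : ‖grad Ω u‖ ≤ ‖u‖ :=
  le_of_sq_le_sq (by rw [norm_H1_sq u]; exact le_add_of_nonneg_left (sq_nonneg _)) (norm_nonneg _)

variable (Ω) in
/-- The embedding `H¹(Ω) → L²(Ω)` as a continuous linear map. -/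
def valL : H1 Ω →L[ℂ] L2 Ω :=
  (val Ω).mkContinuous 1 fun u => by simpa using norm_val_le u

variable (Ω) in
/-- The weak gradient `H¹(Ω) → L²(Ω; ℂᵈ)` as a continuous linear map. -/
def gradL : H1 Ω →L[ℂ] L2vec Ω :=
  (grad Ω).mkContinuous 1 fun u => by simpa using norm_grad_le u

lemma valL_apply (u : H1 Ω) : valL Ω u = val Ω u := rfl

lemma gradL_apply (u : H1 Ω) : gradL Ω u = grad Ω u := rfl

lemma inner_H1 (u v : H1 Ω) :
    ⟪v, u⟫_ℂ = pullInner (grad Ω) u v + ⟪valL Ω v, valL Ω u⟫_ℂ := by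
  rw [pullInner_apply, add_comm]
  exact WithLp.prod_inner_apply _ _

lemma ae_eq_zero_of_forall_integral_mul_eq_zero (hΩ : IsOpen Ω)
    {f : EuclideanSpace ℝ (Fin d) → ℂ} (hf : LocallyIntegrableOn f Ω)
    (h : ∀ ψ, IsTestFunction Ω ψ → ∫ x in Ω, f x * ψ x = 0) :
    f =ᵐ[volume.restrict Ω] 0 := by
  rw [Filter.EventuallyEq, ae_restrict_iff' hΩ.measurableSet]
  refine hΩ.ae_eq_zero_of_integral_contDiff_smul_eq_zero hf fun g hg hgc hgs => ?_
  have hψ : IsTestFunction Ω fun x => (g x : ℂ) :=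
    ⟨Complex.ofRealCLM.contDiff.comp hg, hgc.comp_left Complex.ofReal_zero,
      (closure_mono fun x hx => by simpa using hx).trans hgs⟩
  rw [← h _ hψ, ← setIntegral_eq_integral_of_forall_compl_eq_zero (s := Ω)]
  · simp only [Complex.real_smul, mul_comm]
  · intro x hx
    rw [image_eq_zero_of_notMem_tsupport fun hx' => hx (hgs hx'), zero_smul]

lemma injective_val (hΩ : IsOpen Ω) : Function.Injective (val Ω) := by
  refine (injective_iff_map_eq_zero _).2 fun u hu => ?_
  have hval : val Ω u =ᵐ[volume.restrict Ω] 0 := by rw [hu]; exact Lp.coeFn_zero _ _ _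
  have hcoord (i : Fin d) : (fun x => grad Ω u x i) =ᵐ[volume.restrict Ω] 0 := by
    refine ae_eq_zero_of_forall_integral_mul_eq_zero hΩ
      (locallyIntegrableOn_of_locallyIntegrable_restrict
        (((Lp.memLp (grad Ω u)).eval_piLp i).locallyIntegrable (by norm_num))) fun ψ hψ => ?_
    have hweak : ∫ x in Ω, val Ω u x * gradC ψ x i = -∫ x in Ω, grad Ω u x i * ψ x := u.2 ψ hψ i
    rw [← neg_eq_zero, ← hweak]
    refine integral_eq_zero_of_ae ?_
    filter_upwards [hval] with x hx
    simp [hx]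
  have hgrad : grad Ω u = 0 := by
    refine (Lp.eq_zero_iff_ae_eq_zero).2 ?_
    filter_upwards [ae_all_iff.2 hcoord] with x hx
    ext i
    exact hx i
  simpa [hu, hgrad] using norm_H1_sq u

variable {ψ : EuclideanSpace ℝ (Fin d) → ℂ}

lemma IsTestFunction.conj (h : IsTestFunction Ω ψ) : IsTestFunction Ω (fun x => conj (ψ x)) where
  smooth := Complex.conjCLE.contDiff.comp h.smooth
  compact := h.compact.comp_left (map_zero _)
  support := (closure_mono fun x hx => by simpa using hx).trans h.support

namespace IsTestFunction

lemma eq_zero_of_mem_frontier (h : IsTestFunction Ω ψ) (hΩ : IsOpen Ω)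
    {x : EuclideanSpace ℝ (Fin d)} (hx : x ∈ frontier Ω) : ψ x = 0 :=
  image_eq_zero_of_notMem_tsupport fun hx' => (hΩ.frontier_eq ▸ hx).2 (h.support hx')

lemma ae_eq_zero (h : IsTestFunction Ω ψ) (hΩ : IsOpen Ω) : ψ =ᵐ[surfaceMeasure Ω] 0 := by
  filter_upwards [ae_restrict_mem isClosed_frontier.measurableSet] with x hx
  exact h.eq_zero_of_mem_frontier hΩ hx

lemma mem_smoothFunctions (h : IsTestFunction Ω ψ) (hΩ : IsOpen Ω) : ψ ∈ smoothFunctions Ω :=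
  ⟨h.smooth, h.compact, (memLp_congr_ae (h.ae_eq_zero hΩ)).2 MemLp.zero⟩

end IsTestFunction

lemma restrictInterior_mem_H10 (φ : smoothFunctions Ω)
    (h : IsTestFunction Ω (φ : EuclideanSpace ℝ (Fin d) → ℂ)) :
    restrictInterior Ω φ ∈ H10 Ω :=
  Submodule.le_topologicalClosure _ (Submodule.subset_span ⟨_, h, val_restrictInterior_coeFn φ⟩)

lemma inner_val_restrictInterior (φ : smoothFunctions Ω) (f : L2 Ω) :
    ⟪val Ω (restrictInterior Ω φ), f⟫_ℂ
      = ∫ x in Ω, f x * conj ((φ : EuclideanSpace ℝ (Fin d) → ℂ) x) := by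
  rw [L2.inner_def]
  refine integral_congr_ae ?_
  filter_upwards [val_restrictInterior_coeFn φ] with x hx
  rw [hx, RCLike.inner_apply]

lemma denseRange_val_H10 (hΩ : IsOpen Ω) : DenseRange (valL Ω ∘L (H10 Ω).subtypeL) := by
  suffices (LinearMap.range (val Ω ∘ₗ (H10 Ω).subtype)).topologicalClosure = ⊤ from
    Submodule.dense_iff_topologicalClosure_eq_top.2 this
  rw [Submodule.topologicalClosure_eq_top_iff, eq_bot_iff]
  intro f hf
  refine (Lp.eq_zero_iff_ae_eq_zero).2 (ae_eq_zero_of_forall_integral_mul_eq_zero hΩ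
    (locallyIntegrableOn_of_locallyIntegrable_restrict
      ((Lp.memLp f).locallyIntegrable (by norm_num))) fun ψ hψ => ?_)
  let φ : smoothFunctions Ω := ⟨_, hψ.conj.mem_smoothFunctions hΩ⟩
  have hφ := (Submodule.mem_orthogonal _ f).1 hf _ ⟨⟨_, restrictInterior_mem_H10 φ hψ.conj⟩, rfl⟩
  rw [LinearMap.comp_apply, Submodule.subtype_apply, inner_val_restrictInterior] at hφ
  simpa [φ] using hφ

namespace IsBoundedLipschitzDomain

lemma denseRange_trace (hΩ : IsBoundedLipschitzDomain Ω) : DenseRange (trace Ω) := by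
  have := hΩ.isFiniteMeasure_surfaceMeasure
  refine (Lp.dense_hasCompactSupport_contDiff (F := ℂ) (μ := surfaceMeasure Ω) (p := 2)
    (by norm_num)).mono ?_
  rintro f ⟨g, hfg, hgc, hg⟩
  have hgL := hΩ.memLp_boundary hg.continuous hgc
  refine ⟨restrictInterior Ω ⟨g, hg, hgc, hgL⟩, ?_⟩
  rw [hΩ.trace_restrictInterior]
  exact Lp.ext (hgL.coeFn_toLp.trans hfg.symm)

lemma trace_eq_zero_of_mem_H10 (hΩ : IsBoundedLipschitzDomain Ω) {u : H1 Ω} (hu : u ∈ H10 Ω) :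
    trace Ω u = 0 := by
  suffices H10 Ω ≤ LinearMap.ker (trace Ω : H1 Ω →ₗ[ℂ] L2bd Ω) from this hu
  refine Submodule.topologicalClosure_minimal _ (Submodule.span_le.2 ?_)
    (isClosed_singleton.preimage (trace Ω).continuous)
  rintro u ⟨ψ, hψ, hu⟩
  let φ : smoothFunctions Ω := ⟨ψ, hψ.mem_smoothFunctions hΩ.isOpen⟩
  have hφ : u = restrictInterior Ω φ :=
    injective_val hΩ.isOpen
      (Lp.ext (Filter.EventuallyEq.trans hu (val_restrictInterior_coeFn φ).symm))
  change trace Ω u = 0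
  rw [hφ, hΩ.trace_restrictInterior]
  exact (Lp.eq_zero_iff_ae_eq_zero).2 ((MemLp.coeFn_toLp φ.2.2.2).trans (hψ.ae_eq_zero hΩ.isOpen))

lemma trace_sq_le (hΩ : IsBoundedLipschitzDomain Ω) {ε : ℝ} (hε : 0 < ε) :
    ∃ C : ℝ, 0 ≤ C ∧ ∀ u, ‖trace Ω u‖ ^ 2 ≤ ε ^ 2 * ‖u‖ ^ 2 + C ^ 2 * ‖valL Ω u‖ ^ 2 := by
  obtain ⟨C, τ₀, hC, hτ₀, h⟩ := hΩ.restrictBoundary_le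
  set τ := min τ₀ (ε ^ 2 / (C + 1))
  have hτ : 0 < τ := lt_min hτ₀ (by positivity)
  have hτε : C * τ ≤ ε ^ 2 := by
    calc C * τ ≤ (C + 1) * (ε ^ 2 / (C + 1)) := by
          gcongr
          · linarith
          · exact min_le_right _ _
      _ = ε ^ 2 := by field_simp
  refine ⟨√(C * τ⁻¹), by positivity, fun u => ?_⟩
  rw [Real.sq_sqrt (by positivity)]
  refine hΩ.denseRange_restrictInterior.induction_on
    (p := fun u => ‖trace Ω u‖ ^ 2 ≤ ε ^ 2 * ‖u‖ ^ 2 + C * τ⁻¹ * ‖valL Ω u‖ ^ 2) u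
    (isClosed_le (by fun_prop) (by fun_prop)) fun φ => ?_
  rw [hΩ.trace_restrictInterior, valL_apply]
  calc ‖restrictBoundary Ω φ‖ ^ 2 ≤ C * (τ⁻¹ * ‖val Ω (restrictInterior Ω φ)‖ ^ 2
        + τ * ‖grad Ω (restrictInterior Ω φ)‖ ^ 2) := h τ hτ (min_le_left _ _) φ
    _ = C * τ * ‖grad Ω (restrictInterior Ω φ)‖ ^ 2
        + C * τ⁻¹ * ‖val Ω (restrictInterior Ω φ)‖ ^ 2 := by ring
    _ ≤ _ := by
        gcongr
        exact norm_grad_le _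

end IsBoundedLipschitzDomain

end Sobolev

section Cutoff

open scoped ENNReal NNReal
open Set Metric

section Mollifiers

variable {E : Type*} [NormedAddCommGroup E] [InnerProductSpace ℝ E] [FiniteDimensional ℝ E]
  [MeasurableSpace E] [BorelSpace E] {F : Type*} [NormedAddCommGroup F] [NormedSpace ℝ F]
  {ρ : E → ℝ}

namespace IsMollifier

lemma norm_integral_smul_le (h : IsMollifier ρ) {g : E → F} {B : ℝ} (hB : ∀ t, ‖g t‖ ≤ B) :
    ‖∫ t, ρ t • g t‖ ≤ B := by
  refine (norm_integral_le_of_norm_le (h.integrable.smul_const B) (.of_forall fun t => ?_)).trans_eq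
    (by rw [integral_smul_const, h.integral_eq, one_smul])
  rw [norm_smul, Real.norm_of_nonneg (h.nonneg t), smul_eq_mul]
  exact mul_le_mul_of_nonneg_left (hB t) (h.nonneg t)

lemma lipschitzWith_mollify (h : IsMollifier ρ) {f : E → F} {K : ℝ≥0} (hf : LipschitzWith K f) :
    LipschitzWith K (mollify ρ f) := by
  refine .of_dist_le_mul fun x y => ?_
  have hsub : mollify ρ f x - mollify ρ f y = ∫ t, ρ t • (f (x - t) - f (y - t)) := by
    simp only [smul_sub]
    exact (integral_sub (h.integrable_mollify hf.continuous.locallyIntegrable x)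
      (h.integrable_mollify hf.continuous.locallyIntegrable y)).symm
  rw [dist_eq_norm, hsub]
  refine h.norm_integral_smul_le fun t => ?_
  simpa only [dist_eq_norm, sub_sub_sub_cancel_right] using hf.dist_le_mul (x - t) (y - t)

lemma mollify_eq_of_forall [CompleteSpace F] (h : IsMollifier ρ) {f : E → F} {x : E} {c : F}
    (hc : ∀ t ∈ tsupport ρ, f (x - t) = c) : mollify ρ f x = c := by
  have hρc (t : E) : ρ t • f (x - t) = ρ t • c := by
    by_cases ht : t ∈ tsupport ρ
    · rw [hc t ht]
    · rw [image_eq_zero_of_notMem_tsupport ht, zero_smul, zero_smul]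
  simp only [mollify, hρc, integral_smul_const, h.integral_eq, one_smul]

end IsMollifier

lemma exists_contDiff_cutoff (A : Set E) {δ : ℝ} (hδ : 0 < δ) :
    ∃ χ : E → ℝ, ContDiff ℝ ∞ χ ∧ LipschitzWith δ.toNNReal⁻¹ χ ∧ (∀ x, 0 ≤ χ x ∧ χ x ≤ 1) ∧
      (∀ x ∈ thickening δ A, χ x = 1) ∧ ∀ x ∉ thickening (4 * δ) A, χ x = 0 := by
  obtain ⟨ρ, hρ, hρδ⟩ := exists_isMollifier (0 : E) hδ
  let f : E → ℝ := fun x => thickenedIndicator hδ (thickening (2 * δ) A) x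
  have hf : LipschitzWith δ.toNNReal⁻¹ f := lipschitzWith_thickenedIndicator hδ _
  have hf_le (x : E) : ‖f x‖ ≤ 1 := by
    rw [Real.norm_of_nonneg NNReal.zero_le_coe]
    exact_mod_cast thickenedIndicator_le_one hδ _ x
  have hdist {t : E} (ht : t ∈ tsupport ρ) (x : E) : dist (x - t) x ≤ δ := by
    simpa [hρδ, dist_eq_norm] using ht
  refine ⟨mollify ρ f, hρ.contDiff_mollify hf.continuous.locallyIntegrable,
    hρ.lipschitzWith_mollify hf, fun x => ⟨?_, ?_⟩, fun x hx => ?_, fun x hx => ?_⟩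
  · exact integral_nonneg fun t => mul_nonneg (hρ.nonneg t) NNReal.zero_le_coe
  · exact (le_abs_self _).trans (hρ.norm_integral_smul_le fun t => hf_le (x - t))
  · refine hρ.mollify_eq_of_forall fun t ht => ?_
    obtain ⟨a, ha, hxa⟩ := mem_thickening_iff.1 hx
    have hxt : x - t ∈ thickening (2 * δ) A :=
      mem_thickening_iff.2 ⟨a, ha, by linarith [dist_triangle (x - t) x a, hdist ht x]⟩
    exact congrArg NNReal.toReal (thickenedIndicator_one hδ _ hxt)
  · refine hρ.mollify_eq_of_forall fun t ht => ?_
    have hxt : x - t ∉ thickening δ (thickening (2 * δ) A) := fun hxt => hx <| by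
      obtain ⟨a, ha, hta⟩ := mem_thickening_iff.1 (thickening_thickening_subset _ _ _ hxt)
      exact mem_thickening_iff.2
        ⟨a, ha, by linarith [dist_triangle x (x - t) a, hdist ht x, dist_comm x (x - t)]⟩
    exact congrArg NNReal.toReal (thickenedIndicator_zero hδ _ hxt)

end Mollifiers

variable {d : ℕ} {Ω : Set (EuclideanSpace ℝ (Fin d))}

lemma norm_gradC_ofReal {χ : EuclideanSpace ℝ (Fin d) → ℝ} {x : EuclideanSpace ℝ (Fin d)}
    (hχ : DifferentiableAt ℝ χ x) : ‖gradC (fun x => (χ x : ℂ)) x‖ = ‖fderiv ℝ χ x‖ := by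
  have hderiv : fderiv ℝ (fun x => (χ x : ℂ)) x = Complex.ofRealCLM ∘L fderiv ℝ χ x :=
    (Complex.ofRealCLM.hasFDerivAt.comp x hχ.hasFDerivAt).fderiv
  have hcoord (i : Fin d) : gradC (fun x => (χ x : ℂ)) x i = (gradient χ x i : ℂ) := by
    have hinner := inner_gradient_left (𝕜 := ℝ) (f := χ) (x := x) (y := EuclideanSpace.single i 1)
    rw [EuclideanSpace.inner_single_right] at hinner
    simp [gradC, hderiv, ← hinner]
  rw [← (InnerProductSpace.toDual ℝ (EuclideanSpace ℝ (Fin d))).symm.norm_map (fderiv ℝ χ x),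
    ← gradient]
  simp [EuclideanSpace.norm_eq, hcoord]

lemma restrict_strip (Ω : Set (EuclideanSpace ℝ (Fin d))) (τ : ℝ) :
    volume.restrict (strip Ω τ) = (volume.restrict Ω).restrict (thickening τ Ωᶜ) := by
  rw [Measure.restrict_restrict isOpen_thickening.measurableSet, strip, inter_comm]

lemma continuous_eLpNorm_restrict {X F : Type*} [MeasurableSpace X] [NormedAddCommGroup F]
    [NormedSpace ℝ F] (μ : Measure X) (s : Set X) :
    Continuous fun f : Lp F 2 μ => eLpNorm f 2 (μ.restrict s) := by
  have hnorm (f : Lp F 2 μ) :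
      eLpNorm f 2 (μ.restrict s) = ‖LpToLpRestrictCLM X F ℝ μ 2 s f‖ₑ := by
    rw [Lp.enorm_def]
    exact eLpNorm_congr_ae (LpToLpRestrictCLM_coeFn ℝ s f).symm
  simp only [hnorm]
  fun_prop

lemma continuous_eLpNorm_strip {F : Type*} [NormedAddCommGroup F] [NormedSpace ℝ F]
    (τ : ℝ) :
    Continuous fun f : Lp F 2 (volume.restrict Ω) => eLpNorm f 2 (volume.restrict (strip Ω τ)) := by
  rw [restrict_strip]
  exact continuous_eLpNorm_restrict _ _

lemma tendsto_eLpNorm_strip {F : Type*} [NormedAddCommGroup F] (hΩ : IsOpen Ω)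
    (hb : Bornology.IsBounded Ω) (f : Lp F 2 (volume.restrict Ω)) :
    Filter.Tendsto (fun τ => eLpNorm f 2 (volume.restrict (strip Ω τ))) (𝓝[>] 0) (𝓝 0) := by
  have hmeas : Filter.Tendsto (fun τ => volume.restrict Ω (thickening τ Ωᶜ)) (𝓝[>] 0) (𝓝 0) := by
    have hfin : volume.restrict Ω (thickening 1 Ωᶜ) ≠ ⊤ :=
      ((measure_mono (subset_univ _)).trans_lt (by simpa using hb.measure_lt_top)).ne
    simpa [Measure.restrict_apply hΩ.measurableSet.compl] using
      tendsto_measure_thickening_of_isClosed ⟨1, one_pos, hfin⟩ hΩ.isClosed_compl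
  have hsq : ∫⁻ x in Ω, ‖f x‖ₑ ^ 2 ≠ ⊤ := by rw [← enorm_Lp_sq]; finiteness
  have hint := (tendsto_setLIntegral_zero hsq hmeas).ennrpow_const (1 / 2)
  rw [ENNReal.zero_rpow_of_pos one_half_pos] at hint
  refine hint.congr fun τ => ?_
  rw [← restrict_strip, eLpNorm_eq_lintegral_rpow_enorm_toReal two_ne_zero
    ENNReal.ofNat_ne_top]
  simp

end Cutoff

section TraceKernel

open scoped ENNReal NNReal
open Set Metric

variable {d : ℕ} {Ω : Set (EuclideanSpace ℝ (Fin d))}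

lemma isTestFunction_sub_mul {φ : EuclideanSpace ℝ (Fin d) → ℂ} (hφ : ContDiff ℝ ∞ φ)
    (hc : HasCompactSupport φ) {χ : EuclideanSpace ℝ (Fin d) → ℂ} (hχ : ContDiff ℝ ∞ χ) {δ : ℝ}
    (hδ : 0 < δ) (hχ_one : ∀ x ∈ thickening δ Ωᶜ, χ x = 1) :
    IsTestFunction Ω fun x => φ x - χ x * φ x where
  smooth := hφ.sub (hχ.mul hφ)
  compact := hc.sub hc.mul_left
  support := by
    have hsub : tsupport (fun x => φ x - χ x * φ x) ⊆ (thickening δ Ωᶜ)ᶜ := by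
      refine closure_minimal (fun x hx hxδ => hx ?_) isOpen_thickening.isClosed_compl
      simp [hχ_one x hxδ]
    exact hsub.trans (compl_subset_comm.1 (self_subset_thickening hδ _))

lemma enorm_val_restrictInterior (φ : smoothFunctions Ω) :
    ‖val Ω (restrictInterior Ω φ)‖ₑ
      = eLpNorm (φ : EuclideanSpace ℝ (Fin d) → ℂ) 2 (volume.restrict Ω) :=
  Lp.enorm_toLp (smoothFunctions_memLp Ω φ)

lemma enorm_grad_restrictInterior (φ : smoothFunctions Ω) :
    ‖grad Ω (restrictInterior Ω φ)‖ₑ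
      = eLpNorm (gradC (φ : EuclideanSpace ℝ (Fin d) → ℂ)) 2 (volume.restrict Ω) :=
  Lp.enorm_toLp (smoothFunctions_memLp_grad Ω φ)

lemma eLpNorm_val_restrictInterior_strip (φ : smoothFunctions Ω) (τ : ℝ) :
    eLpNorm (val Ω (restrictInterior Ω φ)) 2 (volume.restrict (strip Ω τ))
      = eLpNorm (φ : EuclideanSpace ℝ (Fin d) → ℂ) 2 (volume.restrict (strip Ω τ)) :=
  eLpNorm_congr_ae (ae_restrict_of_ae_restrict_of_subset inter_subset_left
    (val_restrictInterior_coeFn φ))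

lemma eLpNorm_grad_restrictInterior_strip (φ : smoothFunctions Ω) (τ : ℝ) :
    eLpNorm (grad Ω (restrictInterior Ω φ)) 2 (volume.restrict (strip Ω τ))
      = eLpNorm (gradC (φ : EuclideanSpace ℝ (Fin d) → ℂ)) 2 (volume.restrict (strip Ω τ)) :=
  eLpNorm_congr_ae (ae_restrict_of_ae_restrict_of_subset inter_subset_left
    (grad_restrictInterior_coeFn φ))

lemma exists_cutoff_strip (Ω : Set (EuclideanSpace ℝ (Fin d))) {δ : ℝ} (hδ : 0 < δ) :
    ∃ χ : EuclideanSpace ℝ (Fin d) → ℂ, ContDiff ℝ ∞ χ ∧ (∀ x, ‖χ x‖₊ ≤ 1) ∧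
      (∀ x, ‖gradC χ x‖₊ ≤ δ.toNNReal⁻¹) ∧ (∀ x ∈ thickening δ Ωᶜ, χ x = 1) ∧
      ∀ x ∉ thickening (4 * δ) Ωᶜ, χ x = 0 ∧ gradC χ x = 0 := by
  obtain ⟨χ, hχ, hlip, hmem, hone, hzero⟩ := exists_contDiff_cutoff Ωᶜ hδ
  have hdiff : Differentiable ℝ χ := hχ.differentiable (by simp)
  refine ⟨fun x => χ x, Complex.ofRealCLM.contDiff.comp hχ, fun x => ?_, fun x => ?_,
    fun x hx => by simp [hone x hx],
    fun x hx => ⟨by simp [hzero x hx], ?_⟩⟩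
  · rw [← NNReal.coe_le_coe, coe_nnnorm, Complex.norm_real, Real.norm_of_nonneg (hmem x).1]
    exact (hmem x).2
  · rw [← NNReal.coe_le_coe, coe_nnnorm, norm_gradC_ofReal (hdiff x)]
    exact norm_fderiv_le_of_lipschitz ℝ hlip
  · have hmin : IsLocalMin χ x := .of_forall fun y => (hzero x hx).trans_le (hmem y).1
    rw [← norm_eq_zero, norm_gradC_ofReal (hdiff x), hmin.fderiv_eq_zero, norm_zero]

lemma eLpNorm_mul_le_strip {χ : EuclideanSpace ℝ (Fin d) → ℂ} {δ : ℝ} (hχ_le : ∀ x, ‖χ x‖₊ ≤ 1)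
    (hχ_zero : ∀ x ∉ thickening δ Ωᶜ, χ x = 0) (φ : EuclideanSpace ℝ (Fin d) → ℂ) :
    eLpNorm (fun x => χ x * φ x) 2 (volume.restrict Ω)
      ≤ eLpNorm φ 2 (volume.restrict (strip Ω δ)) := by
  rw [← eLpNorm_restrict_eq_of_support_subset (s := thickening δ Ωᶜ), ← restrict_strip]
  · simpa using eLpNorm_smul_le_of_nnnorm_le hχ_le φ 2
  · exact fun x hx => by_contra fun hxδ => hx (by simp [hχ_zero x hxδ])

lemma eLpNorm_gradC_mul_le_strip {χ φ : EuclideanSpace ℝ (Fin d) → ℂ} (hχ : ContDiff ℝ ∞ χ)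
    (hφ : ContDiff ℝ ∞ φ) {B : ℝ≥0} {δ : ℝ} (hχ_le : ∀ x, ‖χ x‖₊ ≤ 1)
    (hgχ_le : ∀ x, ‖gradC χ x‖₊ ≤ B)
    (hχ_zero : ∀ x ∉ thickening δ Ωᶜ, χ x = 0 ∧ gradC χ x = 0) :
    eLpNorm (gradC fun x => χ x * φ x) 2 (volume.restrict Ω)
      ≤ B * eLpNorm φ 2 (volume.restrict (strip Ω δ))
        + eLpNorm (gradC φ) 2 (volume.restrict (strip Ω δ)) := by
  have hgrad : gradC (fun x => χ x * φ x) = (fun x => φ x • gradC χ x) + fun x => χ x • gradC φ x :=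
    funext fun x => gradC_mul hχ hφ x
  rw [← eLpNorm_restrict_eq_of_support_subset (s := thickening δ Ωᶜ), ← restrict_strip, hgrad]
  · refine (eLpNorm_add_le
      (hφ.continuous.smul (contDiff_gradC hχ).continuous).aestronglyMeasurable
      (hχ.continuous.smul (contDiff_gradC hφ).continuous).aestronglyMeasurable
      one_le_two).trans (add_le_add (eLpNorm_smul_le_of_nnnorm_le' hgχ_le φ 2) ?_)
    exact (eLpNorm_smul_le_of_nnnorm_le hχ_le (gradC φ) 2).trans_eq (one_mul _)
  · exact fun x hx => by_contra fun hxδ => hx (by simp [hgrad, hχ_zero x hxδ])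

namespace IsBoundedLipschitzDomain

lemma infEDist_restrictInterior_H10_le (hΩ : IsBoundedLipschitzDomain Ω) {δ : ℝ} (hδ : 0 < δ)
    (φ : smoothFunctions Ω) :
    infEDist (restrictInterior Ω φ) (H10 Ω) ≤
      eLpNorm (φ : EuclideanSpace ℝ (Fin d) → ℂ) 2 (volume.restrict (strip Ω (4 * δ)))
        + (δ.toNNReal⁻¹ * eLpNorm (φ : EuclideanSpace ℝ (Fin d) → ℂ) 2
            (volume.restrict (strip Ω (4 * δ)))
          + eLpNorm (gradC (φ : EuclideanSpace ℝ (Fin d) → ℂ)) 2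
            (volume.restrict (strip Ω (4 * δ)))) := by
  obtain ⟨χ, hχ, hχ_le, hgχ_le, hχ_one, hχ_zero⟩ := exists_cutoff_strip Ω hδ
  have hφ : ContDiff ℝ ∞ (φ : EuclideanSpace ℝ (Fin d) → ℂ) := φ.2.1
  let θ : smoothFunctions Ω := ⟨fun x => χ x * (φ : EuclideanSpace ℝ (Fin d) → ℂ) x, hχ.mul hφ,
    φ.2.2.1.mul_left, hΩ.memLp_boundary (hχ.mul hφ).continuous φ.2.2.1.mul_left⟩
  have hmem : restrictInterior Ω (φ - θ) ∈ H10 Ω :=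
    restrictInterior_mem_H10 _ (isTestFunction_sub_mul hφ φ.2.2.1 hχ hδ hχ_one)
  calc infEDist (restrictInterior Ω φ) (H10 Ω)
      ≤ edist (restrictInterior Ω φ) (restrictInterior Ω (φ - θ)) := infEDist_le_edist_of_mem hmem
    _ = ‖restrictInterior Ω θ‖ₑ := by rw [edist_eq_enorm_sub, map_sub, sub_sub_cancel]
    _ ≤ _ := by
      refine (enorm_H1_le _).trans (add_le_add ?_ ?_)
      · rw [enorm_val_restrictInterior]
        exact eLpNorm_mul_le_strip hχ_le (fun x hx => (hχ_zero x hx).1) _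
      · rw [enorm_grad_restrictInterior]
        exact eLpNorm_gradC_mul_le_strip hχ hφ hχ_le hgχ_le hχ_zero

lemma infEDist_H10_le (hΩ : IsBoundedLipschitzDomain Ω) {δ : ℝ} (hδ : 0 < δ) (u : H1 Ω) :
    infEDist u (H10 Ω) ≤ eLpNorm (valL Ω u) 2 (volume.restrict (strip Ω (4 * δ)))
      + (δ.toNNReal⁻¹ * eLpNorm (valL Ω u) 2 (volume.restrict (strip Ω (4 * δ)))
        + eLpNorm (gradL Ω u) 2 (volume.restrict (strip Ω (4 * δ)))) := by
  have hcv : Continuous fun u : H1 Ω =>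
      eLpNorm (valL Ω u) 2 (volume.restrict (strip Ω (4 * δ))) :=
    (continuous_eLpNorm_strip _).comp (valL Ω).continuous
  have hcg : Continuous fun u : H1 Ω =>
      eLpNorm (gradL Ω u) 2 (volume.restrict (strip Ω (4 * δ))) :=
    (continuous_eLpNorm_strip _).comp (gradL Ω).continuous
  refine hΩ.denseRange_restrictInterior.induction_on u (isClosed_le continuous_infEDist
    (hcv.add (((ENNReal.continuous_const_mul ENNReal.coe_ne_top).comp hcv).add hcg))) fun φ => ?_
  rw [valL_apply, gradL_apply,
    eLpNorm_val_restrictInterior_strip, eLpNorm_grad_restrictInterior_strip]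
  exact hΩ.infEDist_restrictInterior_H10_le hδ φ

lemma exists_eLpNorm_val_strip_sq_le (hΩ : IsBoundedLipschitzDomain Ω) :
    ∃ (C : ℝ≥0) (c τ₀ : ℝ), 0 < c ∧ 0 < τ₀ ∧ ∀ τ, 0 < τ → τ ≤ τ₀ → ∀ u : H1 Ω,
      eLpNorm (valL Ω u) 2 (volume.restrict (strip Ω (c * τ))) ^ 2 ≤
        C * (ENNReal.ofReal τ * ‖trace Ω u‖ₑ ^ 2
          + ENNReal.ofReal τ ^ 2 * eLpNorm (gradL Ω u) 2 (volume.restrict (strip Ω τ)) ^ 2) := by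
  obtain ⟨C, c, τ₀, hc, hτ₀, h⟩ := hΩ.strip_estimate
  refine ⟨C, c, τ₀, hc, hτ₀, fun τ hτ hττ₀ u => ?_⟩
  have hcv : Continuous fun u : H1 Ω =>
      eLpNorm (valL Ω u) 2 (volume.restrict (strip Ω (c * τ))) :=
    (continuous_eLpNorm_strip _).comp (valL Ω).continuous
  have hcg : Continuous fun u : H1 Ω => eLpNorm (gradL Ω u) 2 (volume.restrict (strip Ω τ)) :=
    (continuous_eLpNorm_strip _).comp (gradL Ω).continuous
  have hct : Continuous fun u : H1 Ω => ‖trace Ω u‖ₑ := (trace Ω).continuous.enorm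
  refine hΩ.denseRange_restrictInterior.induction_on u (isClosed_le
    ((ENNReal.continuous_pow 2).comp hcv) ((ENNReal.continuous_const_mul ENNReal.coe_ne_top).comp
      (((ENNReal.continuous_const_mul ENNReal.ofReal_ne_top).comp
        ((ENNReal.continuous_pow 2).comp hct)).add
      ((ENNReal.continuous_const_mul (by finiteness)).comp
        ((ENNReal.continuous_pow 2).comp hcg))))) fun φ => ?_
  rw [valL_apply, gradL_apply, hΩ.trace_restrictInterior, enorm_restrictBoundary_sq,
    eLpNorm_val_restrictInterior_strip, eLpNorm_grad_restrictInterior_strip,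
    eLpNorm_two_sq, eLpNorm_two_sq]
  exact h τ hτ hττ₀ φ φ.2.1

lemma exists_eLpNorm_val_strip_le_of_trace_eq_zero (hΩ : IsBoundedLipschitzDomain Ω) {u : H1 Ω}
    (hu : trace Ω u = 0) :
    ∃ (C : ℝ≥0) (c τ₀ : ℝ), 0 < c ∧ 0 < τ₀ ∧ ∀ τ, 0 < τ → τ ≤ τ₀ →
      eLpNorm (valL Ω u) 2 (volume.restrict (strip Ω (c * τ))) ≤
        C * ENNReal.ofReal τ * eLpNorm (gradL Ω u) 2 (volume.restrict (strip Ω τ)) := by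
  obtain ⟨C, c, τ₀, hc, hτ₀, hstrip⟩ := hΩ.exists_eLpNorm_val_strip_sq_le
  refine ⟨C + 1, c, τ₀, hc, hτ₀, fun τ hτ hττ₀ => ?_⟩
  have hsq := hstrip τ hτ hττ₀ u
  rw [hu, enorm_zero, zero_pow two_ne_zero, mul_zero, zero_add] at hsq
  rw [← ENNReal.pow_le_pow_left_iff two_ne_zero, mul_assoc, mul_pow, mul_pow _ (eLpNorm _ _ _)]
  refine hsq.trans (mul_le_mul_left ?_ _)
  rw [← ENNReal.coe_pow, ENNReal.coe_le_coe]
  exact (le_self_add (b := 1)).trans (le_self_pow le_add_self two_ne_zero)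

lemma exists_infEDist_H10_le (hΩ : IsBoundedLipschitzDomain Ω) {u : H1 Ω} (hu : trace Ω u = 0) :
    ∃ (C : ℝ≥0) (c τ₀ : ℝ), 0 < c ∧ 0 < τ₀ ∧ ∀ τ, 0 < τ → τ ≤ τ₀ → infEDist u (H10 Ω) ≤
      eLpNorm (valL Ω u) 2 (volume.restrict (strip Ω (c * τ)))
        + (C * eLpNorm (gradL Ω u) 2 (volume.restrict (strip Ω τ))
          + eLpNorm (gradL Ω u) 2 (volume.restrict (strip Ω (c * τ)))) := by
  obtain ⟨C, c, τ₀, hc, hτ₀, hstrip⟩ := hΩ.exists_eLpNorm_val_strip_le_of_trace_eq_zero hu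
  refine ⟨(4 / c).toNNReal * C, c, τ₀, hc, hτ₀, fun τ hτ hττ₀ => ?_⟩
  have hδ : 0 < c * τ / 4 := by positivity
  have hτc : (((c * τ / 4).toNNReal⁻¹ : ℝ≥0) : ℝ≥0∞) * ENNReal.ofReal τ
      = ENNReal.ofReal (4 / c) := by
    rw [ENNReal.coe_inv (by simpa using hδ), ← ENNReal.ofReal, ← ENNReal.ofReal_inv_of_pos hδ,
      ← ENNReal.ofReal_mul (by positivity)]
    congr 1
    field_simp
  have hdist := hΩ.infEDist_H10_le hδ u
  rw [mul_div_cancel₀ _ (four_ne_zero' ℝ)] at hdist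
  refine hdist.trans (add_le_add le_rfl (add_le_add ?_ le_rfl))
  calc _ ≤ _ := mul_le_mul_right (hstrip τ hτ hττ₀) _
    _ = _ := by
      rw [ENNReal.coe_mul, ← ENNReal.ofReal, ← hτc]
      ring

lemma mem_H10_of_trace_eq_zero (hΩ : IsBoundedLipschitzDomain Ω) {u : H1 Ω}
    (hu : trace Ω u = 0) : u ∈ H10 Ω := by
  obtain ⟨C, c, τ₀, hc, hτ₀, hle⟩ := hΩ.exists_infEDist_H10_le hu
  have hv_lim := tendsto_eLpNorm_strip hΩ.isOpen hΩ.isBounded (valL Ω u)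
  have hg_lim := tendsto_eLpNorm_strip hΩ.isOpen hΩ.isBounded (gradL Ω u)
  have hscale : Filter.Tendsto (fun τ => c * τ) (𝓝[>] 0) (𝓝[>] 0) := by
    refine tendsto_nhdsWithin_iff.2 ⟨?_, eventually_nhdsWithin_of_forall fun τ hτ => mul_pos hc hτ⟩
    exact (Continuous.tendsto' (by fun_prop) 0 0 (mul_zero c)).mono_left nhdsWithin_le_nhds
  have hlim := (hv_lim.comp hscale).add ((ENNReal.Tendsto.const_mul hg_lim
    (Or.inr (ENNReal.coe_ne_top (r := C)))).add (hg_lim.comp hscale))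
  rw [mul_zero, add_zero, add_zero] at hlim
  have hzero : infEDist u (H10 Ω) ≤ 0 := ge_of_tendsto hlim (by
    filter_upwards [Ioc_mem_nhdsGT hτ₀] with τ hτ using hle τ hτ.1 hτ.2)
  have hclosed : IsClosed (H10 Ω : Set (H1 Ω)) := Submodule.isClosed_topologicalClosure _
  rw [← SetLike.mem_coe, ← hclosed.closure_eq, mem_closure_iff_infEDist_zero]
  exact le_antisymm hzero bot_le

lemma trace_eq_zero_iff (hΩ : IsBoundedLipschitzDomain Ω) {u : H1 Ω} :
    trace Ω u = 0 ↔ u ∈ H10 Ω :=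
  ⟨hΩ.mem_H10_of_trace_eq_zero, hΩ.trace_eq_zero_of_mem_H10⟩

end IsBoundedLipschitzDomain

end TraceKernel

section CompactOperator

open Set Metric

variable {V H : Type*} [NormedAddCommGroup V] [NormedAddCommGroup H]

lemma isCompactOperator_of_forall_exists_norm_le [NormedSpace ℂ V] [NormedSpace ℂ H]
    {F : Type*} [NormedAddCommGroup F] [NormedSpace ℂ F] [CompleteSpace H] {T : V →L[ℂ] H}
    (h : ∀ ε > 0, ∃ S : V →L[ℂ] F, IsCompactOperator S ∧ ∀ u, ‖T u‖ ≤ ε * ‖u‖ + ‖S u‖) :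
    IsCompactOperator T := by
  suffices TotallyBounded (T '' ball 0 1) from
    (isCompactOperator_iff_isCompact_closure_image_ball T.toLinearMap one_pos).2
      (this.closure.isCompact_of_isClosed isClosed_closure)
  refine totallyBounded_iff.2 fun ε hε => ?_
  obtain ⟨S, hS, hTS⟩ := h (ε / 4) (by positivity)
  obtain ⟨t, ht, htfin, hcover⟩ := exists_subset_image_finite_and.1 <|
    finite_approx_of_totallyBounded ((hS.isCompact_closure_image_ball (f := S.toLinearMap)
      1).totallyBounded.subset subset_closure) (ε / 2) (half_pos hε)
  refine ⟨T '' t, htfin.image T, ?_⟩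
  rintro _ ⟨u, hu, rfl⟩
  obtain ⟨_, ⟨v, hv, rfl⟩, huv⟩ := mem_iUnion₂.1 (hcover (mem_image_of_mem S hu))
  refine mem_iUnion₂.2 ⟨T v, mem_image_of_mem T hv, ?_⟩
  have hdist : ‖u - v‖ < 2 := by
    linarith [norm_sub_le u v, mem_ball_zero_iff.1 hu, mem_ball_zero_iff.1 (ht hv)]
  have hS_lt : ‖S (u - v)‖ < ε / 2 := by simpa [dist_eq_norm] using huv
  rw [mem_ball, dist_eq_norm, ← map_sub]
  nlinarith [hTS (u - v)]

lemma exists_isCompactOperator_norm_inner_le [InnerProductSpace ℂ H] {K : Set H}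
    (hK : IsCompact K) {η : ℝ} (hη : 0 < η) :
    ∃ P : H →L[ℂ] H, IsCompactOperator P ∧ ∀ k ∈ K, ∀ u, ‖⟪k, u⟫_ℂ‖ ≤ η * ‖u‖ + ‖P u‖ := by
  obtain ⟨t, htK, htfin, hcover⟩ := hK.finite_cover_balls hη
  obtain ⟨M, hM⟩ := isBounded_iff_forall_norm_le.1 hK.isBounded
  have := FiniteDimensional.span_of_finite ℂ htfin
  let Q := (Submodule.span ℂ t).starProjection
  have hQ : IsCompactOperator Q :=
    (isCompactOperator_of_locallyCompactSpace_rng (Submodule.span ℂ t).subtypeL).comp_clm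
      (Submodule.span ℂ t).orthogonalProjectionOnto
  refine ⟨(M : ℂ) • Q, hQ.smul (M : ℂ), fun k hk u => ?_⟩
  obtain ⟨y, hy, hky⟩ := mem_iUnion₂.1 (hcover hk)
  have hyQ : ⟪y, u⟫_ℂ = ⟪y, Q u⟫_ℂ := by
    rw [← Submodule.inner_starProjection_left_eq_right,
      Submodule.starProjection_eq_self_iff.2 (Submodule.subset_span hy)]
  have hM_nonneg : 0 ≤ M := (norm_nonneg k).trans (hM k hk)
  calc ‖⟪k, u⟫_ℂ‖ = ‖⟪k - y, u⟫_ℂ + ⟪y, Q u⟫_ℂ‖ := by rw [← hyQ, inner_sub_left, sub_add_cancel]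
    _ ≤ ‖k - y‖ * ‖u‖ + ‖y‖ * ‖Q u‖ :=
      (norm_add_le _ _).trans (add_le_add (norm_inner_le_norm _ _) (norm_inner_le_norm _ _))
    _ ≤ η * ‖u‖ + M * ‖Q u‖ := by
      gcongr
      · exact (mem_ball_iff_norm.1 hky).le
      · exact hM y (htK hy)
    _ = η * ‖u‖ + ‖((M : ℂ) • Q) u‖ := by
      rw [smul_apply, norm_smul, Complex.norm_real, Real.norm_of_nonneg hM_nonneg]

end CompactOperator

section Rellich

open scoped ENNReal NNReal ComplexConjugate
open Set Metric

variable {d : ℕ} {Ω : Set (EuclideanSpace ℝ (Fin d))}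

lemma enorm_translate_sub_sq_le {φ : EuclideanSpace ℝ (Fin d) → ℂ} (hφ : ContDiff ℝ ∞ φ)
    (x e : EuclideanSpace ℝ (Fin d)) :
    ‖φ (x + e) - φ x‖ₑ ^ 2 ≤
      2 * ‖e‖ₑ ^ 2 * ∫⁻ θ in Ioo (0 : ℝ) 1, ‖gradC φ (x + θ • e)‖ₑ ^ 2 := by
  have hm : Measurable fun θ : ℝ => ‖gradC φ (x + θ • e)‖ₑ ^ 2 :=
    ((contDiff_gradC hφ).continuous.comp (by fun_prop)).measurable.enorm.pow_const 2
  have hderiv := enorm_sq_le_of_hasDerivAt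
    (fun θ => (hasDerivAt_comp_add_smul hφ x e θ).sub_const (φ x))
    (continuous_fderiv_comp_add_smul hφ x e) (s := 1) (a := 1) (b := 0) (by simp) (by simp)
  simp only [one_smul, zero_smul, add_zero, sub_self, enorm_zero, ENNReal.ofReal_one, mul_one,
    zero_pow two_ne_zero, mul_zero, zero_add] at hderiv
  rw [mul_assoc, ← lintegral_const_mul _ hm]
  refine hderiv.trans (mul_le_mul_right (lintegral_mono fun θ => ?_) _)
  rw [← mul_pow, ← enorm_norm e, ← enorm_norm (gradC φ _), ← enorm_mul]
  gcongr
  exact enorm_le_iff_norm_le.2 (by simpa using norm_fderiv_apply_le φ (x + θ • e) e)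

lemma lintegral_translate_sub_le (hΩ : MeasurableSet Ω) {φ : EuclideanSpace ℝ (Fin d) → ℂ}
    (hφ : ContDiff ℝ ∞ φ) {A : Set (EuclideanSpace ℝ (Fin d))} (hA : MeasurableSet A)
    {e : EuclideanSpace ℝ (Fin d)} (hAΩ : ∀ x ∈ A, ∀ θ ∈ Ioo (0 : ℝ) 1, x + θ • e ∈ Ω) :
    ∫⁻ x in A, ‖φ (x + e) - φ x‖ₑ ^ 2 ≤ 2 * ‖e‖ₑ ^ 2 * ∫⁻ x in Ω, ‖gradC φ x‖ₑ ^ 2 := by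
  have hm : Measurable fun q : EuclideanSpace ℝ (Fin d) × ℝ => ‖gradC φ (q.1 + q.2 • e)‖ₑ ^ 2 :=
    ((contDiff_gradC hφ).continuous.comp (by fun_prop)).measurable.enorm.pow_const 2
  have hshift (θ : ℝ) (hθ : θ ∈ Ioo (0 : ℝ) 1) :
      ∫⁻ x in A, ‖gradC φ (x + θ • e)‖ₑ ^ 2 ≤ ∫⁻ x in Ω, ‖gradC φ x‖ₑ ^ 2 := by
    rw [← lintegral_indicator hA, ← lintegral_indicator hΩ,
      ← lintegral_add_right_eq_self (Ω.indicator fun x => ‖gradC φ x‖ₑ ^ 2) (θ • e)]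
    refine lintegral_mono fun x => ?_
    by_cases hx : x ∈ A
    · rw [indicator_of_mem hx, indicator_of_mem (hAΩ x hx θ hθ)]
    · rw [indicator_of_notMem hx]
      exact zero_le
  calc ∫⁻ x in A, ‖φ (x + e) - φ x‖ₑ ^ 2
      ≤ ∫⁻ x in A, 2 * ‖e‖ₑ ^ 2 * ∫⁻ θ in Ioo (0 : ℝ) 1, ‖gradC φ (x + θ • e)‖ₑ ^ 2 :=
        lintegral_mono fun x => enorm_translate_sub_sq_le hφ x e
    _ = 2 * ‖e‖ₑ ^ 2 * ∫⁻ θ in Ioo (0 : ℝ) 1, ∫⁻ x in A, ‖gradC φ (x + θ • e)‖ₑ ^ 2 := by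
        rw [lintegral_const_mul' _ _ (by finiteness), lintegral_lintegral_swap hm.aemeasurable]
    _ ≤ 2 * ‖e‖ₑ ^ 2 * ∫⁻ _ in Ioo (0 : ℝ) 1, ∫⁻ x in Ω, ‖gradC φ x‖ₑ ^ 2 := by
        gcongr 2 * ‖e‖ₑ ^ 2 * ?_
        exact setLIntegral_mono measurable_const hshift
    _ = 2 * ‖e‖ₑ ^ 2 * ∫⁻ x in Ω, ‖gradC φ x‖ₑ ^ 2 := by simp

namespace IsMollifier

variable {ρ : EuclideanSpace ℝ (Fin d) → ℝ}

lemma eLpNorm_mollify_sub_le (hρ : IsMollifier ρ) {s : ℝ}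
    (hρs : tsupport ρ ⊆ closedBall 0 s) (hΩ : MeasurableSet Ω)
    {A : Set (EuclideanSpace ℝ (Fin d))} (hA : MeasurableSet A)
    (hAΩ : ∀ x ∈ A, closedBall x s ⊆ Ω) {φ : EuclideanSpace ℝ (Fin d) → ℂ}
    (hφ : ContDiff ℝ ∞ φ) :
    eLpNorm (mollify ρ φ - φ) 2 (volume.restrict A) ≤
      ENNReal.ofReal (2 * s) * eLpNorm (gradC φ) 2 (volume.restrict Ω) := by
  rw [← ENNReal.pow_le_pow_left_iff two_ne_zero, mul_pow, eLpNorm_two_sq, eLpNorm_two_sq]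
  refine hρ.lintegral_mollify_sub_le hφ.continuous.measurable hφ.continuous.locallyIntegrable
    fun t ht => ?_
  have hts : ‖-t‖ ≤ s := by simpa using hρs ht
  simp only [sub_eq_add_neg _ t]
  refine (lintegral_translate_sub_le hΩ hφ hA fun x hx θ hθ => hAΩ x hx ?_).trans
    (mul_le_mul_left ?_ _)
  · rw [mem_closedBall_iff_norm, add_sub_cancel_left, norm_smul, Real.norm_of_nonneg hθ.1.le]
    exact (mul_le_of_le_one_left (norm_nonneg _) hθ.2.le).trans hts
  · rw [ENNReal.ofReal_mul zero_le_two, ENNReal.ofReal_ofNat, mul_pow]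
    gcongr
    · norm_num
    · rw [← ofReal_norm]
      exact ENNReal.ofReal_le_ofReal hts

lemma eLpNorm_le_mollify_add (hρ : IsMollifier ρ) {s : ℝ}
    (hρs : tsupport ρ ⊆ closedBall 0 s) (hΩ : MeasurableSet Ω)
    {A : Set (EuclideanSpace ℝ (Fin d))} (hA : MeasurableSet A)
    (hAΩ : ∀ x ∈ A, closedBall x s ⊆ Ω) {φ : EuclideanSpace ℝ (Fin d) → ℂ}
    (hφ : ContDiff ℝ ∞ φ) :
    eLpNorm φ 2 (volume.restrict A) ≤ eLpNorm (mollify ρ φ) 2 (volume.restrict A)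
      + ENNReal.ofReal (2 * s) * eLpNorm (gradC φ) 2 (volume.restrict Ω) := by
  have hmollify : Continuous (mollify ρ φ) :=
    (hρ.contDiff_mollify hφ.continuous.locallyIntegrable).continuous
  calc eLpNorm φ 2 (volume.restrict A)
      = eLpNorm (mollify ρ φ - (mollify ρ φ - φ)) 2 (volume.restrict A) := by rw [sub_sub_cancel]
    _ ≤ eLpNorm (mollify ρ φ) 2 (volume.restrict A)
        + eLpNorm (mollify ρ φ - φ) 2 (volume.restrict A) :=
      eLpNorm_sub_le hmollify.aestronglyMeasurable
        (hmollify.sub hφ.continuous).aestronglyMeasurable one_le_two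
    _ ≤ _ := add_le_add le_rfl (hρ.eLpNorm_mollify_sub_le hρs hΩ hA hAΩ hφ)

lemma exists_continuous_kernel (hρ : IsMollifier ρ) (Ω : Set (EuclideanSpace ℝ (Fin d))) :
    ∃ k : EuclideanSpace ℝ (Fin d) → L2 Ω, Continuous k ∧
      ∀ x, k x =ᵐ[volume.restrict Ω] fun t => (ρ (x - t) : ℂ) := by
  have hρL : MemLp (fun t => (ρ t : ℂ)) 2 volume :=
    (hρ.smooth.continuous.memLp_of_hasCompactSupport hρ.compact).ofReal
  let reflect (x : EuclideanSpace ℝ (Fin d)) :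
      C(EuclideanSpace ℝ (Fin d), EuclideanSpace ℝ (Fin d)) := ⟨fun t => x - t, by fun_prop⟩
  have hreflect : Continuous reflect :=
    ContinuousMap.continuous_of_continuous_uncurry _ (continuous_fst.sub continuous_snd)
  have hpres (x) : MeasurePreserving (reflect x) volume volume :=
    Measure.measurePreserving_sub_left volume x
  refine ⟨fun x => LpToLpRestrictCLM _ ℂ ℂ volume 2 Ω
    (Lp.compMeasurePreserving (reflect x) (hpres x) (hρL.toLp _)),
    (ContinuousLinearMap.continuous _).comp
      (continuous_const.compMeasurePreservingLp hreflect hpres (by norm_num)), fun x => ?_⟩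
  exact (LpToLpRestrictCLM_coeFn ℂ Ω _).trans <| ae_restrict_of_ae <|
    (Lp.coeFn_compMeasurePreserving _ (hpres x)).trans
      ((hpres x).quasiMeasurePreserving.ae_eq_comp hρL.coeFn_toLp)

lemma mollify_eq_inner {x : EuclideanSpace ℝ (Fin d)} (hx : ∀ t ∈ tsupport ρ, x - t ∈ Ω)
    {k : L2 Ω} (hk : k =ᵐ[volume.restrict Ω] fun t => (ρ (x - t) : ℂ)) (φ : smoothFunctions Ω) :
    mollify ρ φ x = ⟪k, val Ω (restrictInterior Ω φ)⟫_ℂ := by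
  have hsupp (t) (ht : t ∉ Ω) :
      ρ (x - t) • (φ : EuclideanSpace ℝ (Fin d) → ℂ) t = 0 := by
    rw [image_eq_zero_of_notMem_tsupport (f := ρ), zero_smul]
    exact fun hxt => ht (by simpa using hx _ hxt)
  rw [mollify_eq_swap, L2.inner_def, ← setIntegral_eq_integral_of_forall_compl_eq_zero hsupp]
  refine integral_congr_ae ?_
  filter_upwards [hk, val_restrictInterior_coeFn φ] with t hkt hφt
  rw [hkt, hφt]
  simp [RCLike.inner_apply, mul_comm]

lemma exists_eLpNorm_mollify_le (hρ : IsMollifier ρ) {A : Set (EuclideanSpace ℝ (Fin d))}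
    (hA : MeasurableSet A) (hb : Bornology.IsBounded A)
    (hAΩ : ∀ x ∈ A, ∀ t ∈ tsupport ρ, x - t ∈ Ω) {ε : ℝ} (hε : 0 < ε) :
    ∃ P : L2 Ω →L[ℂ] L2 Ω, IsCompactOperator P ∧ ∀ φ : smoothFunctions Ω,
      eLpNorm (mollify ρ (φ : EuclideanSpace ℝ (Fin d) → ℂ)) 2 (volume.restrict A) ≤
        ENNReal.ofReal (ε * ‖val Ω (restrictInterior Ω φ)‖
          + ‖P (val Ω (restrictInterior Ω φ))‖) := by
  obtain ⟨k, hk, hkρ⟩ := hρ.exists_continuous_kernel Ω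
  obtain ⟨c, hc⟩ : ∃ c : ℝ≥0, (c : ℝ≥0∞) = (volume.restrict A) univ ^ (2 : ℝ≥0∞).toReal⁻¹ := by
    rw [Measure.restrict_apply_univ]
    exact WithTop.ne_top_iff_exists.1
      (ENNReal.rpow_ne_top_of_nonneg (by positivity) hb.measure_lt_top.ne)
  have hηc : c * (ε / (c + 1)) ≤ ε := by
    rw [mul_div_left_comm]
    exact mul_le_of_le_one_right hε.le (div_le_one_of_le₀ (by simp) (by positivity))
  obtain ⟨P, hP, hkP⟩ := exists_isCompactOperator_norm_inner_le
    (hb.isCompact_closure.image hk) (η := ε / (c + 1)) (by positivity)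
  refine ⟨(c : ℂ) • P, hP.smul (c : ℂ), fun φ => ?_⟩
  set u := val Ω (restrictInterior Ω φ)
  have hbound : ∀ᵐ x ∂volume.restrict A,
      ‖mollify ρ (φ : EuclideanSpace ℝ (Fin d) → ℂ) x‖ ≤ ε / (c + 1) * ‖u‖ + ‖P u‖ := by
    filter_upwards [ae_restrict_mem hA] with x hx
    rw [mollify_eq_inner (hAΩ x hx) (hkρ x)]
    exact hkP _ (mem_image_of_mem k (subset_closure hx)) u
  refine (eLpNorm_le_of_ae_bound hbound).trans ?_
  rw [← hc, ← ENNReal.ofReal_coe_nnreal, ← ENNReal.ofReal_mul c.coe_nonneg]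
  refine ENNReal.ofReal_le_ofReal ?_
  rw [smul_apply, norm_smul, Complex.norm_real, NNReal.norm_eq, mul_add, ← mul_assoc]
  gcongr

end IsMollifier

lemma exists_eLpNorm_interior_le (hΩ : IsOpen Ω) (hb : Bornology.IsBounded Ω) {r ε : ℝ}
    (hr : 0 < r) (hε : 0 < ε) :
    ∃ P : L2 Ω →L[ℂ] L2 Ω, IsCompactOperator P ∧ ∀ φ : smoothFunctions Ω,
      eLpNorm (φ : EuclideanSpace ℝ (Fin d) → ℂ) 2 (volume.restrict (Ω \ thickening r Ωᶜ)) ≤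
        ENNReal.ofReal (ε * ‖restrictInterior Ω φ‖ + ‖P (val Ω (restrictInterior Ω φ))‖) := by
  set A := Ω \ thickening r Ωᶜ
  have hA : MeasurableSet A := hΩ.measurableSet.diff isOpen_thickening.measurableSet
  set s := min (r / 2) (ε / 4)
  have hs : 0 < s := by positivity
  have hball (x) (hx : x ∈ A) : closedBall x s ⊆ Ω := fun y hy => by
    by_contra hyΩ
    refine hx.2 (mem_thickening_iff.2 ⟨y, hyΩ, ?_⟩)
    rw [dist_comm]
    linarith [mem_closedBall.1 hy, min_le_left (r / 2) (ε / 4)]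
  obtain ⟨ρ, hρ, hρs⟩ := exists_isMollifier (0 : EuclideanSpace ℝ (Fin d)) hs
  obtain ⟨P, hP, hbound⟩ := hρ.exists_eLpNorm_mollify_le (Ω := Ω) hA (hb.subset sdiff_subset)
    (fun x hx t ht => hball x hx (by simpa [hρs] using ht)) (half_pos hε)
  refine ⟨P, hP, fun φ => ?_⟩
  set w := restrictInterior Ω φ
  have hgrad : eLpNorm (gradC (φ : EuclideanSpace ℝ (Fin d) → ℂ)) 2 (volume.restrict Ω) ≤
      ENNReal.ofReal ‖w‖ := by
    rw [← enorm_grad_restrictInterior, ← ofReal_norm]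
    exact ENNReal.ofReal_le_ofReal (norm_grad_le w)
  calc eLpNorm (φ : EuclideanSpace ℝ (Fin d) → ℂ) 2 (volume.restrict A)
      ≤ ENNReal.ofReal (ε / 2 * ‖val Ω w‖ + ‖P (val Ω w)‖)
        + ENNReal.ofReal (2 * s) * ENNReal.ofReal ‖w‖ :=
      (hρ.eLpNorm_le_mollify_add hρs.le hΩ.measurableSet hA hball φ.2.1).trans
        (add_le_add (hbound φ) (mul_le_mul_right hgrad _))
    _ ≤ ENNReal.ofReal (ε * ‖w‖ + ‖P (val Ω w)‖) := by
      rw [← ENNReal.ofReal_mul (by positivity),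
          ← ENNReal.ofReal_add (by positivity) (by positivity)]
      refine ENNReal.ofReal_le_ofReal ?_
      nlinarith [norm_nonneg w, norm_val_le w, min_le_right (r / 2) (ε / 4)]

lemma eLpNorm_le_restrict_add_restrict_compl {X F : Type*} [MeasurableSpace X] {μ : Measure X}
    [NormedAddCommGroup F] {f : X → F} (hf : AEStronglyMeasurable f μ) {s : Set X}
    (hs : MeasurableSet s) {p : ℝ≥0∞} (hp : 1 ≤ p) :
    eLpNorm f p μ ≤ eLpNorm f p (μ.restrict s) + eLpNorm f p (μ.restrict sᶜ) := by
  rw [← eLpNorm_indicator_eq_eLpNorm_restrict hs,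
    ← eLpNorm_indicator_eq_eLpNorm_restrict hs.compl]
  nth_rw 1 [← indicator_self_add_compl s f]
  exact eLpNorm_add_le (hf.indicator hs) (hf.indicator hs.compl) hp

namespace IsBoundedLipschitzDomain

lemma exists_eLpNorm_val_strip_le (hΩ : IsBoundedLipschitzDomain Ω) {ε : ℝ≥0∞} (hε : 0 < ε) :
    ∃ r > 0, ∀ u : H1 Ω, eLpNorm (valL Ω u) 2 (volume.restrict (strip Ω r)) ≤ ε * ‖u‖ₑ := by
  obtain ⟨C, c, τ₀, hc, hτ₀, hstrip⟩ := hΩ.exists_eLpNorm_val_strip_sq_le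
  have hcont : Continuous fun τ : ℝ =>
      C * (ENNReal.ofReal τ * ‖trace Ω‖ₑ ^ 2 + ENNReal.ofReal τ ^ 2) := by
    have hM : ‖trace Ω‖ₑ ^ 2 ≠ ⊤ := by finiteness
    exact (ENNReal.continuous_const_mul ENNReal.coe_ne_top).comp
      (((ENNReal.continuous_mul_const hM).comp ENNReal.continuous_ofReal).add
        ((ENNReal.continuous_pow 2).comp ENNReal.continuous_ofReal))
  have hsmall := (hcont.tendsto' 0 0 (by simp)).mono_left (nhdsWithin_le_nhds (s := Ioi 0))
  obtain ⟨τ, hτε, hτ⟩ := ((hsmall.eventually_le_const (show 0 < ε ^ 2 by positivity)).and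
    (Ioc_mem_nhdsGT hτ₀)).exists
  refine ⟨c * τ, mul_pos hc hτ.1, fun u => ?_⟩
  have hgrad : eLpNorm (gradL Ω u) 2 (volume.restrict (strip Ω τ)) ≤ ‖u‖ₑ :=
    (eLpNorm_mono_measure _ (Measure.restrict_mono inter_subset_left le_rfl)).trans
      ((Lp.enorm_def _).symm.trans_le (enorm_le_iff_norm_le.2 (norm_grad_le u)))
  have htrace : ‖trace Ω u‖ₑ ≤ ‖trace Ω‖ₑ * ‖u‖ₑ := (trace Ω).le_opENorm u
  rw [← ENNReal.pow_le_pow_left_iff two_ne_zero, mul_pow]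
  calc eLpNorm (valL Ω u) 2 (volume.restrict (strip Ω (c * τ))) ^ 2
      ≤ C * (ENNReal.ofReal τ * ‖trace Ω u‖ₑ ^ 2 + ENNReal.ofReal τ ^ 2 *
        eLpNorm (gradL Ω u) 2 (volume.restrict (strip Ω τ)) ^ 2) := hstrip τ hτ.1 hτ.2 u
    _ ≤ C * (ENNReal.ofReal τ * (‖trace Ω‖ₑ * ‖u‖ₑ) ^ 2 + ENNReal.ofReal τ ^ 2 * ‖u‖ₑ ^ 2) := by
      gcongr
    _ = C * (ENNReal.ofReal τ * ‖trace Ω‖ₑ ^ 2 + ENNReal.ofReal τ ^ 2) * ‖u‖ₑ ^ 2 := by ring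
    _ ≤ ε ^ 2 * ‖u‖ₑ ^ 2 := by gcongr

lemma isCompactOperator_valL (hΩ : IsBoundedLipschitzDomain Ω) : IsCompactOperator (valL Ω) := by
  refine isCompactOperator_of_forall_exists_norm_le (F := L2 Ω) fun ε hε => ?_
  obtain ⟨r, hr, hstrip⟩ := hΩ.exists_eLpNorm_val_strip_le (ENNReal.ofReal_pos.2 (half_pos hε))
  obtain ⟨P, hP, hinterior⟩ := exists_eLpNorm_interior_le hΩ.isOpen hΩ.isBounded hr (half_pos hε)
  refine ⟨P ∘L valL Ω, hP.comp_clm (valL Ω), fun u => ?_⟩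
  refine hΩ.denseRange_restrictInterior.induction_on u
    (isClosed_le (by fun_prop) (by fun_prop)) fun φ => ?_
  set w := restrictInterior Ω φ
  have hφ := φ.2.1.continuous.aestronglyMeasurable (μ := volume.restrict Ω)
  have hsplit : ‖valL Ω w‖ₑ ≤ ENNReal.ofReal (ε / 2) * ENNReal.ofReal ‖w‖
      + ENNReal.ofReal (ε / 2 * ‖w‖ + ‖P (valL Ω w)‖) := by
    rw [valL_apply, enorm_val_restrictInterior]
    refine (eLpNorm_le_restrict_add_restrict_compl hφ isOpen_thickening.measurableSet
      (s := thickening r Ωᶜ) one_le_two).trans (add_le_add ?_ ?_)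
    · rw [← restrict_strip, ← eLpNorm_val_restrictInterior_strip, ofReal_norm]
      exact hstrip w
    · rw [Measure.restrict_restrict isOpen_thickening.measurableSet.compl, inter_comm,
        ← sdiff_eq]
      exact hinterior φ
  rw [← ofReal_norm, ← ENNReal.ofReal_mul (by positivity),
    ← ENNReal.ofReal_add (by positivity) (by positivity),
    ENNReal.ofReal_le_ofReal_iff (by positivity)] at hsplit
  rw [ContinuousLinearMap.comp_apply]
  linarith

lemma isCompactOperator_trace (hΩ : IsBoundedLipschitzDomain Ω) : IsCompactOperator (trace Ω) := by
  refine isCompactOperator_of_forall_exists_norm_le (F := L2 Ω) fun ε hε => ?_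
  obtain ⟨C, hC, htrace⟩ := hΩ.trace_sq_le hε
  refine ⟨(C : ℂ) • valL Ω, hΩ.isCompactOperator_valL.smul (C : ℂ), fun u => ?_⟩
  rw [smul_apply, norm_smul, Complex.norm_real, Real.norm_of_nonneg hC]
  refine le_of_sq_le_sq ((htrace u).trans ?_) (by positivity)
  nlinarith [mul_nonneg (mul_nonneg hε.le (norm_nonneg u)) (mul_nonneg hC (norm_nonneg (valL Ω u)))]

lemma isTraceSetting (hΩ : IsBoundedLipschitzDomain Ω) :
    IsTraceSetting (valL Ω) (trace Ω) (pullInner (grad Ω)) (H10 Ω) where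
  inner_eq := inner_H1
  injective := injective_val hΩ.isOpen
  denseRange := denseRange_val_H10 hΩ.isOpen
  denseRange_trace := hΩ.denseRange_trace
  ker_trace _ := hΩ.trace_eq_zero_iff
  isCompactOperator := hΩ.isCompactOperator_valL
  isCompactOperator_trace := hΩ.isCompactOperator_trace

end IsBoundedLipschitzDomain

end Rellich

end RobinDN

end

theorem theorem7p5_general {d : ℕ} {Ω : Set (EuclideanSpace ℝ (Fin d))}
    (hΩ : RobinDN.IsBoundedLipschitzDomain Ω) (α lam : ℂ)
    (hlam : lam ∈ RobinDN.resolventSet (RobinDN.dirichletLaplacian Ω)) :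
    (lam ∈ RobinDN.opSpectrum (RobinDN.robinLaplacian Ω α) ↔
      α ∈ RobinDN.opSpectrum (RobinDN.dnOperator Ω lam)) ∧
    (RobinDN.IsEigenvalue (RobinDN.robinLaplacian Ω α) lam ↔
      RobinDN.IsEigenvalue (RobinDN.dnOperator Ω lam) α) ∧
    (∀ u : RobinDN.H1 Ω,
      RobinDN.IsEigenfunction (RobinDN.robinLaplacian Ω α) lam (RobinDN.val Ω u) ↔
        u ∈ RobinDN.helmholtzSpace Ω lam ∧
          RobinDN.IsEigenfunction (RobinDN.dnOperator Ω lam) α (RobinDN.trace Ω u)) := by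
  have h := hΩ.isTraceSetting
  have hW : ∀ u, u ∈ RobinDN.helmholtzSpace Ω lam ↔ _ := fun _ => Iff.rfl
  have hDW := h.isCompl hW hlam
  exact ⟨h.mem_opSpectrum_robin_iff hW hDW, h.isEigenvalue_robin_iff hW hDW,
    h.isEigenfunction_robin_iff hW hDW⟩

theorem theorem7p5 {d : ℕ} (hd : 2 ≤ d) {Ω : Set (EuclideanSpace ℝ (Fin d))}
    (hΩ : RobinDN.IsBoundedLipschitzDomain Ω) (α lam : ℂ)
    (hlam : lam ∈ RobinDN.resolventSet (RobinDN.dirichletLaplacian Ω)) :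
    (lam ∈ RobinDN.opSpectrum (RobinDN.robinLaplacian Ω α) ↔
      α ∈ RobinDN.opSpectrum (RobinDN.dnOperator Ω lam)) ∧
    (RobinDN.IsEigenvalue (RobinDN.robinLaplacian Ω α) lam ↔
      RobinDN.IsEigenvalue (RobinDN.dnOperator Ω lam) α) ∧
    (∀ u : RobinDN.H1 Ω,
      RobinDN.IsEigenfunction (RobinDN.robinLaplacian Ω α) lam (RobinDN.val Ω u) ↔
        u ∈ RobinDN.helmholtzSpace Ω lam ∧
          RobinDN.IsEigenfunction (RobinDN.dnOperator Ω lam) α (RobinDN.trace Ω u)) :=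
  theorem7p5_general hΩ α lam hlam
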